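/- **Setting.** Let $g\ge 1$ and let $X$ be the compact hyperelliptic Riemann surface of genus $g$ given by $y^2=p(x)$, where $p\in\mathbb C[x]$ has no multiple zeros and degree $n=2g+1$ or $n=2g+2$. Let $T$ be the Virasoro field of central charge $c\in\mathbb C$ and let $\langle\ \rangle$ be a state on $X$ with $\langle 1\rangle\neq 0$. That is, for all $N\ge 0$ and all choices of local coordinates on $X$ one is given the $N$-point function $\langle T(z_1)\cdots T(z_N)\rangle$; these functions are symmetric, and holomorphic at pairwise distinct points; under a change of coordinates $z\mapsto\hat z$ one has, in each argument, $T(z)=\hat T(\hat z)\,[\hat z']^2+\frac{c}{12}S(\hat z)\cdot 1$ with the Schwarzian derivative $S(f)=\frac{f'''}{f'}-\frac32\big(\frac{f''}{f'}\big)^2$; and in every local coordinate and inside every $N$-point function $$T(z)T(w)\mapsto\frac{c/2}{(z-w)^4}\,1+\frac{T(z)+T(w)}{(z-w)^2}+\Phi(w)+O(z-w).$$ Let $T(x)$ be the field in the coordinate $x$, which is a local coordinate where $y\ne 0$. For points $(x_i,y_i)$ of $X$ with $y_i\neq0$, write $p_i=p(x_i)$, $p_i'=p'(x_i)$. The connected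 functions are $\langle T(x_1)\rangle_c=\langle1\rangle^{-1}\langle T(x_1)\rangle$, $\langle T(x_1)T(x_2)\rangle_c=\langle1\rangle^{-1}\langle T(x_1)T(x_2)\rangle-\langle T(x_1)\rangle_c\langle T(x_2)\rangle_c$ and $$\begin{aligned}\langle T(x_1)T(x_2)T(x_3)\rangle_c=\ &\langle1\rangle^{-1}\langle T(x_1)T(x_2)T(x_3)\rangle-\langle T(x_1)T(x_2)\rangle_c\langle T(x_3)\rangle_c-\langle T(x_2)T(x_3)\rangle_c\langle T(x_1)\rangle_c\\&-\langle T(x_3)T(x_1)\rangle_c\langle T(x_2)\rangle_c-\langle T(x_1)\rangle_c\langle T(x_2)\rangle_c\langle T(x_3)\rangle_c.\end{aligned}$$ Put $f_{ij}=\big(\frac{y_i+y_j}{x_i-x_j}\big)^2$. Define $P_i=P(x_i,y_i)$ by $p_i\langle T(x_i)\rangle=\frac{c}{32}\frac{[p_i']^2}{p_i}\langle1\rangle+\frac14P_i$, and $r_{ij}=\langle[T(x_i)T(x_j)]_{\rm reg.}\rangle\,p_ip_j$ by $$\langle T(x_i)T(x_j)\rangle p_ip_j-\langle T(x_i)\rangle_c\langle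 T(x_j)\rangle_c\langle1\rangle p_ip_j=\frac{c}{32}f_{ij}^2\langle1\rangle+\frac{1}{4}f_{ij}\Big\{\langle T(x_i)\rangle p_i-\frac{c}{32}\frac{[p_i']^2}{p_i}\langle1\rangle+\langle T(x_j)\rangle p_j-\frac{c}{32}\frac{[p_j']^2}{p_j}\langle1\rangle\Big\}+r_{ij}.$$ **Theorem.** 1. If $n$ is odd, then for fixed distinct points $(x_2,y_2),(x_3,y_3)$, as $x_1\to\infty$, $$\langle T(x_1)T(x_2)T(x_3)\rangle_c\,p_1p_2p_3=O(x_1^{n-3}).$$ 2. In the region where $x_1,x_2,x_3$ are finite, $$\langle T(x_1)T(x_2)T(x_3)\rangle_c\,p_1p_2p_3=R^{(0)}(x_1,x_2,x_3)+(\text{a polynomial in }x_1,x_2,x_3,y_1,y_2,y_3),$$ where $R^{(0)}$ is the rational function of $x_1,x_2,x_3,y_1,y_2,y_3$, symmetric under permutations of the three points, given by $$\begin{aligned}R^{(0)}=\ &\tfrac{c}{64}f_{12}f_{13}f_{23}+\tfrac1{64}f_{12}f_{13}\langle1\rangle^{-1}(P_2+P_3)+\tfrac1{64}f_{12}f_{23}\langle1\rangle^{-1}(P_1+P_3)+\tfrac1{64}f_{13}f_{23}\langle1\rangle^{-1}(P_1+P_2)\\&+\tfrac14f_{12}\langle1\rangle^{-1}(r_{13}+r_{23})+\tfrac14f_{13}\langle1\rangle^{-1}(r_{12}+r_{23})+\tfrac14f_{23}\langle1\rangle^{-1}(r_{12}+r_{13}).\end{aligned}$$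 3. Let $n$ be odd. For a rational function $Q$ of $x_i,y_i$ (and the other variables), write $Q=Q^{\rm even}+y_iQ^{\rm odd}$, with $Q^{\rm even},Q^{\rm odd}$ independent of $y_i$, and put $$Q_i=\pi_{n-3,i}(Q^{\rm even})+y_i\,\pi_{\frac n2-3,i}(Q^{\rm odd}),$$ where $\pi_{k,i}$ is the projection onto the part of order strictly larger than $k$ in $x_i$ as $x_i\to\infty$; put $Q_{i,j}=[Q_i]_j$, $Q_{i,j,k}=[Q_{i,j}]_k$. These projections exist for $R^{(0)}$, also when iterated over distinct indices; $R^{(0)}_{i,j}=R^{(0)}_{j,i}$ for $i\ne j$, and $R^{(0)}_{i,j,k}$ is the same for all orderings $(i,j,k)$ of $\{1,2,3\}$. There are polynomials $P^{(0)},P^{(i)},P^{(i,j)}$ ($i<j$), $P^{(1,2,3)}$ in $x_1,x_2,x_3$, depending on the state, such that $$\begin{aligned}\langle T(x_1)T(x_2)T(x_3)\rangle_c\,p_1p_2p_3=\ &R^{(0)}-R^{(0)}_1+R^{(0)}_{1,2}-R^{(0)}_2+R^{(0)}_{2,3}-R^{(0)}_3+R^{(0)}_{1,3}-R^{(0)}_{1,2,3}\\&+P^{(0)}+\sum_{i}y_iP^{(i)}+\sum_{i<j}y_iy_jP^{(i,j)}+y_1y_2y_3P^{(1,2,3)}.\end{aligned}$$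 Their degrees (a polynomial with a negative degree bound is zero) are at most: for $P^{(0)}$, $n-3$ in each $x_k$; for $P^{(i)}$, $\frac{n-1}2-3$ in $x_i$ and $n-3$ in the other variables; for $P^{(i,j)}$, $\frac{n-1}2-3$ in $x_i,x_j$ and $n-3$ in the remaining variable; for $P^{(1,2,3)}$, $\frac{n-1}2-3$ in each $x_k$. Moreover $P^{(0)}$, $P^{(1,2,3)}$, $\sum_iy_iP^{(i)}$ and $\sum_{i<j}y_iy_jP^{(i,j)}$ are invariant under permutations of the three points. -/

import Mathlib

open scoped Polynomial Topology
open Filter Asymptotics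

noncomputable section

/-- The data defining a hyperelliptic Riemann surface `y ^ 2 = p x` of genus `g ≥ 1`:
`p` has degree `2g + 1` or `2g + 2` and no multiple zeros. -/
structure HyperellipticSurface where
  g : ℕ
  p : ℂ[X]
  one_le_g : 1 ≤ g
  natDegree_p : p.natDegree = 2 * g + 1 ∨ p.natDegree = 2 * g + 2
  squarefree_p : Squarefree p

namespace HyperellipticSurface

variable (S : HyperellipticSurface)

/-- The degree `n` of `p`. -/
def n : ℕ := S.p.natDegree

/-- The polynomial `q u = u ^ (2g + 2) * p (1 / u)`, which describes the surface near infinity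
as `v ^ 2 = q u`, where `u = 1 / x` and `v = y / x ^ (g + 1)`. -/
def q : ℂ[X] := S.p.reflect (2 * S.g + 2)

/-- The points of the compact surface, obtained by gluing the smooth affine curves
`y ^ 2 = p x` and `v ^ 2 = q u`. There is one point at infinity if the degree of `p` is odd, and
there are two if it is even. -/
inductive Point : Type
  | affine (x y : ℂ) (h : y ^ 2 = S.p.eval x) : Point
  | infinity (v : ℂ) (h : v ^ 2 = S.q.eval 0) : Point

namespace Point

variable {S}

/-- The point lies on the affine curve `y ^ 2 = p x`. -/
def IsFinite : S.Point → Prop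
  | affine _ _ _ => True
  | infinity _ _ => False

/-- The point lies on the affine curve `v ^ 2 = q u`. -/
def IsNonzero : S.Point → Prop
  | affine x _ _ => x ≠ 0
  | infinity _ _ => True

/-- The coordinate function `x` (meaningful at finite points). -/
def x : S.Point → ℂ
  | affine x _ _ => x
  | infinity _ _ => 0

/-- The coordinate function `y` (meaningful at finite points). -/
def y : S.Point → ℂ
  | affine _ y _ => y
  | infinity _ _ => 0

/-- The coordinate function `u = 1 / x` (meaningful at points with `x ≠ 0`). -/
def u : S.Point → ℂ
  | affine x _ _ => x⁻¹
  | infinity _ _ => 0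

/-- The coordinate function `v = y / x ^ (g + 1)` (meaningful at points with `x ≠ 0`). -/
def v : S.Point → ℂ
  | affine x y _ => y / x ^ (S.g + 1)
  | infinity v _ => v

end Point

variable {S} in
/-- A map from the complex plane to the surface is holomorphic at `t`, as seen in one of the two
affine curves that cover the surface. -/
def HolomorphicMapAt (γ : ℂ → S.Point) (t : ℂ) : Prop :=
  ((∀ᶠ s in 𝓝 t, (γ s).IsFinite) ∧
    AnalyticAt ℂ (fun s => (γ s).x) t ∧ AnalyticAt ℂ (fun s => (γ s).y) t) ∨
  ((∀ᶠ s in 𝓝 t, (γ s).IsNonzero) ∧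
    AnalyticAt ℂ (fun s => (γ s).u) t ∧ AnalyticAt ℂ (fun s => (γ s).v) t)

/-- A local coordinate on the surface (a coordinate patch with a complex coordinate on it), given
by its inverse: an injective holomorphic map from an open set of complex numbers to the surface. -/
structure LocalCoordinate where
  domain : Set ℂ
  isOpen_domain : IsOpen domain
  toPoint : ℂ → S.Point
  holomorphic : ∀ t ∈ domain, HolomorphicMapAt toPoint t
  injOn : Set.InjOn toPoint domain

variable {S} in
/-- The coordinate values of `N`-tuples of pairwise distinct points, the `i`-th of which lies in
the `i`-th coordinate patch. -/
def config {N : ℕ} (γ : Fin N → S.LocalCoordinate) : Set (Fin N → ℂ) :=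
  {t | (∀ i, t i ∈ (γ i).domain) ∧ Function.Injective fun i => (γ i).toPoint (t i)}

/-- The points of the affine curve at which `x` is a local coordinate, that is, `y ≠ 0`. -/
@[ext]
structure RegularPoint where
  x : ℂ
  y : ℂ
  eqn : y ^ 2 = S.p.eval x
  y_ne_zero : y ≠ 0

namespace RegularPoint

variable {S}

/-- The Galois conjugate `(x, -y)` of the point `(x, y)`. -/
def conj (z : S.RegularPoint) : S.RegularPoint where
  x := z.x
  y := -z.y
  eqn := by rw [neg_sq]; exact z.eqn
  y_ne_zero := neg_ne_zero.mpr z.y_ne_zero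

/-- The value of `p` at `x`. -/
def p (z : S.RegularPoint) : ℂ := S.p.eval z.x

/-- The value of the derivative of `p` at `x`. -/
def p' (z : S.RegularPoint) : ℂ := S.p.derivative.eval z.x

theorem p_ne_zero (z : S.RegularPoint) : z.p ≠ 0 := by
  unfold p
  rw [← z.eqn]
  exact pow_ne_zero 2 z.y_ne_zero

/-- The holomorphic branch of `y` as a function of `x` around the point `z`. -/
def branch (z : S.RegularPoint) (t : ℂ) : ℂ := z.y * (S.p.eval t / z.p) ^ ((2 : ℕ) : ℂ)⁻¹

theorem branch_sq (z : S.RegularPoint) (t : ℂ) : z.branch t ^ 2 = S.p.eval t := by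
  have h : z.y ^ 2 = z.p := z.eqn
  unfold branch
  rw [mul_pow, Complex.cpow_nat_inv_pow _ two_ne_zero, h, mul_div_cancel₀ _ z.p_ne_zero]

/-- The function `x`, as a local coordinate around the point `z`. -/
def xCoordinate (z : S.RegularPoint) : S.LocalCoordinate where
  domain := {t | S.p.eval t / z.p ∈ Complex.slitPlane}
  isOpen_domain := Complex.isOpen_slitPlane.preimage (by fun_prop)
  toPoint t := Point.affine t (z.branch t) (z.branch_sq t)
  holomorphic := by
    intro t ht
    refine Or.inl ⟨Eventually.of_forall fun _ => trivial, analyticAt_id, ?_⟩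
    have h1 : AnalyticAt ℂ (fun s => S.p.eval s / z.p) t := by
      have : AnalyticAt ℂ (fun s => S.p.eval s) t :=
        (Polynomial.differentiable S.p).analyticAt t
      exact this.div analyticAt_const z.p_ne_zero
    exact analyticAt_const.mul (h1.cpow analyticAt_const ht)
  injOn := by
    intro s _ t _ h
    exact congrArg Point.x h

/-- The filter of neighbourhoods of infinity: `x → ∞` on the surface. -/
def atInfinity : Filter S.RegularPoint := comap x (Bornology.cobounded ℂ)

end RegularPoint

end HyperellipticSurface

/-- The Schwarzian derivative. -/
def schwarzian (h : ℂ → ℂ) (t : ℂ) : ℂ :=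
  iteratedDeriv 3 h t / deriv h t - 3 / 2 * (iteratedDeriv 2 h t / deriv h t) ^ 2

/-- A state on the surface, evaluated on the Virasoro field `T` of central charge `c`: the system
of its `N`-point functions, for all `N` and in all local coordinates. -/
structure VirasoroState (S : HyperellipticSurface) (c : ℂ) where
  /-- `corr N γ t` is the `N`-point function `⟨T ⋯ T⟩`, where the `i`-th field is written in the
  local coordinate `γ i` and evaluated at the value `t i` of this coordinate. -/
  corr : (N : ℕ) → (Fin N → S.LocalCoordinate) → (Fin N → ℂ) → ℂ
  /-- The `N`-point functions are holomorphic away from the partial diagonals. -/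
  holomorphic : ∀ (N : ℕ) (γ : Fin N → S.LocalCoordinate),
    AnalyticOnNhd ℂ (corr N γ) (HyperellipticSurface.config γ)
  /-- The `N`-point functions are symmetric. -/
  symmetric : ∀ (N : ℕ) (γ : Fin N → S.LocalCoordinate) (σ : Equiv.Perm (Fin N)),
    ∀ t ∈ HyperellipticSurface.config γ, corr N (γ ∘ σ) (t ∘ σ) = corr N γ t
  /-- Under a change of coordinates `h`, one has `T = (h') ^ 2 T̂ + c / 12 S(h)`, in each of the
  arguments. -/
  transform : ∀ (N : ℕ) (γ : Fin (N + 1) → S.LocalCoordinate),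
    ∀ t ∈ HyperellipticSurface.config γ,
    ∀ (i : Fin (N + 1)) (δ : S.LocalCoordinate) (h : ℂ → ℂ), AnalyticAt ℂ h (t i) →
      h (t i) ∈ δ.domain → (∀ᶠ s in 𝓝 (t i), δ.toPoint (h s) = (γ i).toPoint s) →
      corr (N + 1) γ t =
        deriv h (t i) ^ 2 *
            corr (N + 1) (Function.update γ i δ) (Function.update t i (h (t i))) +
          c / 12 * schwarzian h (t i) * corr N (i.removeNth γ) (i.removeNth t)
  /-- The Virasoro operator product expansion
  `T(z) T(w) ↦ (c / 2) / (z - w) ^ 4 + (T(z) + T(w)) / (z - w) ^ 2 + Φ(w) + O(z - w)`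
  holds within all `N`-point functions and in every local coordinate. -/
  ope : ∀ (N : ℕ) (δ : S.LocalCoordinate) (γ : Fin N → S.LocalCoordinate) (w : ℂ) (t : Fin N → ℂ),
    (Fin.cons w t : Fin (N + 1) → ℂ) ∈
      HyperellipticSurface.config (Fin.cons δ γ : Fin (N + 1) → S.LocalCoordinate) →
    ∃ Φ : ℂ,
      (fun z : ℂ =>
        corr (N + 2) (Fin.cons δ (Fin.cons δ γ : Fin (N + 1) → S.LocalCoordinate))
            (Fin.cons z (Fin.cons w t : Fin (N + 1) → ℂ)) -
          (c / 2 / (z - w) ^ 4 * corr N γ t +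
            1 / (z - w) ^ 2 *
              (corr (N + 1) (Fin.cons δ γ) (Fin.cons z t) +
                corr (N + 1) (Fin.cons δ γ) (Fin.cons w t)) + Φ))
        =O[𝓝[≠] w] fun z => z - w

namespace VirasoroState

variable {S : HyperellipticSurface} {c : ℂ} (V : VirasoroState S c)

/-- The `N`-point function `⟨T(x₁) ⋯ T(x_N)⟩` in the coordinate `x`, as a function of the points
`(x_i, y_i)` of the curve. -/
def npoint {N : ℕ} (z : Fin N → S.RegularPoint) : ℂ :=
  V.corr N (fun i => (z i).xCoordinate) (fun i => (z i).x)

/-- The zero-point function `⟨1⟩`. -/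
def one : ℂ := V.npoint (N := 0) ![]

/-- The connected one-point function. -/
def conn1 (z₁ : S.RegularPoint) : ℂ := V.one⁻¹ * V.npoint ![z₁]

/-- The connected two-point function. -/
def conn2 (z₁ z₂ : S.RegularPoint) : ℂ :=
  V.one⁻¹ * V.npoint ![z₁, z₂] - V.conn1 z₁ * V.conn1 z₂

/-- The connected three-point function: the sum over all partitions of `{1, 2, 3}` of the products
of the connected functions of the blocks is `⟨1⟩⁻¹ ⟨T(x₁) T(x₂) T(x₃)⟩`. -/
def conn3 (z₁ z₂ z₃ : S.RegularPoint) : ℂ :=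
  V.one⁻¹ * V.npoint ![z₁, z₂, z₃] - V.conn2 z₁ z₂ * V.conn1 z₃ - V.conn2 z₂ z₃ * V.conn1 z₁ -
    V.conn2 z₃ z₁ * V.conn1 z₂ - V.conn1 z₁ * V.conn1 z₂ * V.conn1 z₃

/-- The product `⟨T(x₁) T(x₂) T(x₃)⟩_c p₁ p₂ p₃`. -/
def G3 (z : Fin 3 → S.RegularPoint) : ℂ :=
  V.conn3 (z 0) (z 1) (z 2) * ((z 0).p * (z 1).p * (z 2).p)

/-- The function `P`, defined by `p ⟨T(x)⟩ = (c / 32) (p' ^ 2 / p) ⟨1⟩ + P / 4`. -/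
def P (z : S.RegularPoint) : ℂ :=
  4 * (z.p * V.npoint ![z] - c / 32 * (z.p' ^ 2 / z.p) * V.one)

/-- The square of `(y₁ + y₂) / (x₁ - x₂)`. -/
def f (z₁ z₂ : S.RegularPoint) : ℂ := ((z₁.y + z₂.y) / (z₁.x - z₂.x)) ^ 2

/-- The regular part `⟨[T(x₁) T(x₂)]_reg⟩ p₁ p₂` of the two-point function, defined by
`⟨T(x₁) T(x₂)⟩ p₁ p₂ - ⟨T(x₁)⟩_c ⟨T(x₂)⟩_c ⟨1⟩ p₁ p₂ = (c / 32) f ^ 2 ⟨1⟩`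
`+ (f / 4) (⟨T(x₁)⟩ p₁ - (c / 32) (p₁' ^ 2 / p₁) ⟨1⟩ + ⟨T(x₂)⟩ p₂ - (c / 32) (p₂' ^ 2 / p₂) ⟨1⟩)`
`+ ⟨[T(x₁) T(x₂)]_reg⟩ p₁ p₂`. -/
def reg (z₁ z₂ : S.RegularPoint) : ℂ :=
  V.npoint ![z₁, z₂] * (z₁.p * z₂.p) - V.conn1 z₁ * V.conn1 z₂ * V.one * (z₁.p * z₂.p) -
    c / 32 * f z₁ z₂ ^ 2 * V.one -
    1 / 4 * f z₁ z₂ *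
      (V.npoint ![z₁] * z₁.p - c / 32 * (z₁.p' ^ 2 / z₁.p) * V.one +
        (V.npoint ![z₂] * z₂.p - c / 32 * (z₂.p' ^ 2 / z₂.p) * V.one))

/-- The function `R⁽⁰⁾` of three points. -/
def R0 (z : Fin 3 → S.RegularPoint) : ℂ :=
  c / 64 * f (z 0) (z 1) * f (z 0) (z 2) * f (z 1) (z 2) +
  1 / 64 * f (z 0) (z 1) * f (z 0) (z 2) * (V.one⁻¹ * (V.P (z 1) + V.P (z 2))) +
  1 / 64 * f (z 0) (z 1) * f (z 1) (z 2) * (V.one⁻¹ * (V.P (z 0) + V.P (z 2))) +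
  1 / 64 * f (z 0) (z 2) * f (z 1) (z 2) * (V.one⁻¹ * (V.P (z 0) + V.P (z 1))) +
  1 / 4 * f (z 0) (z 1) *
    (V.one⁻¹ * V.reg (z 0) (z 2) + V.one⁻¹ * V.reg (z 1) (z 2)) +
  1 / 4 * f (z 0) (z 2) *
    (V.one⁻¹ * V.reg (z 0) (z 1) + V.one⁻¹ * V.reg (z 1) (z 2)) +
  1 / 4 * f (z 1) (z 2) *
    (V.one⁻¹ * V.reg (z 0) (z 1) + V.one⁻¹ * V.reg (z 0) (z 2))

end VirasoroState

namespace HyperellipticSurface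

variable {S : HyperellipticSurface}

/-- Three points whose `x`-coordinates are pairwise distinct. -/
def Generic (z : Fin 3 → S.RegularPoint) : Prop := Function.Injective fun i => (z i).x

/-- The value at `x` of the Laurent polynomial with coefficients `h`. -/
def laurentEval (h : ℤ →₀ ℂ) (x : ℂ) : ℂ := h.sum fun m a => a * x ^ m

/-- The Laurent polynomial `h` is the part of order strictly larger than `k` of the function `E`
as `x → ∞`. -/
def IsHighPart (k : ℝ) (E : S.RegularPoint → ℂ) (h : ℤ →₀ ℂ) : Prop :=
  (∀ m ∈ h.support, k < (m : ℝ)) ∧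
    (fun w => E w - laurentEval h w.x) =O[RegularPoint.atInfinity] fun w => ‖w.x‖ ^ k

open Classical in
/-- The part of order strictly larger than `k` of the function `E` as `x → ∞`, if there is one
(it is unique then). -/
def highPart (k : ℝ) (E : S.RegularPoint → ℂ) : ℤ →₀ ℂ :=
  if h : ∃ h, IsHighPart k E h then h.choose else 0

/-- The Galois-even part of `Q` with respect to the `i`-th point, as a function of that point. -/
def evenPart (i : Fin 3) (Q : (Fin 3 → S.RegularPoint) → ℂ) (z : Fin 3 → S.RegularPoint)
    (w : S.RegularPoint) : ℂ :=
  (Q (Function.update z i w) + Q (Function.update z i w.conj)) / 2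

/-- The Galois-odd part of `Q` with respect to the `i`-th point, as a function of that point:
`Q` is the sum of the even part and of `y` times the odd part. -/
def oddPart (i : Fin 3) (Q : (Fin 3 → S.RegularPoint) → ℂ) (z : Fin 3 → S.RegularPoint)
    (w : S.RegularPoint) : ℂ :=
  (Q (Function.update z i w) - Q (Function.update z i w.conj)) / (2 * w.y)

/-- The Galois-even and the Galois-odd part of `Q` with respect to the `i`-th point have parts of
order larger than `n - 3` and `n / 2 - 3`, respectively, as that point tends to infinity. -/
def HasProj (i : Fin 3) (Q : (Fin 3 → S.RegularPoint) → ℂ) : Prop :=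
  ∀ z, Generic z →
    (∃ h, IsHighPart ((S.n : ℝ) - 3) (evenPart i Q z) h) ∧
    (∃ h, IsHighPart ((S.n : ℝ) / 2 - 3) (oddPart i Q z) h)

/-- The projection `Q_i` of `Q`: the part of the Galois-even part of order larger than `n - 3`,
plus `y` times the part of the Galois-odd part of order larger than `n / 2 - 3`. -/
def proj (i : Fin 3) (Q : (Fin 3 → S.RegularPoint) → ℂ) (z : Fin 3 → S.RegularPoint) : ℂ :=
  laurentEval (highPart ((S.n : ℝ) - 3) (evenPart i Q z)) (z i).x +
    (z i).y * laurentEval (highPart ((S.n : ℝ) / 2 - 3) (oddPart i Q z)) (z i).x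

/-- The value of a polynomial in `x₁, x₂, x₃`. -/
def evalX (F : MvPolynomial (Fin 3) ℂ) (z : Fin 3 → S.RegularPoint) : ℂ :=
  MvPolynomial.eval (fun i => (z i).x) F

/-- The value of a polynomial in `x₁, x₂, x₃` (the left variables) and `y₁, y₂, y₃` (the right
ones). -/
def evalXY (F : MvPolynomial (Fin 3 ⊕ Fin 3) ℂ) (z : Fin 3 → S.RegularPoint) : ℂ :=
  MvPolynomial.eval (Sum.elim (fun i => (z i).x) (fun i => (z i).y)) F

/-- The sum, over all sets `s` of `k` indices, of the products of the `y_i` with `i` in `s`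
and of the polynomial `F s`. -/
def galoisSum (F : Finset (Fin 3) → MvPolynomial (Fin 3) ℂ) (k : ℕ)
    (z : Fin 3 → S.RegularPoint) : ℂ :=
  ∑ s ∈ Finset.powersetCard k Finset.univ, (∏ i ∈ s, (z i).y) * evalX (F s) z

end HyperellipticSurface

end

/-!
Written in the coordinate `x`, a field which transforms like `T` is controlled at the branch points
by the coordinate `s` with `s ^ 2 = x - a` and at infinity by one with `s ^ 2 = 1 / x` or
`s = 1 / x`: multiplied by `p`, it is bounded at a branch point up to the Schwarzian term
`p' ^ 2 / p`. The operator product expansion gives its poles at the other points. Hence, as a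
function of one point, the difference of `⟨T T T⟩_c p₁ p₂ p₃` and `R⁽⁰⁾` has no poles and grows
polynomially at infinity, so that Liouville's theorem, applied to its even and odd parts under
`y ↦ -y`, shows it to be of the form `F(x) + y G(x)` with polynomials `F` and `G`. By Lagrange
interpolation, a function of this form in each point separately is a polynomial in all coordinates.

For odd `n`, the connected three-point function is `O(x ^ (n - 3))`, and its projections vanish.
Those of `R⁽⁰⁾` are therefore, up to sign, the projections of this polynomial, which remove
monomials, and inclusion–exclusion leaves the monomials of low order in every point.
-/

noncomputable section

open HyperellipticSurface RegularPoint

/-! ### Functions on the curve and on the `x`-plane -/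

theorem dslope_zero_eventuallyEq_cobounded (E : ℂ → ℂ) :
    dslope E 0 =ᶠ[Bornology.cobounded ℂ] fun t => t⁻¹ * (E t - E 0) := by
  filter_upwards [Bornology.eventually_ne_cobounded 0] with t ht
  rw [dslope_of_ne _ ht, slope_def_field, sub_zero, div_eq_inv_mul]

theorem differentiable_dslope {E : ℂ → ℂ} (hE : Differentiable ℂ E) (a : ℂ) :
    Differentiable ℂ (dslope E a) :=
  differentiableOn_univ.1 ((Complex.differentiableOn_dslope univ_mem).2 hE.differentiableOn)

theorem eq_apply_zero_of_isBigO_one {E : ℂ → ℂ} (hE : Differentiable ℂ E)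
    (hbdd : E =O[Bornology.cobounded ℂ] fun _ => (1 : ℂ)) (t : ℂ) : E t = E 0 := by
  have hquot : Tendsto (dslope E 0) (Bornology.cobounded ℂ) (𝓝 0) := by
    refine (Tendsto.congr' (dslope_zero_eventuallyEq_cobounded E).symm ?_)
    rw [← isLittleO_one_iff ℂ]
    simpa using ((isLittleO_one_iff ℂ).2 tendsto_inv₀_cobounded).mul_isBigO
      (hbdd.sub (isBigO_const_const (E 0) one_ne_zero _))
  have hzero := (differentiable_dslope hE 0).apply_eq_of_tendsto_cocompact t
    (Metric.cobounded_eq_cocompact (α := ℂ) ▸ hquot)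
  have hE0 := sub_smul_dslope E 0 t
  rw [hzero, smul_zero] at hE0
  exact sub_eq_zero.1 hE0.symm

theorem exists_polynomial_of_isBigO_pow {D : ℕ} {E : ℂ → ℂ} (hE : Differentiable ℂ E)
    (hgrowth : E =O[Bornology.cobounded ℂ] fun t => t ^ D) :
    ∃ A : ℂ[X], A.natDegree ≤ D ∧ ∀ t, E t = A.eval t := by
  induction D generalizing E with
  | zero =>
    simp only [pow_zero] at hgrowth
    exact ⟨Polynomial.C (E 0), by simp, by simpa using eq_apply_zero_of_isBigO_one hE hgrowth⟩
  | succ D ih =>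
    have hquot : dslope E 0 =O[Bornology.cobounded ℂ] fun t => t ^ D := by
      have hsub : (fun t => E t - E 0) =O[Bornology.cobounded ℂ] fun t => t ^ (D + 1) :=
        hgrowth.sub ((isBigO_const_const _ one_ne_zero _).trans
          (by simpa using isBigO_pow_pow_cobounded_of_le (R := ℂ) (Nat.zero_le (D + 1))))
      refine ((isBigO_refl _ _).mul hsub).congr' (dslope_zero_eventuallyEq_cobounded E).symm ?_
      filter_upwards [Bornology.eventually_ne_cobounded 0] with t ht
      rw [pow_succ', inv_mul_cancel_left₀ ht]
    obtain ⟨A, hA, hEA⟩ := ih (differentiable_dslope hE 0) hquot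
    refine ⟨Polynomial.X * A + Polynomial.C (E 0), ?_, fun t => ?_⟩
    · compute_degree!
      lia
    · have := sub_smul_dslope E 0 t
      rw [hEA, sub_zero, smul_eq_mul] at this
      simp [this]

theorem isLittleO_const_sub_inv (c a : ℂ) : (fun _ => c) =o[𝓝[≠] a] fun t => (t - a)⁻¹ :=
  isLittleO_const_left.2 (Or.inr
    ((tendsto_norm_sub_self_nhdsNE a).inv_tendsto_nhdsGT_zero.congr fun _ => (norm_inv _).symm))

theorem differentiable_limUnder_of_isLittleO {C : Finset ℂ} {E : ℂ → ℂ}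
    (hdiff : ∀ t ∉ C, DifferentiableAt ℂ E t) (hC : ∀ a ∈ C, E =o[𝓝[≠] a] fun t => (t - a)⁻¹) :
    Differentiable ℂ fun t => limUnder (𝓝[≠] t) E := by
  classical
  intro a
  have hdiff' : ∀ᶠ t in 𝓝[≠] a, DifferentiableAt ℂ E t :=
    (C.eventually_cofinite_notMem.filter_mono (nhdsNE_le_cofinite a)).mono fun t => hdiff t
  have hlittle : (fun t => E t - E a) =o[𝓝[≠] a] fun t => (t - a)⁻¹ := by
    by_cases ha : a ∈ C
    · exact (hC a ha).sub (isLittleO_const_sub_inv _ a)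
    · have hbdd : E =O[𝓝[≠] a] fun _ => (1 : ℂ) :=
        ((hdiff a ha).continuousAt.isBigO_one ℂ).mono nhdsWithin_le_nhds
      exact (hbdd.trans_isLittleO (isLittleO_const_sub_inv 1 a)).sub (isLittleO_const_sub_inv _ a)
  rw [eventually_nhdsWithin_iff] at hdiff'
  refine ((Complex.differentiableOn_update_limUnder_of_isLittleO hdiff'
    (fun t ht => (ht.1 ht.2).differentiableWithinAt) hlittle).differentiableAt
      hdiff').congr_of_eventuallyEq ?_
  filter_upwards [hdiff'] with t ht
  rcases eq_or_ne t a with rfl | hta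
  · rw [Function.update_self]
  · rw [Function.update_of_ne hta]
    exact ((ht hta).continuousAt.tendsto.mono_left nhdsWithin_le_nhds).limUnder_eq

theorem exists_polynomial_of_isLittleO_inv {D : ℕ} {C : Finset ℂ} {E : ℂ → ℂ}
    (hdiff : ∀ t ∉ C, DifferentiableAt ℂ E t) (hC : ∀ a ∈ C, E =o[𝓝[≠] a] fun t => (t - a)⁻¹)
    (hgrowth : E =O[Bornology.cobounded ℂ] fun t => t ^ D) :
    ∃ A : ℂ[X], A.natDegree ≤ D ∧ ∀ t ∉ C, E t = A.eval t := by
  have hlim : ∀ t ∉ C, limUnder (𝓝[≠] t) E = E t := fun t ht =>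
    ((hdiff t ht).continuousAt.tendsto.mono_left nhdsWithin_le_nhds).limUnder_eq
  obtain ⟨A, hA, hEA⟩ := exists_polynomial_of_isBigO_pow
    (differentiable_limUnder_of_isLittleO hdiff hC) (hgrowth.congr'
      ((C.eventually_cofinite_notMem.filter_mono (Bornology.le_cofinite ℂ)).mono
        fun t ht => (hlim t ht).symm) EventuallyEq.rfl)
  exact ⟨A, hA, fun t ht => (hlim t ht).symm.trans (hEA t)⟩

theorem isBigO_one_nhdsNE_of_continuousAt {g : ℂ → ℂ} {a : ℂ} (hg : ContinuousAt g a) :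
    g =O[𝓝[≠] a] fun _ => (1 : ℂ) :=
  (hg.tendsto.mono_left nhdsWithin_le_nhds).isBigO_one ℂ

theorem eventuallyEq_of_sq_eventuallyEq {X : Type*} [TopologicalSpace X] {f g : X → ℂ} {t : X}
    (hf : ContinuousAt f t) (hg : ContinuousAt g t) (hsq : ∀ᶠ s in 𝓝 t, f s ^ 2 = g s ^ 2)
    (ht : f t = g t) (hne : f t ≠ 0) : f =ᶠ[𝓝 t] g := by
  have hsum : ∀ᶠ s in 𝓝 t, f s + g s ≠ 0 := by
    refine (hf.add hg).eventually_ne ?_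
    rw [Pi.add_apply, ← ht, ← two_mul]
    exact mul_ne_zero two_ne_zero hne
  filter_upwards [hsq, hsum] with s hs hs'
  exact (sq_eq_sq_iff_eq_or_eq_neg.1 hs).resolve_right fun h => hs' (by rw [h, neg_add_cancel])

namespace HyperellipticSurface

variable {S : HyperellipticSurface}

theorem p_ne_zero (S : HyperellipticSurface) : S.p ≠ 0 := S.squarefree_p.ne_zero

theorem eval_derivative_ne_zero {a : ℂ} (ha : S.p.eval a = 0) : S.p.derivative.eval a ≠ 0 :=
  (PerfectField.separable_iff_squarefree.2 S.squarefree_p).eval₂_derivative_ne_zero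
    (RingHom.id ℂ) ha

theorem eventually_cofinite_eval_ne_zero (S : HyperellipticSurface) :
    ∀ᶠ t in cofinite, S.p.eval t ≠ 0 :=
  S.p.roots.toFinset.eventually_cofinite_notMem.mono fun t ht => by simpa [S.p_ne_zero] using ht

theorem tendsto_sub_sq_div_eval (S : HyperellipticSurface) (a : ℂ) :
    Tendsto (fun t => (t - a) ^ 2 / S.p.eval t) (𝓝[≠] a) (𝓝 0) := by
  by_cases ha : S.p.eval a = 0
  · have hslope : Tendsto (slope (fun t => S.p.eval t) a) (𝓝[≠] a) (𝓝 (S.p.derivative.eval a)) :=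
      (S.p.hasDerivAt a).tendsto_slope
    have hsub : Tendsto (fun t => t - a) (𝓝[≠] a) (𝓝 (a - a)) :=
      (tendsto_nhdsWithin_of_tendsto_nhds tendsto_id).sub_const _
    have hquot := hsub.mul (hslope.inv₀ (eval_derivative_ne_zero ha))
    rw [sub_self, zero_mul] at hquot
    refine hquot.congr' ?_
    filter_upwards with t
    rw [slope_def_field, ha, sub_zero, inv_div, ← mul_div_assoc, sq]
  · have hcont : ContinuousAt (fun t => (t - a) ^ 2 / S.p.eval t) a :=
      ContinuousAt.div (by fun_prop) (by fun_prop) ha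
    simpa using tendsto_nhdsWithin_of_tendsto_nhds hcont.tendsto

namespace RegularPoint

theorem p_eq (z : S.RegularPoint) : z.p = z.y ^ 2 := z.eqn.symm

@[simp] theorem conj_x (z : S.RegularPoint) : z.conj.x = z.x := rfl

@[simp] theorem conj_y (z : S.RegularPoint) : z.conj.y = -z.y := rfl

@[simp] theorem conj_conj (z : S.RegularPoint) : z.conj.conj = z := by ext <;> simp

theorem eq_or_eq_conj {z w : S.RegularPoint} (h : w.x = z.x) : w = z ∨ w = z.conj := by
  have hsq : w.y ^ 2 = z.y ^ 2 := by rw [w.eqn, z.eqn, h]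
  exact (sq_eq_sq_iff_eq_or_eq_neg.1 hsq).imp (RegularPoint.ext h) (RegularPoint.ext h)

theorem exists_x_eq {t : ℂ} (ht : S.p.eval t ≠ 0) : ∃ w : S.RegularPoint, w.x = t := by
  obtain ⟨y, hy⟩ := IsAlgClosed.exists_pow_nat_eq (S.p.eval t) two_pos
  exact ⟨⟨t, y, hy, by rintro rfl; exact ht (by simpa using hy.symm)⟩, rfl⟩

theorem map_x_comap {l : Filter ℂ} (hl : l ≤ cofinite) : map (x (S := S)) (comap x l) = l :=
  map_comap_of_mem (mem_of_superset (hl S.eventually_cofinite_eval_ne_zero) fun _ => exists_x_eq)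

theorem map_x_atInfinity : map (x (S := S)) atInfinity = Bornology.cobounded ℂ :=
  map_x_comap (Bornology.le_cofinite ℂ)

instance : (atInfinity (S := S)).NeBot :=
  map_neBot_iff x |>.1 (map_x_atInfinity (S := S) ▸ inferInstance)

theorem atInfinity_le_cofinite : atInfinity (S := S) ≤ cofinite :=
  (comap_mono (Bornology.le_cofinite ℂ)).trans (comap_cofinite_le x)

theorem tendsto_x_atInfinity : Tendsto (x (S := S)) atInfinity (Bornology.cobounded ℂ) :=
  tendsto_comap

theorem tendsto_conj_atInfinity : Tendsto (conj (S := S)) atInfinity atInfinity :=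
  tendsto_comap_iff.2 tendsto_x_atInfinity

/-- The filter of regular points whose `x`-coordinate tends to `a` without being `a`: the punctured
neighbourhoods of the (one or two) points of the affine curve over `a`. -/
def near (a : ℂ) : Filter S.RegularPoint := comap x (𝓝[≠] a)

theorem map_x_near (a : ℂ) : map (x (S := S)) (near a) = 𝓝[≠] a :=
  map_x_comap (nhdsNE_le_cofinite a)

theorem near_le_cofinite (a : ℂ) : near (S := S) a ≤ cofinite :=
  (comap_mono (nhdsNE_le_cofinite a)).trans (comap_cofinite_le x)

theorem tendsto_x_near (a : ℂ) : Tendsto (x (S := S)) (near a) (𝓝[≠] a) := tendsto_comap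

theorem tendsto_conj_near (a : ℂ) : Tendsto (conj (S := S)) (near a) (near a) :=
  tendsto_comap_iff.2 (tendsto_x_near a)

theorem tendsto_sub_div_y (a : ℂ) :
    Tendsto (fun w : S.RegularPoint => (w.x - a) / w.y) (near a) (𝓝 0) := by
  have hsq := ((S.tendsto_sub_sq_div_eval a).comp (tendsto_x_near (S := S) a)).norm.sqrt
  rw [norm_zero, Real.sqrt_zero] at hsq
  refine tendsto_zero_iff_norm_tendsto_zero.2 (hsq.congr fun w => ?_)
  rw [Function.comp_apply, ← w.eqn, ← div_pow, norm_pow, Real.sqrt_sq (norm_nonneg _)]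

theorem eventually_one_le_norm_y : ∀ᶠ w : S.RegularPoint in atInfinity, 1 ≤ ‖w.y‖ := by
  have hdeg : 0 < S.p.degree := by
    rw [← Polynomial.natDegree_pos_iff_degree_pos]
    have := S.natDegree_p
    lia
  have hp := S.p.tendsto_norm_atTop hdeg
    (tendsto_norm_cobounded_atTop.comp (tendsto_x_atInfinity (S := S)))
  filter_upwards [hp.eventually_ge_atTop 1] with w hw
  rw [← w.eqn, norm_pow] at hw
  exact (one_le_sq_iff₀ (norm_nonneg _)).1 hw

theorem branch_self (z : S.RegularPoint) : z.branch z.x = z.y := by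
  have : S.p.eval z.x / z.p = 1 := div_self z.p_ne_zero
  simp [branch, this]

theorem mem_xCoordinate_domain (z : S.RegularPoint) : z.x ∈ z.xCoordinate.domain := by
  have : S.p.eval z.x / z.p = 1 := div_self z.p_ne_zero
  simp [xCoordinate, this]

theorem analyticAt_branch_of_mem (z : S.RegularPoint) {t : ℂ} (ht : t ∈ z.xCoordinate.domain) :
    AnalyticAt ℂ z.branch t := by
  have hquot : AnalyticAt ℂ (fun s => S.p.eval s / z.p) t :=
    ((Polynomial.differentiable S.p).analyticAt _).div analyticAt_const z.p_ne_zero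
  exact analyticAt_const.mul (hquot.cpow analyticAt_const ht)

theorem analyticAt_branch (z : S.RegularPoint) : AnalyticAt ℂ z.branch z.x :=
  z.analyticAt_branch_of_mem z.mem_xCoordinate_domain

/-- The point over `t` on the branch of `z`: functions near `z` are studied as functions of `t`
through it. It is `z` itself, by convention, if `t` is a zero of `p`. -/
def lift (z : S.RegularPoint) (t : ℂ) : S.RegularPoint :=
  if h : S.p.eval t = 0 then z else
    ⟨t, z.branch t, z.branch_sq t, fun h' => h (by rw [← z.branch_sq t, h']; simp)⟩

theorem lift_x {z : S.RegularPoint} {t : ℂ} (h : S.p.eval t ≠ 0) : (z.lift t).x = t := by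
  simp [lift, h]

theorem lift_y {z : S.RegularPoint} {t : ℂ} (h : S.p.eval t ≠ 0) :
    (z.lift t).y = z.branch t := by
  simp [lift, h]

@[simp] theorem lift_self (z : S.RegularPoint) : z.lift z.x = z := by
  ext
  · exact lift_x z.p_ne_zero
  · rw [lift_y z.p_ne_zero, z.branch_self]

theorem conj_lift (z : S.RegularPoint) {t : ℂ} (h : S.p.eval t ≠ 0) :
    (z.lift t).conj = z.conj.lift t := by
  ext
  · rw [conj_x, lift_x h, lift_x h]
  · rw [conj_y, lift_y h, lift_y h]
    simp [branch, p]

theorem eventually_eval_ne_zero (z : S.RegularPoint) : ∀ᶠ t in 𝓝 z.x, S.p.eval t ≠ 0 :=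
  S.p.continuous.continuousAt.eventually_ne z.p_ne_zero

theorem lift_x_eventuallyEq (z : S.RegularPoint) : (fun t => (z.lift t).x) =ᶠ[𝓝 z.x] id :=
  z.eventually_eval_ne_zero.mono fun _ => lift_x

theorem lift_y_eventuallyEq (z : S.RegularPoint) : (fun t => (z.lift t).y) =ᶠ[𝓝 z.x] z.branch :=
  z.eventually_eval_ne_zero.mono fun _ => lift_y

theorem analyticAt_lift_x (z : S.RegularPoint) : AnalyticAt ℂ (fun t => (z.lift t).x) z.x :=
  analyticAt_id.congr z.lift_x_eventuallyEq.symm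

theorem analyticAt_lift_y (z : S.RegularPoint) : AnalyticAt ℂ (fun t => (z.lift t).y) z.x :=
  z.analyticAt_branch.congr z.lift_y_eventuallyEq.symm

theorem isBigO_near_of_lift {Q : S.RegularPoint → ℂ} (z : S.RegularPoint)
    (h : (fun t => Q (z.lift t)) =O[𝓝[≠] z.x] fun _ => (1 : ℂ))
    (h' : (fun t => Q (z.conj.lift t)) =O[𝓝[≠] z.x] fun _ => (1 : ℂ)) :
    Q =O[near z.x] fun _ => (1 : ℂ) := by
  obtain ⟨M, hM⟩ := h.bound
  obtain ⟨M', hM'⟩ := h'.bound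
  refine IsBigO.of_bound (max M M') ?_
  filter_upwards [(tendsto_x_near z.x).eventually (hM.and hM')] with w hw
  simp only [norm_one, mul_one] at hw ⊢
  have hp : S.p.eval w.x ≠ 0 := w.p_ne_zero
  rcases eq_or_eq_conj (z := z.lift w.x) (w := w) (lift_x hp).symm with h | h
  · exact le_max_of_le_left (by rw [h]; exact hw.1)
  · exact le_max_of_le_right (by rw [h, conj_lift _ hp]; exact hw.2)

/-- The Galois-even part of a function `Q` of one point: the part `E` of the decomposition
`Q = E + y O` with `E` and `O` depending on `x` only. -/
def galoisEven (Q : S.RegularPoint → ℂ) (w : S.RegularPoint) : ℂ := (Q w + Q w.conj) / 2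

/-- The Galois-odd part of a function `Q` of one point: the part `O` of the decomposition
`Q = E + y O` with `E` and `O` depending on `x` only. -/
def galoisOdd (Q : S.RegularPoint → ℂ) (w : S.RegularPoint) : ℂ := (Q w - Q w.conj) / (2 * w.y)

theorem galoisEven_add_y_mul_galoisOdd (Q : S.RegularPoint → ℂ) (w : S.RegularPoint) :
    galoisEven Q w + w.y * galoisOdd Q w = Q w := by
  have := w.y_ne_zero
  rw [galoisEven, galoisOdd]
  field_simp
  ring

section GaloisParts

variable {Q : S.RegularPoint → ℂ}

theorem galoisEven_conj (Q : S.RegularPoint → ℂ) (w : S.RegularPoint) :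
    galoisEven Q w.conj = galoisEven Q w := by
  rw [galoisEven, galoisEven, conj_conj, add_comm]

theorem galoisOdd_conj (Q : S.RegularPoint → ℂ) (w : S.RegularPoint) :
    galoisOdd Q w.conj = galoisOdd Q w := by
  rw [galoisOdd, galoisOdd, conj_conj, conj_y, mul_neg, div_neg, ← neg_div, neg_sub]

theorem differentiableAt_conj_lift {z : S.RegularPoint}
    (h : DifferentiableAt ℂ (fun t => Q (z.conj.lift t)) z.x) :
    DifferentiableAt ℂ (fun t => Q (z.lift t).conj) z.x :=
  h.congr_of_eventuallyEq (z.eventually_eval_ne_zero.mono fun _ ht => congrArg Q (conj_lift _ ht))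

theorem differentiableAt_galoisEven_lift {z : S.RegularPoint}
    (h : DifferentiableAt ℂ (fun t => Q (z.lift t)) z.x)
    (h' : DifferentiableAt ℂ (fun t => Q (z.conj.lift t)) z.x) :
    DifferentiableAt ℂ (fun t => galoisEven Q (z.lift t)) z.x :=
  (h.add (differentiableAt_conj_lift h')).div_const 2

theorem differentiableAt_galoisOdd_lift {z : S.RegularPoint}
    (h : DifferentiableAt ℂ (fun t => Q (z.lift t)) z.x)
    (h' : DifferentiableAt ℂ (fun t => Q (z.conj.lift t)) z.x) :
    DifferentiableAt ℂ (fun t => galoisOdd Q (z.lift t)) z.x := by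
  refine (h.sub (differentiableAt_conj_lift h')).div
    (z.analyticAt_lift_y.differentiableAt.const_mul 2) ?_
  simpa using z.y_ne_zero

theorem isLittleO_galoisEven_near {a : ℂ} (h : Q =O[near a] fun _ => (1 : ℂ)) :
    galoisEven Q =o[near a] fun w => (w.x - a)⁻¹ := by
  have heven : galoisEven Q =O[near a] fun _ => (1 : ℂ) :=
    ((h.add (h.comp_tendsto (tendsto_conj_near a))).const_mul_left 2⁻¹).congr_left
      fun w => inv_mul_eq_div _ _
  exact heven.trans_isLittleO ((isLittleO_const_sub_inv 1 a).comp_tendsto (tendsto_x_near a))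

theorem isLittleO_galoisOdd_near {a : ℂ} (h : Q =O[near a] fun _ => (1 : ℂ)) :
    galoisOdd Q =o[near a] fun w => (w.x - a)⁻¹ := by
  have hdiff : (fun w => Q w - Q w.conj) =O[near a] fun _ => (1 : ℂ) :=
    h.sub (h.comp_tendsto (tendsto_conj_near a))
  have hquot := ((isLittleO_one_iff ℂ).2 (tendsto_sub_div_y (S := S) a)).mul_isBigO
    (hdiff.const_mul_left 2⁻¹)
  refine ((isBigO_refl (fun w : S.RegularPoint => (w.x - a)⁻¹) _).mul_isLittleO hquot).congr' ?_
    (by simp)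
  filter_upwards [(tendsto_x_near a).eventually self_mem_nhdsWithin] with w hw
  have hxa : w.x - a ≠ 0 := sub_ne_zero.2 hw
  have := w.y_ne_zero
  rw [galoisOdd]
  field_simp

theorem isBigO_galoisEven_atInfinity {D : ℕ} (h : Q =O[atInfinity] fun w => w.x ^ D) :
    galoisEven Q =O[atInfinity] fun w => w.x ^ D := by
  have hconj : (fun w => Q w.conj) =O[atInfinity] fun w => w.x ^ D :=
    h.comp_tendsto tendsto_conj_atInfinity
  exact ((h.add hconj).const_mul_left 2⁻¹).congr_left fun w => inv_mul_eq_div _ _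

theorem isBigO_galoisOdd_atInfinity {D : ℕ} (h : Q =O[atInfinity] fun w => w.x ^ D) :
    galoisOdd Q =O[atInfinity] fun w => w.x ^ D := by
  have hconj : (fun w => Q w.conj) =O[atInfinity] fun w => w.x ^ D :=
    h.comp_tendsto tendsto_conj_atInfinity
  have hinv : (fun w : S.RegularPoint => (2 * w.y)⁻¹) =O[atInfinity] fun _ => (1 : ℂ) := by
    refine IsBigO.of_bound 1 ?_
    filter_upwards [eventually_one_le_norm_y] with w hw
    rw [norm_inv, norm_mul, norm_one, mul_one, Complex.norm_ofNat]
    exact inv_le_one_of_one_le₀ (by linarith)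
  exact ((h.sub hconj).mul hinv).congr_right fun _ => mul_one _

end GaloisParts

theorem exists_polynomial_of_comp_conj_eq {D : ℕ} (B : Finset ℂ) {R : S.RegularPoint → ℂ}
    (hconj : ∀ w, R w.conj = R w)
    (hol : ∀ z : S.RegularPoint, z.x ∉ B → DifferentiableAt ℂ (fun t => R (z.lift t)) z.x)
    (hB : ∀ a, a ∈ B ∨ S.p.eval a = 0 → R =o[near a] fun w => (w.x - a)⁻¹)
    (growth : R =O[atInfinity] fun w => w.x ^ D) :
    ∃ F : ℂ[X], F.natDegree ≤ D ∧ ∀ w, w.x ∉ B → R w = F.eval w.x := by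
  classical
  obtain ⟨E, rfl⟩ : ∃ E : ℂ → ℂ, R = E ∘ x := by
    have hfactors : Function.FactorsThrough R x := fun w z h => by
      rcases eq_or_eq_conj h with rfl | rfl
      exacts [rfl, hconj z]
    exact ⟨Function.extend x R 0, funext fun w => (hfactors.extend_apply 0 w).symm⟩
  have hmem : ∀ a, a ∈ B ∪ S.p.roots.toFinset ↔ a ∈ B ∨ S.p.eval a = 0 := by simp [S.p_ne_zero]
  have hdiff : ∀ t ∉ B ∪ S.p.roots.toFinset, DifferentiableAt ℂ E t := fun t ht => by
    rw [hmem, not_or] at ht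
    obtain ⟨z, rfl⟩ := exists_x_eq ht.2
    refine (hol z ht.1).congr_of_eventuallyEq ?_
    filter_upwards [z.lift_x_eventuallyEq] with s hs
    exact congrArg E hs.symm
  have hE : ∀ a ∈ B ∪ S.p.roots.toFinset, E =o[𝓝[≠] a] fun t => (t - a)⁻¹ := fun a ha => by
    rw [← map_x_near (S := S), isLittleO_map]
    exact hB a ((hmem a).1 ha)
  have hinf : E =O[Bornology.cobounded ℂ] fun t => t ^ D := by
    rw [← map_x_atInfinity (S := S), isBigO_map]
    exact growth
  obtain ⟨F, hF, hEF⟩ := exists_polynomial_of_isLittleO_inv hdiff hE hinf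
  refine ⟨F, hF, fun w hw => hEF w.x ?_⟩
  rw [hmem, not_or]
  exact ⟨hw, w.p_ne_zero⟩

/-- The even and the odd part descend to the `x`-plane, where Liouville's theorem applies. -/
theorem exists_polynomials {D : ℕ} (B : Finset ℂ) {Q : S.RegularPoint → ℂ}
    (hol : ∀ z : S.RegularPoint, z.x ∉ B → AnalyticAt ℂ (fun t => Q (z.lift t)) z.x)
    (bdd : ∀ a, a ∈ B ∨ S.p.eval a = 0 → Q =O[near a] fun _ => (1 : ℂ))
    (growth : Q =O[atInfinity] fun w => w.x ^ D) :
    ∃ F G : ℂ[X], F.natDegree ≤ D ∧ G.natDegree ≤ D ∧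
      ∀ w, w.x ∉ B → Q w = F.eval w.x + w.y * G.eval w.x := by
  obtain ⟨F, hF, hQF⟩ := exists_polynomial_of_comp_conj_eq B (galoisEven_conj Q)
    (fun z hz => differentiableAt_galoisEven_lift (hol z hz).differentiableAt
      (hol z.conj hz).differentiableAt)
    (fun a ha => isLittleO_galoisEven_near (bdd a ha)) (isBigO_galoisEven_atInfinity growth)
  obtain ⟨G, hG, hQG⟩ := exists_polynomial_of_comp_conj_eq B (galoisOdd_conj Q)
    (fun z hz => differentiableAt_galoisOdd_lift (hol z hz).differentiableAt
      (hol z.conj hz).differentiableAt)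
    (fun a ha => isLittleO_galoisOdd_near (bdd a ha)) (isBigO_galoisOdd_atInfinity growth)
  exact ⟨F, G, hF, hG, fun w hw => by
    rw [← galoisEven_add_y_mul_galoisOdd Q w, hQF w hw, hQG w hw]⟩

end RegularPoint

end HyperellipticSurface

/-! ### Quadratic fields and the branch points -/

section Schwarzian

variable {h : ℂ → ℂ} {t a α : ℂ}

theorem schwarzian_id (t : ℂ) : schwarzian id t = 0 := by
  simp [schwarzian, iteratedDeriv_succ, iteratedDeriv_zero, deriv_id']

theorem schwarzian_eq_deriv_logDeriv (ha : AnalyticAt ℂ h t) (ht : deriv h t ≠ 0) :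
    schwarzian h t = deriv (logDeriv (deriv h)) t - 1 / 2 * logDeriv (deriv h) t ^ 2 := by
  rw [logDeriv_apply, logDeriv,
    deriv_div ha.deriv.deriv.differentiableAt ha.deriv.differentiableAt ht]
  simp only [schwarzian, iteratedDeriv_succ, iteratedDeriv_zero]
  field_simp
  ring

theorem logDeriv_sub_const (a s : ℂ) : logDeriv (fun s => s - a) s = 1 / (s - a) := by
  rw [logDeriv_apply, deriv_sub_const_fun, deriv_id'']

theorem logDeriv_deriv_eventuallyEq (ha : AnalyticAt ℂ h t) (hα : α ≠ 0) (hta : t ≠ a)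
    (hlog : logDeriv h =ᶠ[𝓝 t] fun s => α / (s - a)) :
    logDeriv (deriv h) =ᶠ[𝓝 t] fun s => (α - 1) / (s - a) := by
  have hne : ∀ᶠ s in 𝓝 t, h s ≠ 0 ∧ s - a ≠ 0 ∧ deriv h s = α * (h s / (s - a)) := by
    filter_upwards [hlog, isOpen_ne.mem_nhds hta] with s hs hsa
    have hsa : s - a ≠ 0 := sub_ne_zero.2 hsa
    have hs0 : h s ≠ 0 := by
      intro h0
      rw [logDeriv_apply, h0, div_zero] at hs
      exact div_ne_zero hα hsa hs.symm
    rw [logDeriv_apply, div_eq_iff hs0] at hs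
    exact ⟨hs0, hsa, by rw [hs]; ring⟩
  filter_upwards [hne.eventually_nhds, hlog, ha.eventually_analyticAt] with s hs hlogs has
  have hderiv : deriv h =ᶠ[𝓝 s] fun s => α * (h s / (s - a)) := hs.mono fun _ hs => hs.2.2
  obtain ⟨hs0, hsa, -⟩ := hs.self_of_nhds
  rw [(logDeriv_congr_nhds hderiv).self_of_nhds, logDeriv_const_mul s α hα,
    logDeriv_div s hs0 hsa has.differentiableAt (by fun_prop), hlogs, logDeriv_sub_const, sub_div]

theorem schwarzian_of_logDeriv_eventuallyEq (ha : AnalyticAt ℂ h t) (hα : α ≠ 0) (hta : t ≠ a)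
    (hlog : logDeriv h =ᶠ[𝓝 t] fun s => α / (s - a)) :
    schwarzian h t = (1 - α ^ 2) / (2 * (t - a) ^ 2) := by
  have hsub : t - a ≠ 0 := sub_ne_zero.2 hta
  have hlog' := logDeriv_deriv_eventuallyEq ha hα hta hlog
  have hderiv : deriv h t ≠ 0 := by
    intro h0
    have := hlog.self_of_nhds
    rw [logDeriv_apply, h0, zero_div] at this
    exact div_ne_zero hα hsub this.symm
  have hquot : HasDerivAt (fun s => (α - 1) / (s - a)) (-(α - 1) / (t - a) ^ 2) t := by
    simpa using (hasDerivAt_const t (α - 1)).fun_div ((hasDerivAt_id t).sub_const a) hsub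
  rw [schwarzian_eq_deriv_logDeriv ha hderiv, hlog'.deriv_eq, hquot.deriv, hlog'.self_of_nhds]
  field_simp
  ring

theorem logDeriv_eventuallyEq_of_sq {g : ℂ → ℂ} (ha : AnalyticAt ℂ h t)
    (hsq : ∀ᶠ s in 𝓝 t, h s ^ 2 = g s) :
    logDeriv h =ᶠ[𝓝 t] fun s => logDeriv g s / 2 := by
  filter_upwards [hsq.eventually_nhds, ha.eventually_analyticAt] with s hs has
  have hg : g =ᶠ[𝓝 s] fun s => h s ^ 2 := hs.mono fun _ => Eq.symm
  rw [(logDeriv_congr_nhds hg).self_of_nhds, logDeriv_fun_pow has.differentiableAt]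
  simp

end Schwarzian

theorem tendsto_zero_of_sq {X : Type*} {l : Filter X} {f : X → ℂ}
    (h : Tendsto (fun x => f x ^ 2) l (𝓝 0)) : Tendsto f l (𝓝 0) := by
  rw [tendsto_zero_iff_norm_tendsto_zero] at h ⊢
  simpa [Real.sqrt_sq] using h.sqrt

/-- A square root of the polynomial `r`, holomorphic near a point `a` with `r a ≠ 0`. -/
def sqrtNear (r : ℂ[X]) (a t : ℂ) : ℂ :=
  (r.eval a) ^ ((2 : ℕ) : ℂ)⁻¹ * (r.eval t / r.eval a) ^ ((2 : ℕ) : ℂ)⁻¹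

/-- The neighbourhood of `a` in which `sqrtNear r a` is holomorphic: the preimage of the slit
plane under `r / r a`. -/
def sqrtDomain (r : ℂ[X]) (a : ℂ) : Set ℂ := {t | r.eval t / r.eval a ∈ Complex.slitPlane}

section SqrtNear

variable {f r : ℂ[X]} {a t : ℂ}

theorem isOpen_sqrtDomain (r : ℂ[X]) (a : ℂ) : IsOpen (sqrtDomain r a) :=
  Complex.isOpen_slitPlane.preimage (by fun_prop)

theorem self_mem_sqrtDomain (ha : r.eval a ≠ 0) : a ∈ sqrtDomain r a := by
  simp [sqrtDomain, div_self ha]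

theorem sqrtDomain_mem_nhds (ha : r.eval a ≠ 0) : sqrtDomain r a ∈ 𝓝 a :=
  (isOpen_sqrtDomain r a).mem_nhds (self_mem_sqrtDomain ha)

theorem sqrtNear_sq (ha : r.eval a ≠ 0) (t : ℂ) : sqrtNear r a t ^ 2 = r.eval t := by
  rw [sqrtNear, mul_pow, Complex.cpow_nat_inv_pow _ two_ne_zero,
    Complex.cpow_nat_inv_pow _ two_ne_zero, mul_div_cancel₀ _ ha]

theorem analyticAt_sqrtNear (ha : r.eval a ≠ 0) (ht : t ∈ sqrtDomain r a) :
    AnalyticAt ℂ (sqrtNear r a) t :=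
  analyticAt_const.mul ((((Polynomial.differentiable r).analyticAt t).div analyticAt_const ha).cpow
    analyticAt_const ht)

theorem sqrtNear_ne_zero (ha : r.eval a ≠ 0) (ht : t ∈ sqrtDomain r a) : sqrtNear r a t ≠ 0 := by
  intro h
  have heval : r.eval t = 0 := by rw [← sqrtNear_sq ha t, h, zero_pow two_ne_zero]
  simp [sqrtDomain, heval] at ht

theorem div_sqrtNear_sq (hf : f = (Polynomial.X - Polynomial.C a) * r) (ha : r.eval a ≠ 0)
    (ht : t ∈ sqrtDomain r a) {y : ℂ} (hy : y ^ 2 = f.eval t) :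
    (y / sqrtNear r a t) ^ 2 = t - a := by
  have hne : r.eval t ≠ 0 := by
    rw [← sqrtNear_sq ha t]
    exact pow_ne_zero 2 (sqrtNear_ne_zero ha ht)
  rw [div_pow, hy, sqrtNear_sq ha, hf, Polynomial.eval_mul, mul_div_cancel_right₀ _ hne]
  simp

theorem mul_sqrtNear_sq (hf : f = (Polynomial.X - Polynomial.C a) * r) (ha : r.eval a ≠ 0)
    (s : ℂ) : (s * sqrtNear r a (a + s ^ 2)) ^ 2 = f.eval (a + s ^ 2) := by
  rw [mul_pow, sqrtNear_sq ha, hf]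
  simp

theorem analyticAt_mul_sqrtNear (ha : r.eval a ≠ 0) {s : ℂ} (hs : a + s ^ 2 ∈ sqrtDomain r a) :
    AnalyticAt ℂ (fun s => s * sqrtNear r a (a + s ^ 2)) s :=
  analyticAt_id.mul (AnalyticAt.comp (g := sqrtNear r a) (f := fun s => a + s ^ 2)
    (analyticAt_sqrtNear ha hs) (by fun_prop))

theorem eq_of_mul_sqrtNear_eq (ha : r.eval a ≠ 0) {s t : ℂ} (hs : a + s ^ 2 ∈ sqrtDomain r a)
    (hsq : a + s ^ 2 = a + t ^ 2)
    (hmul : s * sqrtNear r a (a + s ^ 2) = t * sqrtNear r a (a + t ^ 2)) : s = t := by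
  rw [← hsq] at hmul
  exact mul_right_cancel₀ (sqrtNear_ne_zero ha hs) hmul

end SqrtNear

namespace HyperellipticSurface

variable {S : HyperellipticSurface}

namespace RegularPoint

/-- The point of the compact surface underlying a regular point. -/
def toPoint (z : S.RegularPoint) : S.Point := Point.affine z.x z.y z.eqn

theorem toPoint_injective : Function.Injective (toPoint (S := S)) := by
  intro z w h
  simp only [toPoint, Point.affine.injEq] at h
  exact RegularPoint.ext h.1 h.2

theorem xCoordinate_toPoint (z : S.RegularPoint) (t : ℂ) :
    z.xCoordinate.toPoint t = Point.affine t (z.branch t) (z.branch_sq t) := rfl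

@[simp] theorem xCoordinate_toPoint_self (z : S.RegularPoint) :
    z.xCoordinate.toPoint z.x = z.toPoint := by
  simp [xCoordinate_toPoint, toPoint, branch_self]

theorem xCoordinate_toPoint_notMem {Z : Set S.RegularPoint} {z : S.RegularPoint} (hz : z ∉ Z) :
    z.xCoordinate.toPoint z.x ∉ toPoint '' Z := by
  rwa [xCoordinate_toPoint_self, toPoint_injective.mem_set_image]

theorem branch_lift_eventuallyEq {z : S.RegularPoint} {t : ℂ} (ht : t ∈ z.xCoordinate.domain)
    (hp : S.p.eval t ≠ 0) : (z.lift t).branch =ᶠ[𝓝 t] z.branch := by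
  have hself : (z.lift t).branch t = z.branch t := by
    simpa only [lift_x hp, lift_y hp] using (z.lift t).branch_self
  have hana := (z.lift t).analyticAt_branch
  rw [lift_x hp] at hana
  refine eventuallyEq_of_sq_eventuallyEq hana.continuousAt
    (z.analyticAt_branch_of_mem ht).continuousAt
    (Eventually.of_forall fun s => by rw [branch_sq, branch_sq]) hself fun h => hp ?_
  rw [← (z.lift t).branch_sq, h, zero_pow two_ne_zero]

end RegularPoint

/-- A field on the surface, given by a function in every local coordinate: it is holomorphic off
the finite set `Z`, and it transforms like a quadratic differential up to `A` times the
Schwarzian derivative. The singular points lie over no branch point and not at infinity. -/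
structure IsQuadratic (Z : Set S.RegularPoint) (A : ℂ) (Ψ : S.LocalCoordinate → ℂ → ℂ) :
    Prop where
  finite : Z.Finite
  analyticAt : ∀ (δ : S.LocalCoordinate), ∀ t ∈ δ.domain, δ.toPoint t ∉ toPoint '' Z →
    AnalyticAt ℂ (Ψ δ) t
  transform : ∀ (γ δ : S.LocalCoordinate) (t : ℂ) (h : ℂ → ℂ), t ∈ γ.domain →
    γ.toPoint t ∉ toPoint '' Z → AnalyticAt ℂ h t → h t ∈ δ.domain →
    (∀ᶠ s in 𝓝 t, δ.toPoint (h s) = γ.toPoint s) →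
    Ψ γ t = deriv h t ^ 2 * Ψ δ (h t) + A * schwarzian h t

/-- A field, written in the coordinate `x`. -/
def atX (Ψ : S.LocalCoordinate → ℂ → ℂ) (w : S.RegularPoint) : ℂ := Ψ w.xCoordinate w.x

namespace IsQuadratic

variable {Z : Set S.RegularPoint} {A : ℂ} {Ψ : S.LocalCoordinate → ℂ → ℂ}

theorem add {A' : ℂ} {Ψ' : S.LocalCoordinate → ℂ → ℂ} (hΨ : IsQuadratic Z A Ψ)
    (hΨ' : IsQuadratic Z A' Ψ') : IsQuadratic Z (A + A') (Ψ + Ψ') where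
  finite := hΨ.finite
  analyticAt δ t ht hZ := (hΨ.analyticAt δ t ht hZ).add (hΨ'.analyticAt δ t ht hZ)
  transform γ δ t h ht hZ ha hδ hh := by
    simp only [Pi.add_apply]
    rw [hΨ.transform γ δ t h ht hZ ha hδ hh, hΨ'.transform γ δ t h ht hZ ha hδ hh]
    ring

theorem const_smul (b : ℂ) (hΨ : IsQuadratic Z A Ψ) : IsQuadratic Z (b * A) (b • Ψ) where
  finite := hΨ.finite
  analyticAt δ t ht hZ := analyticAt_const.mul (hΨ.analyticAt δ t ht hZ)
  transform γ δ t h ht hZ ha hδ hh := by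
    simp only [Pi.smul_apply, smul_eq_mul]
    rw [hΨ.transform γ δ t h ht hZ ha hδ hh]
    ring

theorem mono {Z' : Set S.RegularPoint} (hΨ : IsQuadratic Z A Ψ) (hZ : Z ⊆ Z') (hf : Z'.Finite) :
    IsQuadratic Z' A Ψ where
  finite := hf
  analyticAt δ t ht hZ' := hΨ.analyticAt δ t ht fun h => hZ' (Set.image_mono hZ h)
  transform γ δ t h ht hZ' ha hδ hh :=
    hΨ.transform γ δ t h ht (fun h => hZ' (Set.image_mono hZ h)) ha hδ hh

theorem atX_lift_eventuallyEq (hΨ : IsQuadratic Z A Ψ) (z : S.RegularPoint) :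
    (fun t => atX Ψ (z.lift t)) =ᶠ[𝓝 z.x] Ψ z.xCoordinate := by
  have hZ : ∀ᶠ t in 𝓝 z.x, t ≠ z.x → t ∉ x '' Z :=
    eventually_nhdsWithin_iff.1 (nhdsNE_le_cofinite z.x (hΨ.finite.image x).compl_mem_cofinite)
  filter_upwards [hZ, z.eventually_eval_ne_zero,
    z.xCoordinate.isOpen_domain.mem_nhds z.mem_xCoordinate_domain] with t ht hp hd
  rcases eq_or_ne t z.x with rfl | hne
  · simp [atX]
  have hx : (z.lift t).x = t := lift_x hp
  have hchange : ∀ᶠ s in 𝓝 (z.lift t).x,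
      z.xCoordinate.toPoint (id s) = (z.lift t).xCoordinate.toPoint s := by
    rw [hx]
    filter_upwards [branch_lift_eventuallyEq hd hp] with s hs
    simp [xCoordinate_toPoint, hs]
  have hnotMem : z.lift t ∉ Z := fun h => ht hne ⟨_, h, hx⟩
  have := hΨ.transform _ z.xCoordinate _ id (z.lift t).mem_xCoordinate_domain
    (xCoordinate_toPoint_notMem hnotMem) analyticAt_id (by rwa [hx]) hchange
  simpa [atX, hx, schwarzian_id] using this

theorem analyticAt_atX_lift (hΨ : IsQuadratic Z A Ψ) {z : S.RegularPoint} (hz : z ∉ Z) :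
    AnalyticAt ℂ (fun t => atX Ψ (z.lift t)) z.x :=
  (hΨ.analyticAt z.xCoordinate z.x z.mem_xCoordinate_domain
    (xCoordinate_toPoint_notMem hz)).congr (hΨ.atX_lift_eventuallyEq z).symm

-- In the coordinate `s` of `δ`, whose transition map satisfies `s' / s = α / (x - a)`, the field
-- is bounded; the factor `s' ^ 2` and the Schwarzian derivative of `s` give the stated growth.
theorem isBigO_atX_sub (hΨ : IsQuadratic Z A Ψ) {l : Filter S.RegularPoint}
    (hl : l ≤ cofinite) {δ : S.LocalCoordinate} {s₀ : ℂ} (hs₀ : s₀ ∈ δ.domain)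
    (hδ : δ.toPoint s₀ ∉ toPoint '' Z) {h : S.RegularPoint → ℂ → ℂ} {α a : ℂ} (hα : α ≠ 0)
    (hh : ∀ᶠ w : S.RegularPoint in l, AnalyticAt ℂ (h w) w.x ∧ w.x ≠ a ∧
      (∀ᶠ s in 𝓝 w.x, δ.toPoint (h w s) = w.xCoordinate.toPoint s) ∧
      logDeriv (h w) =ᶠ[𝓝 w.x] fun s => α / (s - a))
    (ht : Tendsto (fun w => h w w.x) l (𝓝 s₀)) :
    (fun w => atX Ψ w - A * ((1 - α ^ 2) / (2 * (w.x - a) ^ 2))) =O[l]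
      fun w => (h w w.x / (w.x - a)) ^ 2 := by
  have hbound : (fun w => Ψ δ (h w w.x)) =O[l] fun _ => (1 : ℂ) :=
    ((hΨ.analyticAt δ s₀ hs₀ hδ).continuousAt.tendsto.comp ht).isBigO_one ℂ
  refine (((isBigO_refl (fun w : S.RegularPoint => (h w w.x / (w.x - a)) ^ 2) l).mul
    hbound).const_mul_left (α ^ 2)).congr' ?_ (by simp)
  filter_upwards [hh, hl hΨ.finite.compl_mem_cofinite,
    ht.eventually (δ.isOpen_domain.mem_nhds hs₀)] with w ⟨ha, hxa, hpt, hlog⟩ hZ hdom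
  have hsub : w.x - a ≠ 0 := sub_ne_zero.2 hxa
  have hlogw : deriv (h w) w.x / h w w.x = α / (w.x - a) := hlog.self_of_nhds
  have hne : h w w.x ≠ 0 := by
    intro h0
    rw [h0, div_zero] at hlogw
    exact div_ne_zero hα hsub hlogw.symm
  have hderiv : deriv (h w) w.x = α * (h w w.x / (w.x - a)) := by
    rw [div_eq_iff hne] at hlogw
    rw [hlogw]; ring
  rw [atX, hΨ.transform w.xCoordinate δ w.x (h w) w.mem_xCoordinate_domain
    (xCoordinate_toPoint_notMem hZ) ha hdom hpt, hderiv,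
    schwarzian_of_logDeriv_eventuallyEq ha hα hxa hlog]
  ring

end IsQuadratic

section BranchPoint

variable {a : ℂ} {r : ℂ[X]}

theorem exists_eq_mul (ha : S.p.eval a = 0) :
    ∃ r : ℂ[X], S.p = (Polynomial.X - Polynomial.C a) * r ∧ r.eval a ≠ 0 := by
  obtain ⟨r, hr⟩ := Polynomial.dvd_iff_isRoot.2 ha
  refine ⟨r, hr, ?_⟩
  simpa [hr] using eval_derivative_ne_zero ha

/-- The local coordinate `s` with `x = a + s ^ 2` around a zero `a` of `p`. -/
def branchCoordinate (hr : S.p = (Polynomial.X - Polynomial.C a) * r) (hra : r.eval a ≠ 0) :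
    S.LocalCoordinate where
  domain := {s | a + s ^ 2 ∈ sqrtDomain r a}
  isOpen_domain := (isOpen_sqrtDomain r a).preimage (by fun_prop)
  toPoint s := Point.affine (a + s ^ 2) (s * sqrtNear r a (a + s ^ 2)) (mul_sqrtNear_sq hr hra s)
  holomorphic s hs := Or.inl ⟨Eventually.of_forall fun _ => trivial,
    (by fun_prop : AnalyticAt ℂ (fun s : ℂ => a + s ^ 2) s), analyticAt_mul_sqrtNear hra hs⟩
  injOn s hs t _ h := by
    simp only [Point.affine.injEq] at h
    exact eq_of_mul_sqrtNear_eq hra hs h.1 h.2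

theorem branchCoordinate_zero_notMem (hr : S.p = (Polynomial.X - Polynomial.C a) * r)
    (hra : r.eval a ≠ 0) (Z : Set S.RegularPoint) :
    (branchCoordinate hr hra).toPoint 0 ∉ toPoint '' Z := by
  rintro ⟨z, -, hz⟩
  simp only [branchCoordinate, toPoint, Point.affine.injEq, zero_mul] at hz
  exact z.y_ne_zero hz.2

theorem branchCoordinate_div_sqrtNear (hr : S.p = (Polynomial.X - Polynomial.C a) * r)
    (hra : r.eval a ≠ 0) (w : S.RegularPoint) {s : ℂ} (hs : s ∈ sqrtDomain r a) :
    (branchCoordinate hr hra).toPoint (w.branch s / sqrtNear r a s) = w.xCoordinate.toPoint s := by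
  simp only [branchCoordinate, xCoordinate_toPoint, 
    div_sqrtNear_sq hr hra hs (w.branch_sq s), add_sub_cancel,
    div_mul_cancel₀ _ (sqrtNear_ne_zero hra hs)]

theorem logDeriv_branch_div_sqrtNear (hr : S.p = (Polynomial.X - Polynomial.C a) * r)
    (hra : r.eval a ≠ 0) {w : S.RegularPoint} (hw : w.x ∈ sqrtDomain r a) :
    AnalyticAt ℂ (fun s => w.branch s / sqrtNear r a s) w.x ∧
      logDeriv (fun s => w.branch s / sqrtNear r a s) =ᶠ[𝓝 w.x] fun s => 1 / 2 / (s - a) := by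
  have hana : AnalyticAt ℂ (fun s => w.branch s / sqrtNear r a s) w.x :=
    w.analyticAt_branch.div (analyticAt_sqrtNear hra hw) (sqrtNear_ne_zero hra hw)
  refine ⟨hana, (logDeriv_eventuallyEq_of_sq (g := fun s => s - a) hana ?_).trans ?_⟩
  · filter_upwards [(isOpen_sqrtDomain r a).mem_nhds hw] with s hs
    exact div_sqrtNear_sq hr hra hs (w.branch_sq s)
  · exact Eventually.of_forall fun s => by simp only [logDeriv_sub_const, div_right_comm]

theorem eventually_near_sqrtDomain (hra : r.eval a ≠ 0) :
    ∀ᶠ w : S.RegularPoint in near a, w.x ≠ a ∧ w.x ∈ sqrtDomain r a :=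
  (tendsto_x_near a).eventually
    (eventually_mem_nhdsWithin.and (nhdsWithin_le_nhds (sqrtDomain_mem_nhds hra)))

theorem isBigO_one_of_continuousAt {g : ℂ → ℂ} (hg : ContinuousAt g a) :
    (fun w : S.RegularPoint => g w.x) =O[near a] fun _ => (1 : ℂ) :=
  (hg.tendsto.comp ((tendsto_x_near a).mono_right nhdsWithin_le_nhds)).isBigO_one ℂ

namespace IsQuadratic

variable {Z : Set S.RegularPoint} {A : ℂ} {Ψ : S.LocalCoordinate → ℂ → ℂ}

theorem isBigO_near_sub (hΨ : IsQuadratic Z A Ψ) (hr : S.p = (Polynomial.X - Polynomial.C a) * r)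
    (hra : r.eval a ≠ 0) :
    (fun w : S.RegularPoint => atX Ψ w - A * (3 / 8 / (w.x - a) ^ 2)) =O[near a]
      fun w => (w.x - a)⁻¹ := by
  have hnear := eventually_near_sqrtDomain (S := S) hra
  have hsq : ∀ᶠ w : S.RegularPoint in near a,
      (w.branch w.x / sqrtNear r a w.x) ^ 2 = w.x - a :=
    hnear.mono fun w hw => div_sqrtNear_sq hr hra hw.2 (w.branch_sq _)
  have htendsto : Tendsto (fun w : S.RegularPoint => w.branch w.x / sqrtNear r a w.x) (near a)
      (𝓝 0) := by
    have hx : Tendsto (x (S := S)) (near a) (𝓝 a) :=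
      (tendsto_x_near a).mono_right nhdsWithin_le_nhds
    refine tendsto_zero_of_sq (Tendsto.congr' (hsq.mono fun _ => Eq.symm) ?_)
    simpa using hx.sub_const a
  refine (hΨ.isBigO_atX_sub (near_le_cofinite a) (δ := branchCoordinate hr hra) (a := a)
    (h := fun w s => w.branch s / sqrtNear r a s) (α := 1 / 2) ?_
    (branchCoordinate_zero_notMem hr hra Z) (by norm_num) ?_ htendsto).congr' ?_ ?_
  · simpa [branchCoordinate] using self_mem_sqrtDomain hra
  · filter_upwards [hnear] with w ⟨hxa, hw⟩
    obtain ⟨hana, hlog⟩ := logDeriv_branch_div_sqrtNear hr hra hw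
    refine ⟨hana, hxa, ?_, hlog⟩
    filter_upwards [(isOpen_sqrtDomain r a).mem_nhds hw] with s hs
    exact branchCoordinate_div_sqrtNear hr hra w hs
  · filter_upwards with w
    rw [← div_div]
    norm_num
  · filter_upwards [hsq, hnear] with w hw ⟨hxa, _⟩
    have : w.x - a ≠ 0 := sub_ne_zero.2 hxa
    rw [div_pow, hw]
    field_simp

theorem isBigO_near_of_eval_eq_zero (hΨ : IsQuadratic Z A Ψ) (ha : S.p.eval a = 0) :
    (fun w : S.RegularPoint => w.p * atX Ψ w - 3 / 8 * A * (w.p' ^ 2 / w.p)) =O[near a]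
      fun _ => (1 : ℂ) := by
  obtain ⟨r, hr, hra⟩ := exists_eq_mul ha
  have hp : ∀ w : S.RegularPoint, w.p = (w.x - a) * r.eval w.x := fun w => by
    rw [RegularPoint.p, hr]; simp
  have hp' : ∀ w : S.RegularPoint,
      w.p' = r.eval w.x + (w.x - a) * r.derivative.eval w.x := fun w => by
    rw [p', hr]; simp
  have hsingular : (fun w : S.RegularPoint => r.eval w.x * (w.x - a) *
      (atX Ψ w - A * (3 / 8 / (w.x - a) ^ 2))) =O[near a] fun _ => (1 : ℂ) := by
    refine ((isBigO_one_of_continuousAt (S := S) r.continuousAt).mul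
      (isBigO_refl (fun w : S.RegularPoint => w.x - a) _)).mul (hΨ.isBigO_near_sub hr hra)
      |>.congr' EventuallyEq.rfl ?_
    filter_upwards [eventually_near_sqrtDomain hra] with w ⟨hxa, _⟩
    rw [one_mul, mul_inv_cancel₀ (sub_ne_zero.2 hxa)]
  have hregular : (fun w : S.RegularPoint => 2 * r.derivative.eval w.x +
      (w.x - a) * r.derivative.eval w.x ^ 2 / r.eval w.x) =O[near a] fun _ => (1 : ℂ) :=
    isBigO_one_of_continuousAt (S := S)
      (g := fun t => 2 * r.derivative.eval t + (t - a) * r.derivative.eval t ^ 2 / r.eval t)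
      (ContinuousAt.add (by fun_prop) (ContinuousAt.div (by fun_prop) (by fun_prop) hra))
  refine (hsingular.sub (hregular.const_mul_left (3 / 8 * A))).congr' ?_ EventuallyEq.rfl
  filter_upwards [eventually_near_sqrtDomain hra] with w ⟨hxa, _⟩
  have hsub : w.x - a ≠ 0 := sub_ne_zero.2 hxa
  have hrw : r.eval w.x ≠ 0 := right_ne_zero_of_mul (hp w ▸ w.p_ne_zero)
  rw [hp', hp]
  field_simp
  ring

end IsQuadratic

end BranchPoint

end HyperellipticSurface

/-! ### Quadratic fields at infinity -/

namespace HyperellipticSurface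

variable {S : HyperellipticSurface}

theorem eval_q {u : ℂ} (hu : u ≠ 0) : S.q.eval u = u ^ (2 * S.g + 2) * S.p.eval u⁻¹ := by
  have hdeg : S.p.natDegree ≤ 2 * S.g + 2 := by have := S.natDegree_p; omega
  let : Invertible u⁻¹ := invertibleOfNonzero (inv_ne_zero hu)
  have hreflect := Polynomial.eval₂_reflect_mul_pow (RingHom.id ℂ) u⁻¹ _ S.p hdeg
  rw [invOf_eq_inv, inv_inv] at hreflect
  change S.q.eval u * u⁻¹ ^ (2 * S.g + 2) = S.p.eval u⁻¹ at hreflect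
  rw [← hreflect, inv_pow, mul_comm, mul_assoc, inv_mul_cancel₀ (pow_ne_zero _ hu), mul_one]

theorem eval_p_div_sq {s : ℂ} (hs : s ≠ 0) :
    S.p.eval s / (s ^ (S.g + 1)) ^ 2 = S.q.eval s⁻¹ := by
  rw [eval_q (inv_ne_zero hs), inv_inv, inv_pow, ← pow_mul, add_mul, one_mul, mul_comm S.g,
    div_eq_inv_mul]

theorem coeff_zero_q : S.q.coeff 0 = S.p.coeff (2 * S.g + 2) := by
  rw [q, Polynomial.coeff_reflect, Polynomial.revAt_zero]

theorem coeff_one_q : S.q.coeff 1 = S.p.coeff (2 * S.g + 1) := by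
  rw [q, Polynomial.coeff_reflect, Polynomial.revAt_le (by omega)]
  rfl

theorem exists_q_eq_mul_of_odd (hn : S.p.natDegree = 2 * S.g + 1) :
    ∃ r : ℂ[X], S.q = (Polynomial.X - Polynomial.C 0) * r ∧ r.eval 0 ≠ 0 := by
  refine ⟨S.q.divX, ?_, ?_⟩
  · have hcoeff : S.q.coeff 0 = 0 := by
      rw [coeff_zero_q, Polynomial.coeff_eq_zero_of_natDegree_lt (by omega)]
    have := Polynomial.X_mul_divX_add S.q
    simpa [hcoeff] using this.symm
  · rw [← Polynomial.coeff_zero_eq_eval_zero, Polynomial.coeff_divX, coeff_one_q, ← hn]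
    exact Polynomial.leadingCoeff_ne_zero.2 S.p_ne_zero

theorem eval_zero_q_of_even (hn : S.p.natDegree = 2 * S.g + 2) : S.q.eval 0 ≠ 0 := by
  rw [← Polynomial.coeff_zero_eq_eval_zero, coeff_zero_q, ← hn]
  exact Polynomial.leadingCoeff_ne_zero.2 S.p_ne_zero

namespace Point

variable {u v : ℂ}

/-- The point with coordinates `(u, v)` on the affine curve `v ^ 2 = q u`. -/
def ofUV (u v : ℂ) (h : v ^ 2 = S.q.eval u) : S.Point :=
  if hu : u = 0 then infinity v (by rw [h, hu])
  else affine u⁻¹ (v / u ^ (S.g + 1)) (by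
    rw [← inv_inv u, ← eval_p_div_sq (inv_ne_zero hu)] at h
    rw [div_pow, h, inv_pow, inv_pow, div_inv_eq_mul,
      mul_div_cancel_right₀ _ (pow_ne_zero _ (pow_ne_zero _ hu))])

theorem ofUV_isNonzero (h : v ^ 2 = S.q.eval u) : (ofUV u v h).IsNonzero := by
  unfold ofUV
  split_ifs with hu
  · trivial
  · exact inv_ne_zero hu

theorem u_ofUV (h : v ^ 2 = S.q.eval u) : (ofUV u v h).u = u := by
  unfold ofUV
  split_ifs with hu
  · exact hu.symm
  · exact inv_inv u

theorem v_ofUV (h : v ^ 2 = S.q.eval u) : (ofUV u v h).v = v := by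
  unfold ofUV
  split_ifs with hu
  · rfl
  · change v / u ^ (S.g + 1) / u⁻¹ ^ (S.g + 1) = v
    rw [inv_pow, div_inv_eq_mul, div_mul_cancel₀ _ (pow_ne_zero _ hu)]

theorem ofUV_eq_affine {x y : ℂ} (h : v ^ 2 = S.q.eval u) (h' : y ^ 2 = S.p.eval x)
    (hx : x ≠ 0) (hu : u = x⁻¹) (hv : v = y / x ^ (S.g + 1)) : ofUV u v h = affine x y h' := by
  subst hu hv
  rw [ofUV, dif_neg (inv_ne_zero hx)]
  simp only [affine.injEq, inv_inv, true_and]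
  rw [inv_pow, div_inv_eq_mul, div_mul_cancel₀ _ (pow_ne_zero _ hx)]

theorem ofUV_notMem_image_toPoint (h : v ^ 2 = S.q.eval u) (hu : u = 0)
    (Z : Set S.RegularPoint) : ofUV u v h ∉ toPoint '' Z := by
  rintro ⟨z, -, hz⟩
  simp [ofUV, hu, toPoint] at hz

end Point

/-- The local coordinate on the affine curve `v ^ 2 = q u` whose inverse is `s ↦ (U s, W s)`. -/
def uvCoordinate (D : Set ℂ) (hD : IsOpen D) (U W : ℂ → ℂ) (h : ∀ s, W s ^ 2 = S.q.eval (U s))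
    (hU : ∀ s ∈ D, AnalyticAt ℂ U s) (hW : ∀ s ∈ D, AnalyticAt ℂ W s)
    (hinj : ∀ s ∈ D, ∀ t ∈ D, U s = U t → W s = W t → s = t) : S.LocalCoordinate where
  domain := D
  isOpen_domain := hD
  toPoint s := Point.ofUV (U s) (W s) (h s)
  holomorphic t ht := by
    refine Or.inr ⟨Eventually.of_forall fun s => Point.ofUV_isNonzero _, ?_, ?_⟩
    · simpa only [Point.u_ofUV] using hU t ht
    · simpa only [Point.v_ofUV] using hW t ht
  injOn s hs t ht hst := by
    refine hinj s hs t ht ?_ ?_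
    · simpa only [Point.u_ofUV] using congrArg Point.u hst
    · simpa only [Point.v_ofUV] using congrArg Point.v hst

theorem tendsto_inv_x_atInfinity :
    Tendsto (fun w : S.RegularPoint => w.x⁻¹) atInfinity (𝓝 0) :=
  (tendsto_inv₀_cobounded (α := ℂ)).comp tendsto_x_atInfinity

theorem eventually_x_ne_zero : ∀ᶠ w : S.RegularPoint in atInfinity, w.x ≠ 0 :=
  tendsto_x_atInfinity.eventually (Bornology.eventually_ne_cobounded 0)

theorem isBigO_inv_x_pow (k : ℕ) :
    (fun w : S.RegularPoint => w.x⁻¹ ^ k) =O[atInfinity] fun _ => (1 : ℂ) :=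
  (tendsto_inv_x_atInfinity.pow k).isBigO_one ℂ

theorem eventually_atInfinity_sqrtDomain {r : ℂ[X]} (hr0 : r.eval 0 ≠ 0) :
    ∀ᶠ w : S.RegularPoint in atInfinity, w.x ≠ 0 ∧ w.x⁻¹ ∈ sqrtDomain r 0 :=
  eventually_x_ne_zero.and (tendsto_inv_x_atInfinity.eventually (sqrtDomain_mem_nhds hr0))

theorem eventually_inv_mem_sqrtDomain {r : ℂ[X]} {x : ℂ} (hx : x ≠ 0)
    (hr : x⁻¹ ∈ sqrtDomain r 0) : ∀ᶠ s in 𝓝 x, s ≠ 0 ∧ s⁻¹ ∈ sqrtDomain r 0 :=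
  (isOpen_ne.eventually_mem hx).and
    ((continuousAt_inv₀ hx).eventually ((isOpen_sqrtDomain r 0).mem_nhds hr))

theorem analyticAt_sqrtNear_inv {r : ℂ[X]} {x : ℂ} (hr0 : r.eval 0 ≠ 0) (hx : x ≠ 0)
    (hr : x⁻¹ ∈ sqrtDomain r 0) : AnalyticAt ℂ (fun s => sqrtNear r 0 s⁻¹) x :=
  AnalyticAt.comp (g := sqrtNear r 0) (f := fun s => s⁻¹) (analyticAt_sqrtNear hr0 hr)
    (analyticAt_inv hx)

theorem branch_div_pow_sq (w : S.RegularPoint) {s : ℂ} (hs : s ≠ 0) :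
    (w.branch s / s ^ (S.g + 1)) ^ 2 = S.q.eval s⁻¹ := by
  rw [div_pow, branch_sq, eval_p_div_sq hs]

section Odd

variable {r : ℂ[X]}

/-- The local coordinate `s` with `1 / x = s ^ 2` around the point at infinity, for `n` odd. The
summand `0` is the base point of the general construction of square roots. -/
def oddInfinityCoordinate (hr : S.q = (Polynomial.X - Polynomial.C 0) * r) (hr0 : r.eval 0 ≠ 0) :
    S.LocalCoordinate :=
  uvCoordinate {s | 0 + s ^ 2 ∈ sqrtDomain r 0} ((isOpen_sqrtDomain r 0).preimage (by fun_prop))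
    (fun s => 0 + s ^ 2) (fun s => s * sqrtNear r 0 (0 + s ^ 2)) (mul_sqrtNear_sq hr hr0)
    (fun s _ => by fun_prop) (fun _ hs => analyticAt_mul_sqrtNear hr0 hs)
    (fun _ hs _ _ hsq hmul => eq_of_mul_sqrtNear_eq hr0 hs hsq hmul)

/-- The coordinate `s = v / √(q u / u)` around the point at infinity with `s ^ 2 = u = 1 / x`, as
a function of `x` near the point `w`. -/
def oddTransition (r : ℂ[X]) (w : S.RegularPoint) (s : ℂ) : ℂ :=
  w.branch s / s ^ (S.g + 1) / sqrtNear r 0 s⁻¹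

theorem oddTransition_sq (hr : S.q = (Polynomial.X - Polynomial.C 0) * r) (hr0 : r.eval 0 ≠ 0)
    (w : S.RegularPoint) {s : ℂ} (hs : s ≠ 0 ∧ s⁻¹ ∈ sqrtDomain r 0) :
    oddTransition r w s ^ 2 = s⁻¹ := by
  rw [oddTransition, div_sqrtNear_sq hr hr0 hs.2 (branch_div_pow_sq w hs.1), sub_zero]

theorem oddInfinityCoordinate_oddTransition (hr : S.q = (Polynomial.X - Polynomial.C 0) * r)
    (hr0 : r.eval 0 ≠ 0) (w : S.RegularPoint) {s : ℂ} (hs : s ≠ 0 ∧ s⁻¹ ∈ sqrtDomain r 0) :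
    (oddInfinityCoordinate hr hr0).toPoint (oddTransition r w s) = w.xCoordinate.toPoint s := by
  have hu : 0 + oddTransition r w s ^ 2 = s⁻¹ := by rw [oddTransition_sq hr hr0 w hs, zero_add]
  refine Point.ofUV_eq_affine (mul_sqrtNear_sq hr hr0 _) (w.branch_sq s) hs.1 hu ?_
  rw [hu, oddTransition, div_mul_cancel₀ _ (sqrtNear_ne_zero hr0 hs.2)]

theorem analyticAt_oddTransition (hr0 : r.eval 0 ≠ 0) {w : S.RegularPoint}
    (hw : w.x ≠ 0 ∧ w.x⁻¹ ∈ sqrtDomain r 0) : AnalyticAt ℂ (oddTransition r w) w.x :=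
  (w.analyticAt_branch.div (analyticAt_id.pow _) (pow_ne_zero _ hw.1)).div
    (analyticAt_sqrtNear_inv hr0 hw.1 hw.2) (sqrtNear_ne_zero hr0 hw.2)

theorem logDeriv_oddTransition (hr : S.q = (Polynomial.X - Polynomial.C 0) * r)
    (hr0 : r.eval 0 ≠ 0) {w : S.RegularPoint} (hw : w.x ≠ 0 ∧ w.x⁻¹ ∈ sqrtDomain r 0) :
    logDeriv (oddTransition r w) =ᶠ[𝓝 w.x] fun s => -1 / 2 / (s - 0) := by
  refine (logDeriv_eventuallyEq_of_sq (g := fun s => s⁻¹) (analyticAt_oddTransition hr0 hw)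
    ((eventually_inv_mem_sqrtDomain hw.1 hw.2).mono fun _ => oddTransition_sq hr hr0 w)).trans ?_
  exact Eventually.of_forall fun s => by simp only [logDeriv_inv, sub_zero, div_right_comm]

theorem tendsto_oddTransition (hr : S.q = (Polynomial.X - Polynomial.C 0) * r)
    (hr0 : r.eval 0 ≠ 0) :
    Tendsto (fun w : S.RegularPoint => oddTransition r w w.x) atInfinity (𝓝 0) := by
  refine tendsto_zero_of_sq (tendsto_inv_x_atInfinity.congr' ?_)
  filter_upwards [eventually_atInfinity_sqrtDomain hr0] with w hw
  exact (oddTransition_sq hr hr0 w hw).symm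

end Odd

theorem mul_sqrtNear_sq_of_even (hq : S.q.eval 0 ≠ 0) {ε : ℂ} (hε : ε ^ 2 = 1) (s : ℂ) :
    (ε * sqrtNear S.q 0 s) ^ 2 = S.q.eval s := by
  rw [mul_pow, sqrtNear_sq hq, hε, one_mul]

/-- The local coordinate `u = 1 / x` around the point at infinity `v = ε √(q 0)`, for `n` even. -/
def evenInfinityCoordinate (hq : S.q.eval 0 ≠ 0) {ε : ℂ} (hε : ε ^ 2 = 1) : S.LocalCoordinate :=
  uvCoordinate (sqrtDomain S.q 0) (isOpen_sqrtDomain S.q 0) (fun s => s)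
    (fun s => ε * sqrtNear S.q 0 s) (mul_sqrtNear_sq_of_even hq hε)
    (fun _ _ => by fun_prop) (fun _ hs => analyticAt_const.mul (analyticAt_sqrtNear hq hs))
    (fun _ _ _ _ h _ => h)

theorem evenInfinityCoordinate_inv (hq : S.q.eval 0 ≠ 0) {ε : ℂ} (hε : ε ^ 2 = 1)
    {w : S.RegularPoint} (hw : w.x ≠ 0 ∧ w.x⁻¹ ∈ sqrtDomain S.q 0)
    (hwε : w.y / w.x ^ (S.g + 1) = ε * sqrtNear S.q 0 w.x⁻¹) :
    ∀ᶠ s in 𝓝 w.x,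
      (evenInfinityCoordinate hq hε).toPoint s⁻¹ = w.xCoordinate.toPoint s := by
  have hne : ∀ᶠ s in 𝓝 w.x, s ≠ 0 := isOpen_ne.mem_nhds hw.1
  have hv : (fun s => w.branch s / s ^ (S.g + 1)) =ᶠ[𝓝 w.x]
      fun s => ε * sqrtNear S.q 0 s⁻¹ := by
    refine eventuallyEq_of_sq_eventuallyEq
      (w.analyticAt_branch.continuousAt.div (by fun_prop) (pow_ne_zero _ hw.1))
      (continuousAt_const.mul (analyticAt_sqrtNear_inv hq hw.1 hw.2).continuousAt)
      (hne.mono fun s hs => ?_) (by rwa [branch_self]) ?_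
    · rw [branch_div_pow_sq w hs, mul_sqrtNear_sq_of_even hq hε]
    · rw [branch_self]
      exact div_ne_zero w.y_ne_zero (pow_ne_zero _ hw.1)
  filter_upwards [hne, hv] with s hs hvs
  exact Point.ofUV_eq_affine (mul_sqrtNear_sq_of_even hq hε _) (w.branch_sq s) hs rfl hvs.symm

theorem y_div_pow_eq_or (hq : S.q.eval 0 ≠ 0) {w : S.RegularPoint} (hw : w.x ≠ 0) :
    w.y / w.x ^ (S.g + 1) = 1 * sqrtNear S.q 0 w.x⁻¹ ∨
      w.y / w.x ^ (S.g + 1) = -1 * sqrtNear S.q 0 w.x⁻¹ := by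
  have hsq : (w.y / w.x ^ (S.g + 1)) ^ 2 = sqrtNear S.q 0 w.x⁻¹ ^ 2 := by
    rw [sqrtNear_sq hq, div_pow, w.eqn, eval_p_div_sq hw]
  simpa using sq_eq_sq_iff_eq_or_eq_neg.1 hsq

namespace IsQuadratic

variable {Z : Set S.RegularPoint} {A : ℂ} {Ψ : S.LocalCoordinate → ℂ → ℂ}

theorem isBigO_atInfinity_sub_of_odd (hΨ : IsQuadratic Z A Ψ) (hn : S.p.natDegree = 2 * S.g + 1) :
    (fun w => atX Ψ w - A * (3 / 8 * w.x⁻¹ ^ 2)) =O[atInfinity] fun w => w.x⁻¹ ^ 3 := by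
  obtain ⟨r, hr, hr0⟩ := exists_q_eq_mul_of_odd hn
  have hinf := eventually_atInfinity_sqrtDomain (S := S) hr0
  refine (hΨ.isBigO_atX_sub atInfinity_le_cofinite (δ := oddInfinityCoordinate hr hr0) (a := 0)
    (h := oddTransition r) (α := -1 / 2) ?_
    (Point.ofUV_notMem_image_toPoint (mul_sqrtNear_sq hr hr0 0) (by simp) Z) (by norm_num) ?_
    (tendsto_oddTransition hr hr0)).congr' (Eventually.of_forall fun w => ?_) ?_
  · simpa [oddInfinityCoordinate, uvCoordinate] using self_mem_sqrtDomain hr0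
  · filter_upwards [hinf] with w hw
    refine ⟨analyticAt_oddTransition hr0 hw, hw.1, ?_, logDeriv_oddTransition hr hr0 hw⟩
    exact (eventually_inv_mem_sqrtDomain hw.1 hw.2).mono fun s =>
      oddInfinityCoordinate_oddTransition hr hr0 w
  · simp only [← div_div]
    norm_num [div_eq_mul_inv]
  · filter_upwards [hinf] with w hw
    rw [div_pow, oddTransition_sq hr hr0 w hw]
    ring

theorem isBigO_atInfinity_of_even (hΨ : IsQuadratic Z A Ψ) (hn : S.p.natDegree = 2 * S.g + 2) :
    atX Ψ =O[atInfinity] fun w => w.x⁻¹ ^ 4 := by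
  have hq := eval_zero_q_of_even hn
  have hside : ∀ ε : ℂ, ε ^ 2 = 1 →
      atX Ψ =O[atInfinity ⊓ 𝓟 {w | w.y / w.x ^ (S.g + 1) = ε * sqrtNear S.q 0 w.x⁻¹}]
        fun w => w.x⁻¹ ^ 4 := by
    intro ε hε
    refine (hΨ.isBigO_atX_sub (inf_le_left.trans atInfinity_le_cofinite)
      (δ := evenInfinityCoordinate hq hε) (a := 0) (h := fun _ s => s⁻¹) (α := -1)
      (self_mem_sqrtDomain hq)
      (Point.ofUV_notMem_image_toPoint (mul_sqrtNear_sq_of_even hq hε 0) rfl Z) (by norm_num) ?_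
      (tendsto_inv_x_atInfinity.mono_left inf_le_left)).congr (fun w => by simp) fun w => by
        rw [sub_zero]; ring
    filter_upwards [inf_le_left (a := atInfinity) (eventually_atInfinity_sqrtDomain (S := S) hq),
      mem_inf_of_right (mem_principal_self _)] with w hw hwε
    refine ⟨analyticAt_inv hw.1, hw.1, evenInfinityCoordinate_inv hq hε hw hwε, ?_⟩
    exact Eventually.of_forall fun s => by simp only [logDeriv_inv, sub_zero]
  refine ((hside 1 (by norm_num)).sup (hside (-1) (by norm_num))).mono ?_
  rw [← inf_sup_left, sup_principal, le_inf_iff, le_principal_iff]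
  exact ⟨le_rfl, eventually_x_ne_zero.mono fun _ => y_div_pow_eq_or hq⟩

theorem isBigO_atInfinity (hΨ : IsQuadratic Z A Ψ) : atX Ψ =O[atInfinity] fun _ => (1 : ℂ) := by
  rcases S.natDegree_p with hn | hn
  · refine (((hΨ.isBigO_atInfinity_sub_of_odd hn).trans (isBigO_inv_x_pow 3)).add
      ((isBigO_inv_x_pow 2).const_mul_left (A * (3 / 8)))).congr_left fun w => ?_
    ring
  · exact (hΨ.isBigO_atInfinity_of_even hn).trans (isBigO_inv_x_pow 4)

end IsQuadratic

end HyperellipticSurface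

/-! ### Correlation functions as quadratic fields -/

theorem injective_vec_three {α : Type*} {a b d : α} (hab : a ≠ b) (had : a ≠ d) (hbd : b ≠ d) :
    Function.Injective ![a, b, d] := by
  refine Fin.cons_injective_iff.2 ⟨?_, injective_pair_iff_ne.2 hbd⟩
  simp [hab, had]

namespace VirasoroState

variable {S : HyperellipticSurface} {c : ℂ} (V : VirasoroState S c)

section Insertion

variable {N : ℕ} {z : Fin N → S.RegularPoint}

theorem mem_config (hz : Function.Injective z) :
    (fun i => (z i).x) ∈ config fun i => (z i).xCoordinate := by
  refine ⟨fun i => (z i).mem_xCoordinate_domain, ?_⟩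
  simp only [xCoordinate_toPoint_self]
  exact toPoint_injective.comp hz

theorem cons_mem_config (hz : Function.Injective z) {δ : S.LocalCoordinate} {t : ℂ}
    (ht : t ∈ δ.domain) (htz : δ.toPoint t ∉ toPoint '' Set.range z) :
    (Fin.cons t fun i => (z i).x : Fin (N + 1) → ℂ) ∈
      config (Fin.cons δ fun i => (z i).xCoordinate : Fin (N + 1) → S.LocalCoordinate) := by
  refine ⟨Fin.cases ht fun j => (z j).mem_xCoordinate_domain, ?_⟩
  suffices Function.Injective (Fin.cons (δ.toPoint t) (toPoint ∘ z) : Fin (N + 1) → S.Point) by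
    convert this using 1
    exact funext (Fin.cases rfl fun j => (z j).xCoordinate_toPoint_self)
  exact Fin.cons_injective_iff.2 ⟨by rwa [Set.range_comp], toPoint_injective.comp hz⟩

theorem npoint_comp_perm (hz : Function.Injective z) (σ : Equiv.Perm (Fin N)) :
    V.npoint (z ∘ σ) = V.npoint z :=
  V.symmetric N _ σ _ (mem_config hz)

/-- The `(N + 1)`-point function with the first field in the coordinate `δ` and all others in the
coordinate `x`. -/
def insertion (z : Fin N → S.RegularPoint) (δ : S.LocalCoordinate) (t : ℂ) : ℂ :=
  V.corr (N + 1) (Fin.cons δ fun i => (z i).xCoordinate) (Fin.cons t fun i => (z i).x)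

theorem cons_comp_regularPoint {α : Type*} (φ : S.RegularPoint → α) (w : S.RegularPoint)
    (z : Fin N → S.RegularPoint) :
    (fun i => φ ((Fin.cons w z : Fin (N + 1) → S.RegularPoint) i)) =
      Fin.cons (φ w) fun i => φ (z i) :=
  funext (Fin.cases rfl fun _ => rfl)

theorem npoint_cons (w : S.RegularPoint) (z : Fin N → S.RegularPoint) :
    V.npoint (Fin.cons w z : Fin (N + 1) → S.RegularPoint) = atX (V.insertion z) w := by
  rw [npoint, atX, insertion, cons_comp_regularPoint xCoordinate, cons_comp_regularPoint x]

theorem isQuadratic_insertion (hz : Function.Injective z) :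
    IsQuadratic (Set.range z) (c / 12 * V.npoint z) (V.insertion z) where
  finite := Set.finite_range z
  analyticAt δ t ht htz := by
    have hcons : AnalyticAt ℂ
        (fun t : ℂ => (Fin.cons t fun i => (z i).x : Fin (N + 1) → ℂ)) t :=
      analyticAt_pi_iff.2 (Fin.cases analyticAt_id fun _ => analyticAt_const)
    exact AnalyticAt.comp (V.holomorphic _ _ _ (cons_mem_config hz ht htz)) hcons
  transform γ δ t h ht htz hh hδ hchange := by
    have htrans := V.transform N _ _ (cons_mem_config hz ht htz) 0 δ h hh hδ hchange
    rw [Fin.cons_zero, Fin.update_cons_zero, Fin.update_cons_zero, Fin.removeNth_zero,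
      Fin.removeNth_zero, Fin.tail_cons, Fin.tail_cons] at htrans
    rw [insertion, htrans, insertion, npoint]
    ring

theorem exists_ope_insertion {z₀ : S.RegularPoint}
    (hz : Function.Injective (Fin.cons z₀ z : Fin (N + 1) → S.RegularPoint)) :
    ∃ Φ : ℂ, (fun t => V.insertion (Fin.cons z₀ z : Fin (N + 1) → S.RegularPoint)
        z₀.xCoordinate t -
      (c / 2 / (t - z₀.x) ^ 4 * V.npoint z + 1 / (t - z₀.x) ^ 2 *
        (V.insertion z z₀.xCoordinate t + atX (V.insertion z) z₀) + Φ))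
      =O[𝓝[≠] z₀.x] fun t => t - z₀.x := by
  rw [Fin.cons_injective_iff] at hz
  have hmem := cons_mem_config hz.2 z₀.mem_xCoordinate_domain (by
    rw [xCoordinate_toPoint_self, toPoint_injective.mem_set_image]
    exact hz.1)
  unfold insertion
  rw [cons_comp_regularPoint xCoordinate, cons_comp_regularPoint x]
  exact V.ope N z₀.xCoordinate _ z₀.x _ hmem

theorem isBigO_ope {z₀ : S.RegularPoint}
    (hz : Function.Injective (Fin.cons z₀ z : Fin (N + 1) → S.RegularPoint)) :
    (fun t => V.npoint (Fin.cons (z₀.lift t) (Fin.cons z₀ z : Fin (N + 1) → S.RegularPoint) :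
        Fin (N + 2) → S.RegularPoint) -
      (c / 2 / (t - z₀.x) ^ 4 * V.npoint z + 1 / (t - z₀.x) ^ 2 *
        (V.npoint (Fin.cons (z₀.lift t) z : Fin (N + 1) → S.RegularPoint) +
          V.npoint (Fin.cons z₀ z : Fin (N + 1) → S.RegularPoint))))
      =O[𝓝[≠] z₀.x] fun _ => (1 : ℂ) := by
  obtain ⟨Φ, hΦ⟩ := V.exists_ope_insertion hz
  have hsub : (fun t : ℂ => t - z₀.x) =O[𝓝[≠] z₀.x] fun _ => (1 : ℂ) :=
    isBigO_one_nhdsNE_of_continuousAt (by fun_prop)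
  refine ((hΦ.trans hsub).add (isBigO_const_one ℂ Φ _)).congr' ?_ EventuallyEq.rfl
  filter_upwards [nhdsWithin_le_nhds ((V.isQuadratic_insertion hz).atX_lift_eventuallyEq z₀),
    nhdsWithin_le_nhds ((V.isQuadratic_insertion
      (Fin.cons_injective_iff.1 hz).2).atX_lift_eventuallyEq z₀)] with t hcons hlift
  rw [npoint_cons, npoint_cons, npoint_cons, hcons, hlift]
  ring

end Insertion

section Symmetry

variable {z₁ z₂ z₃ : S.RegularPoint}

theorem npoint_two_comm (h : z₁ ≠ z₂) : V.npoint ![z₁, z₂] = V.npoint ![z₂, z₁] := by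
  rw [← V.npoint_comp_perm (injective_pair_iff_ne.2 h.symm) (Equiv.swap 0 1)]
  congr 1
  ext1 i
  fin_cases i <;> rfl

theorem npoint_three_comm_left (h12 : z₁ ≠ z₂) (h13 : z₁ ≠ z₃) (h23 : z₂ ≠ z₃) :
    V.npoint ![z₁, z₂, z₃] = V.npoint ![z₂, z₁, z₃] := by
  rw [← V.npoint_comp_perm (injective_vec_three h12.symm h23 h13) (Equiv.swap 0 1)]
  congr 1
  ext1 i
  fin_cases i <;> rfl

theorem npoint_three_comm_right (h12 : z₁ ≠ z₂) (h13 : z₁ ≠ z₃) (h23 : z₂ ≠ z₃) :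
    V.npoint ![z₁, z₂, z₃] = V.npoint ![z₁, z₃, z₂] := by
  rw [← V.npoint_comp_perm (injective_vec_three h13 h12 h23.symm) (Equiv.swap 1 2)]
  congr 1
  ext1 i
  fin_cases i <;> rfl

theorem conn2_comm (h : z₁ ≠ z₂) : V.conn2 z₁ z₂ = V.conn2 z₂ z₁ := by
  rw [conn2, conn2, V.npoint_two_comm h, mul_comm (V.conn1 z₁)]

theorem conn3_comm_left (h12 : z₁ ≠ z₂) (h13 : z₁ ≠ z₃) (h23 : z₂ ≠ z₃) :
    V.conn3 z₁ z₂ z₃ = V.conn3 z₂ z₁ z₃ := by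
  rw [conn3, conn3, V.npoint_three_comm_left h12 h13 h23, V.conn2_comm h12, V.conn2_comm h23,
    V.conn2_comm h13.symm]
  ring

theorem conn3_comm_right (h12 : z₁ ≠ z₂) (h13 : z₁ ≠ z₃) (h23 : z₂ ≠ z₃) :
    V.conn3 z₁ z₂ z₃ = V.conn3 z₁ z₃ z₂ := by
  rw [conn3, conn3, V.npoint_three_comm_right h12 h13 h23, V.conn2_comm h12, V.conn2_comm h23,
    V.conn2_comm h13.symm]
  ring

end Symmetry

section ConnectedFields

/-- The connected one-point function, in an arbitrary local coordinate. -/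
def connField1 : S.LocalCoordinate → ℂ → ℂ := V.one⁻¹ • V.insertion ![]

/-- The connected two-point function, as a field in its first argument (in an arbitrary local
coordinate). -/
def connField2 (z : S.RegularPoint) : S.LocalCoordinate → ℂ → ℂ :=
  V.one⁻¹ • V.insertion ![z] + (-V.conn1 z) • V.connField1

/-- The connected three-point function, as a field in its first argument (in an arbitrary local
coordinate). It contains the two-point functions with their first argument at this point. -/
def connField3 (z₂ z₃ : S.RegularPoint) : S.LocalCoordinate → ℂ → ℂ :=
  V.one⁻¹ • V.insertion ![z₂, z₃] + (-V.conn1 z₃) • V.connField2 z₂ +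
    (-V.conn1 z₂) • V.connField2 z₃ + (-V.conn2 z₂ z₃ - V.conn1 z₂ * V.conn1 z₃) • V.connField1

theorem atX_connField1 (w : S.RegularPoint) : atX V.connField1 w = V.conn1 w :=
  congrArg (V.one⁻¹ * ·) (V.npoint_cons w ![]).symm

theorem atX_connField2 (w z : S.RegularPoint) : atX (V.connField2 z) w = V.conn2 w z := by
  change V.one⁻¹ * atX (V.insertion ![z]) w + -V.conn1 z * atX V.connField1 w = _
  rw [← npoint_cons, atX_connField1, conn2, mul_comm (V.conn1 w), neg_mul, ← sub_eq_add_neg]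
  rfl

theorem atX_connField3 (w z₂ z₃ : S.RegularPoint) :
    atX (V.connField3 z₂ z₃) w = V.one⁻¹ * V.npoint ![w, z₂, z₃] - V.conn2 w z₂ * V.conn1 z₃ -
      V.conn2 z₂ z₃ * V.conn1 w - V.conn2 w z₃ * V.conn1 z₂ -
      V.conn1 w * V.conn1 z₂ * V.conn1 z₃ := by
  change V.one⁻¹ * atX (V.insertion ![z₂, z₃]) w + -V.conn1 z₃ * atX (V.connField2 z₂) w +
    -V.conn1 z₂ * atX (V.connField2 z₃) w +
    (-V.conn2 z₂ z₃ - V.conn1 z₂ * V.conn1 z₃) * atX V.connField1 w = _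
  rw [← npoint_cons, atX_connField2, atX_connField2, atX_connField1]
  simp only [Matrix.vecCons]
  ring

theorem conn3_eq_atX {w z₂ z₃ : S.RegularPoint} (h : w ≠ z₃) :
    V.conn3 w z₂ z₃ = atX (V.connField3 z₂ z₃) w := by
  rw [conn3, atX_connField3, V.conn2_comm h]

theorem isQuadratic_connField1 (hV : V.one ≠ 0) : IsQuadratic ∅ (c / 12) V.connField1 := by
  have hins := V.isQuadratic_insertion (z := ![]) (Function.injective_of_subsingleton _)
  have hcoeff : V.one⁻¹ * (c / 12 * V.one) = c / 12 := by field_simp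
  rw [Set.range_eq_empty] at hins
  exact hcoeff ▸ hins.const_smul V.one⁻¹

theorem isQuadratic_connField2 (hV : V.one ≠ 0) (z : S.RegularPoint) :
    IsQuadratic {z} 0 (V.connField2 z) := by
  have hins := V.isQuadratic_insertion (z := ![z]) (Function.injective_of_subsingleton _)
  rw [Matrix.range_cons_empty] at hins
  have hcoeff : V.one⁻¹ * (c / 12 * V.npoint ![z]) + -V.conn1 z * (c / 12) = 0 := by
    rw [conn1]
    ring
  exact hcoeff ▸ (hins.const_smul V.one⁻¹).add (((V.isQuadratic_connField1 hV).mono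
    (Set.empty_subset {z}) (Set.finite_singleton z)).const_smul (-V.conn1 z))

theorem isQuadratic_connField3 (hV : V.one ≠ 0) {z₂ z₃ : S.RegularPoint} (h : z₂ ≠ z₃) :
    IsQuadratic {z₂, z₃} 0 (V.connField3 z₂ z₃) := by
  have hfin : ({z₂, z₃} : Set S.RegularPoint).Finite := Set.toFinite _
  have hins := V.isQuadratic_insertion (z := ![z₂, z₃]) (injective_pair_iff_ne.2 h)
  rw [Matrix.range_cons_cons_empty] at hins
  have hconn1 := (V.isQuadratic_connField1 hV).mono (Set.empty_subset {z₂, z₃}) hfin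
  have hconn2 := (V.isQuadratic_connField2 hV z₂).mono (Z' := {z₂, z₃}) (by simp) hfin
  have hconn2' := (V.isQuadratic_connField2 hV z₃).mono (Z' := {z₂, z₃}) (by simp) hfin
  have hcoeff : V.one⁻¹ * (c / 12 * V.npoint ![z₂, z₃]) + -V.conn1 z₃ * 0 + -V.conn1 z₂ * 0 +
      (-V.conn2 z₂ z₃ - V.conn1 z₂ * V.conn1 z₃) * (c / 12) = 0 := by
    rw [conn2]
    ring
  exact hcoeff ▸ (((hins.const_smul V.one⁻¹).add (hconn2.const_smul (-V.conn1 z₃))).add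
    (hconn2'.const_smul (-V.conn1 z₂))).add
    (hconn1.const_smul (-V.conn2 z₂ z₃ - V.conn1 z₂ * V.conn1 z₃))

end ConnectedFields

end VirasoroState

/-! ### Poles of the one- and two-point functions -/

theorem exists_eq_add_mul_of_analyticAt {g : ℂ → ℂ} {b : ℂ} (hg : AnalyticAt ℂ g b) :
    ∃ g₁ : ℂ → ℂ, AnalyticAt ℂ g₁ b ∧ ∀ t, g t = g b + (t - b) * g₁ t := by
  obtain ⟨p, hp⟩ := hg
  refine ⟨dslope g b, hp.has_fpower_series_dslope_fslope.analyticAt, fun t => ?_⟩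
  rw [← smul_eq_mul, sub_smul_dslope, add_sub_cancel]

theorem isBigO_one_mul {α : Type*} {l : Filter α} {F G : α → ℂ}
    (hF : F =O[l] fun _ => (1 : ℂ)) (hG : G =O[l] fun _ => (1 : ℂ)) :
    (fun x => F x * G x) =O[l] fun _ => (1 : ℂ) := by
  simpa only [mul_one] using hF.mul hG

theorem double_pole_cancel {Y α v K κ κ₁ δ : ℂ} (hδ : δ ≠ 0) (hY : Y = α + δ * v)
    (hK : K = κ + δ * κ₁) :
    Y ^ 2 * α ^ 2 * (1 / δ ^ 2 * (K + κ)) -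
      ((Y + α) / δ) ^ 2 / 4 * (Y ^ 2 * K + α ^ 2 * κ) =
    -v ^ 2 / 4 * (Y ^ 2 * K + α ^ 2 * κ) - Y * α * v * (v * K + α * κ₁) := by
  subst hY hK
  field_simp
  ring

theorem fourth_order_pole_cancel {Y Y' α β v u u' δ : ℂ} (hδ : δ ≠ 0) (hv : v = β + δ * u)
    (hY : Y = α + δ * v) (hY' : Y' = β + 2 * δ * u + δ ^ 2 * u') :
    16 * (Y ^ 2 * α ^ 2) / δ ^ 4 - ((Y + α) / δ) ^ 4 +
      ((Y + α) / δ) ^ 2 * (Y' ^ 2 + β ^ 2) =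
    (Y + α) ^ 2 * (2 * u ^ 2 + 2 * (β + 2 * δ * u) * u' + δ ^ 2 * u' ^ 2) + v ^ 4 := by
  have hsq : δ ^ 2 * (Y' ^ 2 + β ^ 2) - 2 * (δ * v) ^ 2 =
      δ ^ 4 * (2 * u ^ 2 + 2 * (β + 2 * δ * u) * u' + δ ^ 2 * u' ^ 2) := by
    subst hv hY'; ring
  have hδv : δ * v = Y - α := by rw [hY]; ring
  have hv_eq : v = (Y - α) / δ := by rw [← hδv]; field_simp
  rw [hδv] at hsq
  rw [hv_eq]
  field_simp
  linear_combination (Y + α) ^ 2 * hsq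

namespace HyperellipticSurface

variable {S : HyperellipticSurface}

namespace RegularPoint

theorem eval_derivative_eq (z : S.RegularPoint) {t : ℂ} (h : DifferentiableAt ℂ z.branch t) :
    S.p.derivative.eval t = 2 * z.branch t * deriv z.branch t := by
  have hsq : HasDerivAt (z.branch ^ 2) _ t := h.hasDerivAt.pow 2
  rw [show z.branch ^ 2 = fun s => S.p.eval s from funext z.branch_sq] at hsq
  rw [(S.p.hasDerivAt t).unique hsq]
  push_cast
  ring

theorem analyticAt_lift_eval (z : S.RegularPoint) (r : ℂ[X]) :
    AnalyticAt ℂ (fun t => r.eval (z.lift t).x) z.x :=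
  ((Polynomial.differentiable r).analyticAt z.x).congr
    (z.lift_x_eventuallyEq.symm.fun_comp fun t => r.eval t)

theorem lift_p {z : S.RegularPoint} {t : ℂ} (h : S.p.eval t ≠ 0) :
    (z.lift t).p = z.branch t ^ 2 := by
  rw [p_eq, lift_y h]

theorem lift_p'_sq_div_lift_p {z : S.RegularPoint} {t : ℂ} (ht : S.p.eval t ≠ 0)
    (h : DifferentiableAt ℂ z.branch t) :
    (z.lift t).p' ^ 2 / (z.lift t).p = 4 * deriv z.branch t ^ 2 := by
  have hy : z.branch t ≠ 0 := by rw [← lift_y ht]; exact y_ne_zero _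
  rw [p', lift_x ht, z.eval_derivative_eq h, lift_p ht]
  field_simp
  ring

theorem exists_branch_expansion (z : S.RegularPoint) : ∃ u : ℂ → ℂ, AnalyticAt ℂ u z.x ∧
    (∀ t, z.branch t = z.y + (t - z.x) * (deriv z.branch z.x + (t - z.x) * u t)) ∧
    ∀ᶠ t in 𝓝 z.x, deriv z.branch t =
      deriv z.branch z.x + 2 * (t - z.x) * u t + (t - z.x) ^ 2 * deriv u t := by
  obtain ⟨v, hv, hbranch⟩ := exists_eq_add_mul_of_analyticAt z.analyticAt_branch
  obtain ⟨u, hu, hvu⟩ := exists_eq_add_mul_of_analyticAt hv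
  have htaylor : ∀ t, z.branch t = z.y + (t - z.x) * (v z.x + (t - z.x) * u t) := fun t => by
    rw [hbranch t, hvu t, branch_self]
  have hderiv : ∀ᶠ t in 𝓝 z.x, deriv z.branch t =
      v z.x + 2 * (t - z.x) * u t + (t - z.x) ^ 2 * deriv u t := by
    filter_upwards [hu.eventually_analyticAt] with t ht
    have hid : HasDerivAt (fun t : ℂ => t - z.x) 1 t := (hasDerivAt_id t).sub_const _
    have hbranch' := (hid.mul ((hid.mul ht.differentiableAt.hasDerivAt).const_add
      (v z.x))).const_add z.y
    rw [funext htaylor]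
    refine hbranch'.deriv.trans ?_
    simp only [Pi.mul_apply]
    ring
  have hv_eq : deriv z.branch z.x = v z.x := by
    rw [hderiv.self_of_nhds]
    ring
  rw [hv_eq]
  exact ⟨u, hu, htaylor, hderiv⟩

theorem conj_ne (z : S.RegularPoint) : z.conj ≠ z := fun h =>
  z.y_ne_zero (neg_eq_self.1 (congrArg y h))

end RegularPoint

/-- The functions to which the Riemann–Roch type argument `exists_polynomials` applies, apart from
their behaviour at `B`: `F` is holomorphic off the points with `x`-coordinate in `B`, bounded near
the branch points, and `O(x ^ D)` at infinity. -/
structure IsTame (B : Set ℂ) (D : ℕ) (F : S.RegularPoint → ℂ) : Prop where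
  analyticAt : ∀ z : S.RegularPoint, z.x ∉ B → AnalyticAt ℂ (fun t => F (z.lift t)) z.x
  near_branch : ∀ a, S.p.eval a = 0 → F =O[near a] fun _ => (1 : ℂ)
  atInfinity : F =O[atInfinity] fun w => w.x ^ D

theorem isBigO_x_pow {m k : ℕ} (h : m ≤ k) :
    (fun w : S.RegularPoint => w.x ^ m) =O[atInfinity] fun w => w.x ^ k :=
  (isBigO_pow_pow_cobounded_of_le h).comp_tendsto tendsto_x_atInfinity

theorem isBigO_eval (r : ℂ[X]) {k : ℕ} (h : r.natDegree ≤ k) :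
    (fun w : S.RegularPoint => r.eval w.x) =O[atInfinity] fun w => w.x ^ k := by
  simp only [Polynomial.eval_eq_sum_range]
  exact IsBigO.fun_sum fun i hi => (isBigO_x_pow
    ((Nat.lt_succ_iff.1 (Finset.mem_range.1 hi)).trans h)).const_mul_left _

namespace IsTame

variable {B B' : Set ℂ} {D D' : ℕ} {F G : S.RegularPoint → ℂ}

theorem isBigO_lift (h : IsTame B D F) {z : S.RegularPoint} (hz : z.x ∉ B) :
    (fun t => F (z.lift t)) =O[𝓝[≠] z.x] fun _ => (1 : ℂ) :=
  isBigO_one_nhdsNE_of_continuousAt (h.analyticAt z hz).continuousAt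

theorem mono (h : IsTame B D F) (hB : B ⊆ B') (hD : D ≤ D') : IsTame B' D' F where
  analyticAt z hz := h.analyticAt z fun hzB => hz (hB hzB)
  near_branch := h.near_branch
  atInfinity := h.atInfinity.trans (isBigO_x_pow hD)

theorem add (hF : IsTame B D F) (hG : IsTame B D G) : IsTame B D fun w => F w + G w where
  analyticAt z hz := (hF.analyticAt z hz).add (hG.analyticAt z hz)
  near_branch a ha := (hF.near_branch a ha).add (hG.near_branch a ha)
  atInfinity := hF.atInfinity.add hG.atInfinity

theorem const_mul (k : ℂ) (hF : IsTame B D F) : IsTame B D fun w => k * F w where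
  analyticAt z hz := analyticAt_const.mul (hF.analyticAt z hz)
  near_branch a ha := (hF.near_branch a ha).const_mul_left k
  atInfinity := hF.atInfinity.const_mul_left k

theorem sub (hF : IsTame B D F) (hG : IsTame B D G) : IsTame B D fun w => F w - G w where
  analyticAt z hz := (hF.analyticAt z hz).sub (hG.analyticAt z hz)
  near_branch a ha := (hF.near_branch a ha).sub (hG.near_branch a ha)
  atInfinity := hF.atInfinity.sub hG.atInfinity

theorem const (k : ℂ) : IsTame B D fun _ : S.RegularPoint => k where
  analyticAt _ _ := analyticAt_const
  near_branch _ _ := isBigO_const_one ℂ k _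
  atInfinity := by
    simpa only [pow_zero, mul_one] using
      (isBigO_x_pow (S := S) (Nat.zero_le D)).const_mul_left k

theorem mul (hF : IsTame B D F) (hG : IsTame B D' G) :
    IsTame B (D + D') fun w => F w * G w where
  analyticAt z hz := (hF.analyticAt z hz).mul (hG.analyticAt z hz)
  near_branch a ha := isBigO_one_mul (hF.near_branch a ha) (hG.near_branch a ha)
  atInfinity := by simpa only [pow_add] using hF.atInfinity.mul hG.atInfinity

theorem congr (hF : IsTame B D F) (h : ∀ w, G w = F w) : IsTame B D G :=
  (funext h : G = F) ▸ hF

theorem eval (r : ℂ[X]) {k : ℕ} (h : r.natDegree ≤ k) :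
    IsTame ∅ k fun w : S.RegularPoint => r.eval w.x where
  analyticAt z _ := z.analyticAt_lift_eval r
  near_branch _ _ := isBigO_one_of_continuousAt r.continuous.continuousAt
  atInfinity := isBigO_eval r h

end IsTame

theorem isTame_p : IsTame ∅ S.n fun w : S.RegularPoint => w.p := IsTame.eval S.p le_rfl

theorem isTame_p' : IsTame ∅ S.n fun w : S.RegularPoint => w.p' :=
  IsTame.eval S.p.derivative ((Polynomial.natDegree_derivative_le _).trans (Nat.sub_le _ _))

theorem isBigO_y_atInfinity :
    (fun w : S.RegularPoint => w.y) =O[atInfinity] fun w => w.x ^ S.n := by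
  refine (IsBigO.of_bound 1 ?_).trans isTame_p.atInfinity
  filter_upwards [eventually_one_le_norm_y] with w hw
  rw [p_eq, norm_pow, one_mul, sq]
  exact le_mul_of_one_le_left (norm_nonneg _) hw

theorem isBigO_inv_p_atInfinity :
    (fun w : S.RegularPoint => w.p⁻¹) =O[atInfinity] fun _ => (1 : ℂ) := by
  refine IsBigO.of_bound 1 ?_
  filter_upwards [eventually_one_le_norm_y] with w hw
  rw [p_eq, norm_inv, norm_pow, norm_one, mul_one]
  exact inv_le_one_of_one_le₀ (one_le_pow₀ hw)

theorem isTame_y : IsTame ∅ S.n fun w : S.RegularPoint => w.y where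
  analyticAt z _ := z.analyticAt_lift_y
  near_branch a ha := by
    obtain ⟨M, hM⟩ := (isTame_p.near_branch a ha).bound
    refine IsBigO.of_bound (M + 1) ?_
    filter_upwards [hM] with w hw
    rw [p_eq, norm_pow] at hw
    simp only [norm_one, mul_one] at hw ⊢
    nlinarith [norm_nonneg w.y, sq_nonneg (‖w.y‖ - 1)]
  atInfinity := isBigO_y_atInfinity

theorem isTame_inv_sub (b : ℂ) (hb : S.p.eval b ≠ 0) :
    IsTame {b} 0 fun w : S.RegularPoint => (w.x - b)⁻¹ where
  analyticAt z hz :=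
    (z.analyticAt_lift_x.sub analyticAt_const).inv (by simpa [sub_ne_zero] using hz)
  near_branch a ha := by
    have hab : a ≠ b := by rintro rfl; exact hb ha
    exact isBigO_one_of_continuousAt (g := fun t => (t - b)⁻¹)
      (ContinuousAt.inv₀ (by fun_prop) (sub_ne_zero.2 hab))
  atInfinity := by
    have hinv : Tendsto (fun t : ℂ => (t - b)⁻¹) (Bornology.cobounded ℂ) (𝓝 0) :=
      tendsto_inv₀_cobounded.comp (tendsto_sub_const_cobounded b)
    simpa only [pow_zero, Function.comp_def] using
      (hinv.comp (tendsto_x_atInfinity (S := S))).isBigO_one ℂ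

theorem IsQuadratic.isTame_p_mul {Z : Set S.RegularPoint} {Ψ : S.LocalCoordinate → ℂ → ℂ}
    (hΨ : IsQuadratic Z 0 Ψ) : IsTame (x '' Z) S.n fun w => w.p * atX Ψ w where
  analyticAt z hz := (isTame_p.analyticAt z (Set.notMem_empty _)).mul
    (hΨ.analyticAt_atX_lift fun hzZ => hz (Set.mem_image_of_mem x hzZ))
  near_branch a ha := (hΨ.isBigO_near_of_eval_eq_zero ha).congr_left fun w => by ring
  atInfinity := by
    simpa only [mul_one] using isTame_p.atInfinity.mul hΨ.isBigO_atInfinity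

end HyperellipticSurface

namespace VirasoroState

variable {S : HyperellipticSurface} {c : ℂ} (V : VirasoroState S c)

section NormalizedFunctions

theorem isTame_f (z : S.RegularPoint) : IsTame {z.x} (2 * S.n) fun w => f w z := by
  have hy := ((isTame_y (S := S)).add (IsTame.const z.y)).mono (Set.empty_subset {z.x}) le_rfl
  have hroot := hy.mul (isTame_inv_sub z.x z.p_ne_zero)
  refine ((hroot.mul hroot).mono le_rfl (by lia)).congr fun w => ?_
  rw [f, div_eq_mul_inv, sq]

theorem f_comm (z w : S.RegularPoint) : f z w = f w z := by
  rw [f, f, ← neg_sub w.x, div_neg, neg_sq, add_comm]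

/-- The function `P`, divided by `⟨1⟩`. -/
def nP (z : S.RegularPoint) : ℂ := V.one⁻¹ * V.P z

/-- The regular part `r` of the two-point function, divided by `⟨1⟩`. -/
def nreg (z w : S.RegularPoint) : ℂ := V.one⁻¹ * V.reg z w

theorem nP_eq (hV : V.one ≠ 0) (z : S.RegularPoint) :
    V.nP z = 4 * (z.p * V.conn1 z - c / 32 * (z.p' ^ 2 / z.p)) := by
  rw [nP, P, conn1]
  field_simp

theorem nreg_eq (hV : V.one ≠ 0) (z w : S.RegularPoint) :
    V.nreg z w = z.p * w.p * V.conn2 z w - c / 32 * f z w ^ 2 -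
      1 / 16 * f z w * (V.nP z + V.nP w) := by
  rw [nreg, reg, nP_eq V hV, nP_eq V hV, conn2, conn1, conn1]
  field_simp
  ring

theorem nreg_comm (hV : V.one ≠ 0) {z w : S.RegularPoint} (h : z ≠ w) :
    V.nreg z w = V.nreg w z := by
  rw [nreg_eq V hV, nreg_eq V hV, V.conn2_comm h, f_comm]
  ring

theorem analyticAt_conn1_lift (hV : V.one ≠ 0) (z : S.RegularPoint) :
    AnalyticAt ℂ (fun t => V.conn1 (z.lift t)) z.x :=
  (V.isQuadratic_connField1 hV).analyticAt_atX_lift (Set.notMem_empty z)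
    |>.congr (.of_forall fun _ => V.atX_connField1 _)

theorem analyticAt_conn2_lift (hV : V.one ≠ 0) {z w : S.RegularPoint} (h : z ≠ w) :
    AnalyticAt ℂ (fun t => V.conn2 (z.lift t) w) z.x :=
  (V.isQuadratic_connField2 hV w).analyticAt_atX_lift (Set.mem_singleton_iff.not.2 h)
    |>.congr (.of_forall fun _ => V.atX_connField2 _ _)

theorem isBigO_nP_atInfinity (hV : V.one ≠ 0) : V.nP =O[atInfinity] fun w => w.x ^ (2 * S.n) := by
  have hpole : (fun w : S.RegularPoint => w.p * V.conn1 w) =O[atInfinity]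
      fun w => w.x ^ (2 * S.n) := by
    have hprod := isTame_p.atInfinity.mul (V.isQuadratic_connField1 hV).isBigO_atInfinity
    simp only [mul_one, atX_connField1] at hprod
    exact hprod.trans (isBigO_x_pow (by lia))
  have hschwarz : (fun w : S.RegularPoint => w.p' ^ 2 / w.p) =O[atInfinity]
      fun w => w.x ^ (2 * S.n) := by
    have hprod := (isTame_p'.atInfinity.pow 2).mul (isBigO_inv_p_atInfinity (S := S))
    simpa only [mul_one, ← pow_mul, ← div_eq_mul_inv, mul_comm S.n 2] using hprod
  exact ((hpole.sub (hschwarz.const_mul_left (c / 32))).const_mul_left 4).congr_left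
    fun w => (V.nP_eq hV w).symm

theorem isTame_nP (hV : V.one ≠ 0) : IsTame ∅ (2 * S.n) V.nP where
  analyticAt z hz := by
    simp only [nP_eq V hV]
    have hp := isTame_p.analyticAt z hz
    exact analyticAt_const.mul ((hp.mul (V.analyticAt_conn1_lift hV z)).sub
      (analyticAt_const.mul (((isTame_p'.analyticAt z hz).pow 2).div hp (p_ne_zero _))))
  near_branch a ha := by
    refine (((V.isQuadratic_connField1 hV).isBigO_near_of_eval_eq_zero
      ha).const_mul_left 4).congr_left fun w => ?_
    rw [nP_eq V hV, atX_connField1]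
    ring
  atInfinity := V.isBigO_nP_atInfinity hV

theorem isTame_nreg (hV : V.one ≠ 0) (z : S.RegularPoint) :
    IsTame {z.x} (4 * S.n) fun w => V.nreg w z := by
  have hconn := (V.isQuadratic_connField2 hV z).isTame_p_mul
  rw [Set.image_singleton] at hconn
  have hf := isTame_f (S := S) z
  have hnP := ((V.isTame_nP hV).add (IsTame.const (V.nP z))).mono (Set.empty_subset {z.x}) le_rfl
  refine ((((hconn.const_mul z.p).mono le_rfl (by lia)).sub
    (((hf.mul hf).const_mul (c / 32)).mono le_rfl (by lia))).sub
    (((hf.mul hnP).const_mul (1 / 16)).mono le_rfl (by lia))).congr fun w => ?_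
  rw [nreg_eq V hV, atX_connField2]
  ring

end NormalizedFunctions

section OperatorProductExpansion

theorem isBigO_conn2_lift_sub (hV : V.one ≠ 0) (z : S.RegularPoint) :
    (fun t => V.conn2 (z.lift t) z - (c / 2 / (t - z.x) ^ 4 +
      1 / (t - z.x) ^ 2 * (V.conn1 (z.lift t) + V.conn1 z))) =O[𝓝[≠] z.x] fun _ => (1 : ℂ) := by
  have hope := V.isBigO_ope (z₀ := z) (z := ![])
    (Function.injective_of_subsingleton (α := Fin 1) _)
  have hconn1 := isBigO_one_nhdsNE_of_continuousAt (V.analyticAt_conn1_lift hV z).continuousAt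
  refine ((hope.const_mul_left V.one⁻¹).sub
    (hconn1.const_mul_left (V.conn1 z))).congr_left fun t => ?_
  change V.one⁻¹ * (V.npoint ![z.lift t, z] - (_ * V.one + _ * (V.npoint ![z.lift t] +
    V.npoint ![z]))) - _ = _
  rw [conn2, conn1, conn1]
  field_simp
  ring

theorem isBigO_connField3_lift_sub (hV : V.one ≠ 0) {z w : S.RegularPoint} (h : z ≠ w) :
    (fun t => atX (V.connField3 z w) (z.lift t) -
      1 / (t - z.x) ^ 2 * (V.conn2 (z.lift t) w + V.conn2 z w)) =O[𝓝[≠] z.x] fun _ => (1 : ℂ) := by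
  have hope := V.isBigO_ope (z₀ := z) (z := ![w]) (by
    rw [Fin.cons_injective_iff]
    exact ⟨by simpa using h, Function.injective_of_subsingleton _⟩)
  have hconn1 := isBigO_one_nhdsNE_of_continuousAt (V.analyticAt_conn1_lift hV z).continuousAt
  have hconn2 := isBigO_one_nhdsNE_of_continuousAt (V.analyticAt_conn2_lift hV h).continuousAt
  refine (((hope.const_mul_left V.one⁻¹).sub
    ((V.isBigO_conn2_lift_sub hV z).const_mul_left (V.conn1 w))).sub
    ((hconn1.const_mul_left (V.conn2 z w + V.conn1 z * V.conn1 w)).add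
      (hconn2.const_mul_left (V.conn1 z)))).congr_left fun t => ?_
  change V.one⁻¹ * (V.npoint ![z.lift t, z, w] - (_ * V.npoint ![w] + _ *
    (V.npoint ![z.lift t, w] + V.npoint ![z, w]))) - _ - _ = _
  rw [atX_connField3, conn2, conn2, conn2, conn1, conn1, conn1]
  ring

theorem isBigO_nreg_lift (hV : V.one ≠ 0) (z : S.RegularPoint) :
    (fun t => V.nreg (z.lift t) z) =O[𝓝[≠] z.x] fun _ => (1 : ℂ) := by
  obtain ⟨u, hu, hY, hY'⟩ := z.exists_branch_expansion
  obtain ⟨κ, hκ, hκ_eq⟩ := exists_eq_add_mul_of_analyticAt (V.analyticAt_conn1_lift hV z)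
  set β := deriv z.branch z.x
  have hbranch := z.analyticAt_branch.continuousAt
  have hconn1 := (V.analyticAt_conn1_lift hV z).continuousAt
  have hremainder : ContinuousAt (fun t =>
      (-(β + (t - z.x) * u t) ^ 2 / 4 * (z.branch t ^ 2 * V.conn1 (z.lift t) +
          z.y ^ 2 * V.conn1 z) -
        z.branch t * z.y * (β + (t - z.x) * u t) *
          ((β + (t - z.x) * u t) * V.conn1 (z.lift t) + z.y * κ t)) +
      c / 32 * ((z.branch t + z.y) ^ 2 * (2 * u t ^ 2 + 2 * (β + 2 * (t - z.x) * u t) * deriv u t +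
        (t - z.x) ^ 2 * deriv u t ^ 2) + (β + (t - z.x) * u t) ^ 4)) z.x := by
    have := hu.continuousAt
    have := hu.deriv.continuousAt
    have := hκ.continuousAt
    fun_prop
  have hprefactor : ContinuousAt (fun t => z.branch t ^ 2 * z.y ^ 2) z.x := by fun_prop
  refine ((isBigO_one_mul (isBigO_one_nhdsNE_of_continuousAt hprefactor)
    (V.isBigO_conn2_lift_sub hV z)).add
    (isBigO_one_nhdsNE_of_continuousAt hremainder)).congr' ?_ EventuallyEq.rfl
  filter_upwards [nhdsWithin_le_nhds z.eventually_eval_ne_zero, self_mem_nhdsWithin,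
    nhdsWithin_le_nhds hY', nhdsWithin_le_nhds z.analyticAt_branch.eventually_analyticAt]
    with t hp ht hY't hanalytic
  have hδ : t - z.x ≠ 0 := sub_ne_zero.2 ht
  have hschwarz := lift_p'_sq_div_lift_p z.p_ne_zero z.analyticAt_branch.differentiableAt
  have hκt := hκ_eq t
  rw [lift_self] at hschwarz hκt
  rw [← double_pole_cancel hδ (hY t) hκt, ← fourth_order_pole_cancel hδ rfl (hY t) hY't,
    nreg_eq V hV, nP_eq V hV, nP_eq V hV, lift_p'_sq_div_lift_p hp hanalytic.differentiableAt,
    hschwarz, lift_p hp, z.p_eq, f, lift_y hp, lift_x hp]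
  ring

theorem isBigO_f_conj_lift (z : S.RegularPoint) :
    (fun t => f (z.conj.lift t) z) =O[𝓝[≠] z.x] fun _ => (1 : ℂ) := by
  obtain ⟨v, hv, hbranch⟩ := exists_eq_add_mul_of_analyticAt z.conj.analyticAt_branch
  refine (isBigO_one_nhdsNE_of_continuousAt (hv.continuousAt.pow 2)).congr' ?_ EventuallyEq.rfl
  filter_upwards [nhdsWithin_le_nhds z.eventually_eval_ne_zero, self_mem_nhdsWithin] with t hp ht
  have hδ : t - z.x ≠ 0 := sub_ne_zero.2 ht
  rw [f, lift_y hp, lift_x hp, hbranch t, branch_self, conj_y, conj_x, neg_add_eq_sub,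
    sub_add_cancel, mul_div_cancel_left₀ _ hδ]
  rfl

theorem isBigO_nreg_conj_lift (hV : V.one ≠ 0) (z : S.RegularPoint) :
    (fun t => V.nreg (z.conj.lift t) z) =O[𝓝[≠] z.x] fun _ => (1 : ℂ) := by
  have hf := isBigO_f_conj_lift z
  have hp := isTame_p.isBigO_lift (Set.notMem_empty z.conj.x)
  have hconn2 := isBigO_one_nhdsNE_of_continuousAt
    (V.analyticAt_conn2_lift hV z.conj_ne).continuousAt
  have hnP := (V.isTame_nP hV).isBigO_lift (Set.notMem_empty z.conj.x)
  refine ((((isBigO_one_mul hp hconn2).const_mul_left z.p).sub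
    ((isBigO_one_mul hf hf).const_mul_left (c / 32))).sub
    ((isBigO_one_mul hf (hnP.add (isBigO_const_one ℂ (V.nP z) _))).const_mul_left
      (1 / 16))).congr_left fun t => ?_
  rw [nreg_eq V hV]
  ring

theorem isBigO_nreg_near (hV : V.one ≠ 0) (z : S.RegularPoint) :
    (fun w => V.nreg w z) =O[near z.x] fun _ => (1 : ℂ) :=
  isBigO_near_of_lift z (V.isBigO_nreg_lift hV z) (V.isBigO_nreg_conj_lift hV z)

end OperatorProductExpansion

end VirasoroState

/-! ### The difference of the three-point function and `R⁽⁰⁾` -/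

namespace HyperellipticSurface

variable {S : HyperellipticSurface}

theorem natDegree_p_of_odd (hn : Odd S.n) : S.p.natDegree = 2 * S.g + 1 := by
  rw [n] at hn
  rcases S.natDegree_p with h | h <;> grind

theorem three_le_n : 3 ≤ S.n := by
  have hg := S.one_le_g
  rw [n]
  rcases S.natDegree_p with h | h <;> lia

theorem IsTame.exists_polynomials {B : Finset ℂ} {D : ℕ} {F : S.RegularPoint → ℂ}
    (hF : IsTame B D F) (hB : ∀ a ∈ B, F =O[near a] fun _ => (1 : ℂ)) :
    ∃ G H : ℂ[X], G.natDegree ≤ D ∧ H.natDegree ≤ D ∧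
      ∀ w : S.RegularPoint, w.x ∉ B → F w = G.eval w.x + w.y * H.eval w.x :=
  RegularPoint.exists_polynomials B hF.analyticAt
    (fun a ha => ha.elim (hB a) (hF.near_branch a)) hF.atInfinity

end HyperellipticSurface

namespace VirasoroState

variable {S : HyperellipticSurface} {c : ℂ} (V : VirasoroState S c)

/-- The function `R⁽⁰⁾` of three points, written with the normalized functions `nP` and `nreg`. -/
def nR (z₁ z₂ z₃ : S.RegularPoint) : ℂ :=
  c / 64 * f z₁ z₂ * f z₁ z₃ * f z₂ z₃ +
  1 / 64 * f z₁ z₂ * f z₁ z₃ * (V.nP z₂ + V.nP z₃) +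
  1 / 64 * f z₁ z₂ * f z₂ z₃ * (V.nP z₁ + V.nP z₃) +
  1 / 64 * f z₁ z₃ * f z₂ z₃ * (V.nP z₁ + V.nP z₂) +
  1 / 4 * f z₁ z₂ * (V.nreg z₁ z₃ + V.nreg z₂ z₃) +
  1 / 4 * f z₁ z₃ * (V.nreg z₁ z₂ + V.nreg z₂ z₃) +
  1 / 4 * f z₂ z₃ * (V.nreg z₁ z₂ + V.nreg z₁ z₃)

theorem R0_eq (z : Fin 3 → S.RegularPoint) : V.R0 z = V.nR (z 0) (z 1) (z 2) := by
  simp only [R0, nR, nP, nreg]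
  ring

/-- The difference of `⟨T(x₁) T(x₂) T(x₃)⟩_c p₁ p₂ p₃` and `R⁽⁰⁾`, with the connected three-point
function replaced by `connField3`, which is quadratic in its first argument also at `z₃`. -/
def diffField (w z₂ z₃ : S.RegularPoint) : ℂ :=
  atX (V.connField3 z₂ z₃) w * (w.p * z₂.p * z₃.p) - V.nR w z₂ z₃

section Symmetry

variable {z₁ z₂ z₃ : S.RegularPoint}

theorem nR_comm_left (hV : V.one ≠ 0) (h12 : z₁ ≠ z₂) : V.nR z₁ z₂ z₃ = V.nR z₂ z₁ z₃ := by
  rw [nR, nR, f_comm z₂ z₁, V.nreg_comm hV h12]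
  ring

theorem nR_comm_right (hV : V.one ≠ 0) (h23 : z₂ ≠ z₃) : V.nR z₁ z₂ z₃ = V.nR z₁ z₃ z₂ := by
  rw [nR, nR, f_comm z₃ z₂, V.nreg_comm hV h23]
  ring

theorem diffField_comm_right (hV : V.one ≠ 0) (h12 : z₁ ≠ z₂) (h13 : z₁ ≠ z₃) (h23 : z₂ ≠ z₃) :
    V.diffField z₁ z₂ z₃ = V.diffField z₁ z₃ z₂ := by
  rw [diffField, diffField, ← V.conn3_eq_atX h13, ← V.conn3_eq_atX h12,
    V.conn3_comm_right h12 h13 h23, V.nR_comm_right hV h23]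
  ring

end Symmetry

section Bounds

variable {z₂ z₃ : S.RegularPoint}

theorem isTame_nR (hV : V.one ≠ 0) :
    IsTame {z₂.x, z₃.x} (6 * S.n) fun w => V.nR w z₂ z₃ := by
  have hf₂ := (isTame_f z₂).mono (B' := {z₂.x, z₃.x}) (by simp) le_rfl
  have hf₃ := (isTame_f z₃).mono (B' := {z₂.x, z₃.x}) (by simp) le_rfl
  have hr₂ := (V.isTame_nreg hV z₂).mono (B' := {z₂.x, z₃.x}) (by simp) le_rfl
  have hr₃ := (V.isTame_nreg hV z₃).mono (B' := {z₂.x, z₃.x}) (by simp) le_rfl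
  have hP := (V.isTame_nP hV).mono (B' := {z₂.x, z₃.x}) (by simp) le_rfl
  have hff := ((hf₂.mul hf₃).const_mul (c / 64 * f z₂ z₃ + 1 / 64 * (V.nP z₂ + V.nP z₃)))
  have hfP := ((hf₂.mul (hP.add (.const (V.nP z₃)))).add
    (hf₃.mul (hP.add (.const (V.nP z₂))))).const_mul (1 / 64 * f z₂ z₃)
  have hfr := ((hf₂.mul (hr₃.add (.const (V.nreg z₂ z₃)))).add
    (hf₃.mul (hr₂.add (.const (V.nreg z₂ z₃))))).const_mul (1 / 4)
  have hr := (hr₂.add hr₃).const_mul (1 / 4 * f z₂ z₃)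
  refine ((((hff.add hfP).mono le_rfl (by lia)).add (hfr.mono le_rfl (by lia))).add
    (hr.mono le_rfl (by lia))).congr fun w => ?_
  rw [nR]
  ring

theorem isTame_diffField (hV : V.one ≠ 0) (h : z₂.x ≠ z₃.x) :
    IsTame {z₂.x, z₃.x} (6 * S.n) fun w => V.diffField w z₂ z₃ := by
  have hfield := (V.isQuadratic_connField3 hV (ne_of_apply_ne x h)).isTame_p_mul
  rw [Set.image_pair] at hfield
  refine (((hfield.const_mul (z₂.p * z₃.p)).mono le_rfl (by lia)).sub
    (V.isTame_nR hV)).congr fun w => ?_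
  rw [diffField]
  ring

theorem isBigO_nR_conj_lift (hV : V.one ≠ 0) (h : z₂.x ≠ z₃.x) :
    (fun t => V.nR (z₂.conj.lift t) z₂ z₃) =O[𝓝[≠] z₂.x] fun _ => (1 : ℂ) := by
  have hx : z₂.conj.x ∉ ({z₃.x} : Set ℂ) := h
  have hf₂ := isBigO_f_conj_lift z₂
  have hf₃ := (isTame_f z₃).isBigO_lift hx
  have hr₂ := V.isBigO_nreg_conj_lift hV z₂
  have hr₃ := (V.isTame_nreg hV z₃).isBigO_lift hx
  have hP := (V.isTame_nP hV).isBigO_lift (Set.notMem_empty z₂.conj.x)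
  have hconst (k : ℂ) : (fun _ : ℂ => k) =O[𝓝[≠] z₂.x] fun _ => (1 : ℂ) := isBigO_const_one ℂ k _
  have hff := (isBigO_one_mul hf₂ hf₃).const_mul_left
    (c / 64 * f z₂ z₃ + 1 / 64 * (V.nP z₂ + V.nP z₃))
  have hfP := ((isBigO_one_mul hf₂ (hP.add (hconst (V.nP z₃)))).add
    (isBigO_one_mul hf₃ (hP.add (hconst (V.nP z₂))))).const_mul_left (1 / 64 * f z₂ z₃)
  have hfr := ((isBigO_one_mul hf₂ (hr₃.add (hconst (V.nreg z₂ z₃)))).add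
    (isBigO_one_mul hf₃ (hr₂.add (hconst (V.nreg z₂ z₃))))).const_mul_left (1 / 4)
  have hr := (hr₂.add hr₃).const_mul_left (1 / 4 * f z₂ z₃)
  refine (((hff.add hfP).add hfr).add hr).congr_left fun t => ?_
  rw [nR]
  ring

theorem isBigO_diffField_conj_lift (hV : V.one ≠ 0) (h : z₂.x ≠ z₃.x) :
    (fun t => V.diffField (z₂.conj.lift t) z₂ z₃) =O[𝓝[≠] z₂.x] fun _ => (1 : ℂ) := by
  have hmem : z₂.conj ∉ ({z₂, z₃} : Set S.RegularPoint) := by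
    rintro (hz₂ | hz₃)
    · exact z₂.conj_ne hz₂
    · exact h (congrArg x (show z₂.conj = z₃ from hz₃) : z₂.conj.x = z₃.x)
  have hfield := isBigO_one_nhdsNE_of_continuousAt ((V.isQuadratic_connField3 hV
    (ne_of_apply_ne x h)).analyticAt_atX_lift hmem).continuousAt
  have hp := isTame_p.isBigO_lift (Set.notMem_empty z₂.conj.x)
  have hnR := V.isBigO_nR_conj_lift hV h
  refine (((isBigO_one_mul hfield hp).const_mul_left (z₂.p * z₃.p)).sub hnR).congr_left fun t => ?_
  rw [diffField]
  ring

theorem nR_eq (hV : V.one ≠ 0) (z₁ z₂ z₃ : S.RegularPoint) :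
    V.nR z₁ z₂ z₃ =
      f z₁ z₂ / 4 * (z₃.p * (z₁.p * V.conn2 z₁ z₃ + z₂.p * V.conn2 z₂ z₃)) +
      f z₁ z₂ * (-c / 128 * (f z₁ z₃ - f z₂ z₃) ^ 2 -
        1 / 64 * ((f z₁ z₃ - f z₂ z₃) * (V.nP z₁ - V.nP z₂))) +
      1 / 4 * ((f z₁ z₃ + f z₂ z₃) * V.nreg z₁ z₂) +
      1 / 4 * (f z₁ z₃ * V.nreg z₂ z₃ + f z₂ z₃ * V.nreg z₁ z₃) +
      1 / 64 * f z₂ z₃ * (f z₁ z₃ * (V.nP z₁ + V.nP z₂)) := by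
  rw [nR]
  linear_combination 1 / 4 * f z₁ z₂ * V.nreg_eq hV z₁ z₃ + 1 / 4 * f z₁ z₂ * V.nreg_eq hV z₂ z₃

theorem isBigO_connField3_lift_pole (hV : V.one ≠ 0) {z w : S.RegularPoint} (h : z ≠ w) :
    (fun t => atX (V.connField3 z w) (z.lift t) * ((z.lift t).p * z.p) -
      f (z.lift t) z / 4 * ((z.lift t).p * V.conn2 (z.lift t) w + z.p * V.conn2 z w))
      =O[𝓝[≠] z.x] fun _ => (1 : ℂ) := by
  obtain ⟨v, hv, hv_eq⟩ := exists_eq_add_mul_of_analyticAt z.analyticAt_branch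
  obtain ⟨κ, hκ, hκ_eq⟩ := exists_eq_add_mul_of_analyticAt (V.analyticAt_conn2_lift hV h)
  have hbranch := z.analyticAt_branch.continuousAt
  have hremainder : ContinuousAt (fun t =>
      -v t ^ 2 / 4 * (z.branch t ^ 2 * V.conn2 (z.lift t) w + z.y ^ 2 * V.conn2 z w) -
        z.branch t * z.y * v t * (v t * V.conn2 (z.lift t) w + z.y * κ t)) z.x := by
    have := (V.analyticAt_conn2_lift hV h).continuousAt
    have := hv.continuousAt
    have := hκ.continuousAt
    fun_prop
  have hprefactor : ContinuousAt (fun t => z.branch t ^ 2 * z.y ^ 2) z.x := by fun_prop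
  refine ((isBigO_one_mul (isBigO_one_nhdsNE_of_continuousAt hprefactor)
    (V.isBigO_connField3_lift_sub hV h)).add
    (isBigO_one_nhdsNE_of_continuousAt hremainder)).congr' ?_ EventuallyEq.rfl
  filter_upwards [nhdsWithin_le_nhds z.eventually_eval_ne_zero, self_mem_nhdsWithin] with t hp ht
  have hvt := hv_eq t
  have hκt := hκ_eq t
  rw [branch_self] at hvt
  rw [lift_self] at hκt
  rw [← double_pole_cancel (sub_ne_zero.2 ht) hvt hκt, f, lift_y hp, lift_x hp, lift_p hp, z.p_eq]
  ring

/-- Both `f z w` and `P` are differentiable at `z`, which cancels the double pole of `f`. -/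
theorem isBigO_f_mul_lift (hV : V.one ≠ 0) {z w : S.RegularPoint} (h : z.x ≠ w.x) :
    (fun t => f (z.lift t) z * (-c / 128 * (f (z.lift t) w - f z w) ^ 2 -
      1 / 64 * ((f (z.lift t) w - f z w) * (V.nP (z.lift t) - V.nP z))))
      =O[𝓝[≠] z.x] fun _ => (1 : ℂ) := by
  obtain ⟨π, hπ, hπ_eq⟩ := exists_eq_add_mul_of_analyticAt
    ((V.isTame_nP hV).analyticAt z (Set.notMem_empty _))
  obtain ⟨φ, hφ, hφ_eq⟩ := exists_eq_add_mul_of_analyticAt ((isTame_f w).analyticAt z h)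
  have hquotient : ContinuousAt (fun t =>
      (z.branch t + z.y) ^ 2 * (-c / 128 * φ t ^ 2 - 1 / 64 * (φ t * π t))) z.x := by
    have := z.analyticAt_branch.continuousAt
    have := hφ.continuousAt
    have := hπ.continuousAt
    fun_prop
  refine (isBigO_one_nhdsNE_of_continuousAt hquotient).congr' ?_ EventuallyEq.rfl
  filter_upwards [nhdsWithin_le_nhds z.eventually_eval_ne_zero, self_mem_nhdsWithin] with t hp ht
  have hδ : t - z.x ≠ 0 := sub_ne_zero.2 ht
  have hπt := hπ_eq t
  have hφt := hφ_eq t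
  rw [lift_self] at hπt hφt
  rw [hπt, hφt, f, lift_y hp, lift_x hp]
  field_simp
  ring

theorem isBigO_diffField_lift (hV : V.one ≠ 0) {z w : S.RegularPoint} (h : z.x ≠ w.x) :
    (fun t => V.diffField (z.lift t) z w) =O[𝓝[≠] z.x] fun _ => (1 : ℂ) := by
  have hf := (isTame_f w).isBigO_lift h
  have hr := (V.isTame_nreg hV w).isBigO_lift h
  have hP := (V.isTame_nP hV).isBigO_lift (Set.notMem_empty z.x)
  have hfr := (isBigO_one_mul (hf.add (isBigO_const_one ℂ (f z w) _))
    (V.isBigO_nreg_lift hV z)).const_mul_left (1 / 4)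
  have hfr' := ((hf.const_mul_left (V.nreg z w)).add (hr.const_mul_left (f z w))).const_mul_left
    (1 / 4)
  have hfP := (isBigO_one_mul hf (hP.add (isBigO_const_one ℂ (V.nP z) _))).const_mul_left
    (1 / 64 * f z w)
  have hpole := (V.isBigO_connField3_lift_pole hV (ne_of_apply_ne x h)).const_mul_left w.p
  refine ((((hpole.sub (V.isBigO_f_mul_lift hV h)).sub hfr).sub hfr').sub hfP).congr_left
    fun t => ?_
  rw [diffField, nR_eq V hV]
  ring

theorem isBigO_diffField_near (hV : V.one ≠ 0) (h : z₂.x ≠ z₃.x) :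
    (fun w => V.diffField w z₂ z₃) =O[near z₂.x] fun _ => (1 : ℂ) :=
  isBigO_near_of_lift z₂ (V.isBigO_diffField_lift hV h) (V.isBigO_diffField_conj_lift hV h)

theorem isBigO_diffField_near' (hV : V.one ≠ 0) (h : z₂.x ≠ z₃.x) :
    (fun w => V.diffField w z₂ z₃) =O[near z₃.x] fun _ => (1 : ℂ) := by
  refine (V.isBigO_diffField_near hV h.symm).congr' ?_ EventuallyEq.rfl
  filter_upwards [near_le_cofinite z₃.x (eventually_cofinite_ne z₂),
    near_le_cofinite z₃.x (eventually_cofinite_ne z₃)] with w hz₂ hz₃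
  exact V.diffField_comm_right hV hz₃ hz₂ (ne_of_apply_ne x h.symm)

end Bounds

theorem exists_polynomials_diffField (hV : V.one ≠ 0) {z₂ z₃ : S.RegularPoint} (h : z₂.x ≠ z₃.x) :
    ∃ F G : ℂ[X], F.natDegree ≤ 6 * S.n ∧ G.natDegree ≤ 6 * S.n ∧
      ∀ w : S.RegularPoint, w.x ∉ ({z₂.x, z₃.x} : Finset ℂ) →
        V.diffField w z₂ z₃ = F.eval w.x + w.y * G.eval w.x := by
  refine IsTame.exists_polynomials (B := {z₂.x, z₃.x})
    (by simpa using V.isTame_diffField hV h) ?_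
  intro a ha
  rcases Finset.mem_insert.1 ha with rfl | ha
  · exact V.isBigO_diffField_near hV h
  · exact Finset.mem_singleton.1 ha ▸ V.isBigO_diffField_near' hV h

theorem exists_polynomials_nreg (hV : V.one ≠ 0) (z : S.RegularPoint) :
    ∃ F G : ℂ[X], F.natDegree ≤ 4 * S.n ∧ G.natDegree ≤ 4 * S.n ∧
      ∀ w : S.RegularPoint, w.x ∉ ({z.x} : Finset ℂ) →
        V.nreg w z = F.eval w.x + w.y * G.eval w.x :=
  IsTame.exists_polynomials (B := {z.x}) (by simpa using V.isTame_nreg hV z)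
    fun _ ha => Finset.mem_singleton.1 ha ▸ V.isBigO_nreg_near hV z

theorem exists_polynomials_nP (hV : V.one ≠ 0) :
    ∃ F G : ℂ[X], F.natDegree ≤ 2 * S.n ∧ G.natDegree ≤ 2 * S.n ∧
      ∀ w : S.RegularPoint, w.x ∉ (∅ : Finset ℂ) → V.nP w = F.eval w.x + w.y * G.eval w.x :=
  IsTame.exists_polynomials (B := ∅) (by simpa using V.isTame_nP hV) (by simp)

theorem isBigO_G3 (hV : V.one ≠ 0) (hn : Odd S.n) {z₂ z₃ : S.RegularPoint} (h : z₂ ≠ z₃) :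
    (fun z₁ : S.RegularPoint => V.G3 ![z₁, z₂, z₃]) =O[atInfinity]
      fun z₁ => z₁.x ^ (S.n - 3) := by
  have hfield := (V.isQuadratic_connField3 hV h).isBigO_atInfinity_sub_of_odd
    (natDegree_p_of_odd hn)
  simp only [zero_mul, sub_zero] at hfield
  refine ((isTame_p.atInfinity.mul hfield).const_mul_left (z₂.p * z₃.p)).congr' ?_ ?_
  · filter_upwards [atInfinity_le_cofinite (eventually_cofinite_ne z₃)] with w hw
    change _ = V.conn3 w z₂ z₃ * (w.p * z₂.p * z₃.p)
    rw [V.conn3_eq_atX hw]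
    ring
  · filter_upwards [eventually_x_ne_zero] with w hw
    rw [inv_pow, ← div_eq_mul_inv, pow_sub₀ _ hw three_le_n, div_eq_mul_inv]

end VirasoroState

/-! ### Separately polynomial functions -/

namespace HyperellipticSurface

variable {S : HyperellipticSurface} {N D : ℕ}

/-- The exponents of the monomials in the coordinates of `N` points: `(s, m)` stands for
`∏ i ∈ s, y_i * ∏ i, x_i ^ m i`. No higher power of `y_i` is needed, as `y_i ^ 2 = p(x_i)`. -/
abbrev Exponent (N : ℕ) := Finset (Fin N) × (Fin N →₀ ℕ)

/-- The monomial with exponent `j`, as a function of `N` points. -/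
def mono (j : Exponent N) (z : Fin N → S.RegularPoint) : ℂ :=
  (∏ i ∈ j.1, (z i).y) * ∏ i, (z i).x ^ j.2 i

/-- The function of `N` points that is the linear combination of monomials with the given
coefficients. -/
def monoSum : (Exponent N →₀ ℂ) →ₗ[ℂ] (Fin N → S.RegularPoint) → ℂ :=
  Finsupp.linearCombination ℂ mono

theorem monoSum_apply (a : Exponent N →₀ ℂ) (z : Fin N → S.RegularPoint) :
    monoSum a z = a.sum fun j k => k * mono j z := by
  simp [monoSum, Finsupp.linearCombination_apply, Finsupp.sum, Finset.sum_apply]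

theorem monoSum_single (j : Exponent N) (k : ℂ) (z : Fin N → S.RegularPoint) :
    monoSum (Finsupp.single j k) z = k * mono j z := by
  simp [monoSum]

theorem injective_x_cons {w : S.RegularPoint} {z : Fin N → S.RegularPoint} :
    (Function.Injective fun i => ((Fin.cons w z : Fin (N + 1) → S.RegularPoint) i).x) ↔
      (∀ i, (z i).x ≠ w.x) ∧ Function.Injective fun i => (z i).x := by
  have hcons : (fun i => ((Fin.cons w z : Fin (N + 1) → S.RegularPoint) i).x) =
      Fin.cons w.x fun i => (z i).x :=
    Fin.comp_cons x w z
  rw [hcons, Fin.cons_injective_iff]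
  simp

section PolynomialFunctions

/-- A function of `N` points that is a polynomial in their coordinates as long as the
`x`-coordinates are distinct. -/
def IsPolyFun (Q : (Fin N → S.RegularPoint) → ℂ) : Prop :=
  ∃ a, ∀ z : Fin N → S.RegularPoint, (Function.Injective fun i => (z i).x) → Q z = monoSum a z

namespace IsPolyFun

variable {Q R : (Fin N → S.RegularPoint) → ℂ}

theorem congr (hQ : IsPolyFun Q)
    (h : ∀ z : Fin N → S.RegularPoint, (Function.Injective fun i => (z i).x) → R z = Q z) :
    IsPolyFun R := by
  obtain ⟨a, ha⟩ := hQ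
  exact ⟨a, fun z hz => (h z hz).trans (ha z hz)⟩

theorem add (hQ : IsPolyFun Q) (hR : IsPolyFun R) : IsPolyFun fun z => Q z + R z := by
  obtain ⟨a, ha⟩ := hQ
  obtain ⟨b, hb⟩ := hR
  refine ⟨a + b, fun z hz => ?_⟩
  simp only [map_add, Pi.add_apply, ha z hz, hb z hz]

theorem sum {ι : Type*} (s : Finset ι) {Q : ι → (Fin N → S.RegularPoint) → ℂ}
    (hQ : ∀ i ∈ s, IsPolyFun (Q i)) : IsPolyFun fun z => ∑ i ∈ s, Q i z := by
  choose! a ha using hQ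
  refine ⟨∑ i ∈ s, a i, fun z hz => ?_⟩
  rw [map_sum, Finset.sum_apply]
  exact Finset.sum_congr rfl fun i hi => ha i hi z hz

theorem of_isEmpty [IsEmpty (Fin N)] : IsPolyFun Q :=
  ⟨Finsupp.single (∅, 0) (Q isEmptyElim), fun z _ => by
    rw [monoSum_single, Subsingleton.elim z isEmptyElim, mono]
    simp⟩

theorem mul_tail {g : S.RegularPoint → ℂ} {φ : Exponent N → Exponent (N + 1)}
    (hQ : IsPolyFun Q)
    (hφ : ∀ j (z : Fin (N + 1) → S.RegularPoint), mono (φ j) z = g (z 0) * mono j (Fin.tail z)) :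
    IsPolyFun fun z : Fin (N + 1) → S.RegularPoint => g (z 0) * Q (Fin.tail z) := by
  obtain ⟨a, ha⟩ := hQ
  refine ⟨a.mapDomain φ, fun z hz => ?_⟩
  beta_reduce
  rw [ha (Fin.tail z) (hz.comp (Fin.succ_injective N)), monoSum_apply, monoSum_apply,
    Finsupp.sum_mapDomain_index (by simp) fun _ _ _ => add_mul .., Finsupp.mul_sum]
  exact Finsupp.sum_congr fun j _ => by rw [hφ, mul_left_comm]

theorem x_pow_mul_tail (hQ : IsPolyFun Q) (m : ℕ) :
    IsPolyFun fun z : Fin (N + 1) → S.RegularPoint => (z 0).x ^ m * Q (Fin.tail z) := by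
  refine hQ.mul_tail (φ := fun j => (j.1.map (Fin.succEmb N), Finsupp.cons m j.2))
    (g := fun w => w.x ^ m) fun j z => ?_
  simp only [mono, Finset.prod_map, Fin.prod_univ_succ, Finsupp.cons_zero, Finsupp.cons_succ,
    Fin.coe_succEmb, Fin.tail]
  ring

theorem y_mul_x_pow_mul_tail (hQ : IsPolyFun Q) (m : ℕ) :
    IsPolyFun fun z : Fin (N + 1) → S.RegularPoint =>
      (z 0).y * (z 0).x ^ m * Q (Fin.tail z) := by
  refine hQ.mul_tail (φ := fun j => (insert 0 (j.1.map (Fin.succEmb N)), Finsupp.cons m j.2))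
    (g := fun w => w.y * w.x ^ m) fun j z => ?_
  have hzero : 0 ∉ j.1.map (Fin.succEmb N) := by simp [Fin.succ_ne_zero]
  simp only [mono, Finset.prod_insert hzero, Finset.prod_map, Fin.prod_univ_succ,
    Finsupp.cons_zero, Finsupp.cons_succ, Fin.coe_succEmb, Fin.tail]
  ring

end IsPolyFun

end PolynomialFunctions

section Generic

/-- The `x`-coordinates of the points are distinct and lie outside of `A`. -/
def IsGenericOff (A : Finset ℂ) (z : Fin N → S.RegularPoint) : Prop :=
  (Function.Injective fun i => (z i).x) ∧ ∀ i, (z i).x ∉ A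

variable {A B : Finset ℂ} {z : Fin N → S.RegularPoint} {w : S.RegularPoint}

theorem isGenericOff_empty : IsGenericOff ∅ z ↔ Function.Injective fun i => (z i).x := by
  simp [IsGenericOff]

theorem isGenericOff_cons :
    IsGenericOff A (Fin.cons w z : Fin (N + 1) → S.RegularPoint) ↔
      w.x ∉ A ∧ IsGenericOff (insert w.x A) z := by
  rw [IsGenericOff, injective_x_cons, Fin.forall_fin_succ, IsGenericOff]
  simp only [Fin.cons_zero, Fin.cons_succ, Finset.mem_insert, not_or, forall_and]
  tauto

theorem IsGenericOff.anti (hz : IsGenericOff B z) (hAB : A ⊆ B) : IsGenericOff A z :=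
  ⟨hz.1, fun i hi => hz.2 i (hAB hi)⟩

theorem IsGenericOff.update {i : Fin N} (hz : IsGenericOff A z) (hw : w.x ∉ A)
    (hinj : Function.Injective fun j => (Function.update z i w j).x) :
    IsGenericOff A (Function.update z i w) :=
  ⟨hinj, (Function.forall_update_iff z fun _ v => v.x ∉ A).2 ⟨hw, fun j _ => hz.2 j⟩⟩

theorem injective_x_update (hz : Function.Injective fun j => (z j).x) (i : Fin N)
    (hw : ∀ j, (z j).x ≠ w.x) : Function.Injective fun j => (Function.update z i w j).x := by
  intro j k hjk
  have hinj := @hz j k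
  have hj := hw j
  have hk := hw k
  grind [Function.update_apply]

end Generic

section SeparatelyPolynomial

/-- A function of `N` points which, when all of them but one are fixed, has the form
`F(x) + y G(x)` in the remaining one, with polynomials `F` and `G` of degree at most `D`. Only
points with distinct `x`-coordinates outside of `A` are considered. -/
def IsSeparatelyPoly (A : Finset ℂ) (D : ℕ) (Q : (Fin N → S.RegularPoint) → ℂ) : Prop :=
  ∀ i z, IsGenericOff A z → ∃ F G : ℂ[X], F.natDegree ≤ D ∧ G.natDegree ≤ D ∧
    ∀ w, IsGenericOff A (Function.update z i w) →
      Q (Function.update z i w) = F.eval w.x + w.y * G.eval w.x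

theorem infinite_x (S : HyperellipticSurface) (A : Finset ℂ) :
    {t | t ∉ A ∧ S.p.eval t ≠ 0}.Infinite :=
  frequently_cofinite_iff_infinite.1
    (A.eventually_cofinite_notMem.and S.eventually_cofinite_eval_ne_zero).frequently

theorem eq_of_eval_add_y_mul_eval_eq (A : Finset ℂ) {F G F' G' : ℂ[X]}
    (h : ∀ w : S.RegularPoint, w.x ∉ A →
      F.eval w.x + w.y * G.eval w.x = F'.eval w.x + w.y * G'.eval w.x) : F = F' ∧ G = G' := by
  have hval (t : ℂ) (ht : t ∉ A ∧ S.p.eval t ≠ 0) :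
      F.eval t = F'.eval t ∧ G.eval t = G'.eval t := by
    obtain ⟨w, rfl⟩ := exists_x_eq ht.2
    have hw := h w ht.1
    have hconj := h w.conj ht.1
    rw [conj_x, conj_y] at hconj
    exact ⟨by linear_combination (hw + hconj) / 2,
      mul_left_cancel₀ w.y_ne_zero (by linear_combination (hw - hconj) / 2)⟩
  exact ⟨Polynomial.eq_of_infinite_eval_eq _ _ ((infinite_x S A).mono fun t ht => (hval t ht).1),
    Polynomial.eq_of_infinite_eval_eq _ _ ((infinite_x S A).mono fun t ht => (hval t ht).2)⟩

namespace IsSeparatelyPoly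

variable {A B : Finset ℂ} {Q R : (Fin N → S.RegularPoint) → ℂ}

theorem mono (hQ : IsSeparatelyPoly A D Q) (hAB : A ⊆ B) : IsSeparatelyPoly B D Q := by
  intro i z hz
  obtain ⟨F, G, hF, hG, hQFG⟩ := hQ i z (hz.anti hAB)
  exact ⟨F, G, hF, hG, fun w hw => hQFG w (hw.anti hAB)⟩

theorem congr (hQ : IsSeparatelyPoly A D Q) (h : ∀ z, IsGenericOff A z → R z = Q z) :
    IsSeparatelyPoly A D R := by
  intro i z hz
  obtain ⟨F, G, hF, hG, hQFG⟩ := hQ i z hz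
  exact ⟨F, G, hF, hG, fun w hw => (h _ hw).trans (hQFG w hw)⟩

theorem const_mul (hQ : IsSeparatelyPoly A D Q) (k : ℂ) :
    IsSeparatelyPoly A D fun z => k * Q z := by
  intro i z hz
  obtain ⟨F, G, hF, hG, hQFG⟩ := hQ i z hz
  refine ⟨Polynomial.C k * F, Polynomial.C k * G, (Polynomial.natDegree_C_mul_le k F).trans hF,
    (Polynomial.natDegree_C_mul_le k G).trans hG, fun w hw => ?_⟩
  simp only [hQFG w hw, Polynomial.eval_C_mul]
  ring

theorem sum {ι : Type*} {s : Finset ι} {Q : ι → (Fin N → S.RegularPoint) → ℂ}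
    (hQ : ∀ k ∈ s, IsSeparatelyPoly A D (Q k)) : IsSeparatelyPoly A D fun z => ∑ k ∈ s, Q k z := by
  intro i z hz
  choose! F G hF hG hQFG using fun k hk => hQ k hk i z hz
  refine ⟨∑ k ∈ s, F k, ∑ k ∈ s, G k, Polynomial.natDegree_sum_le_of_forall_le _ _ hF,
    Polynomial.natDegree_sum_le_of_forall_le _ _ hG, fun w hw => ?_⟩
  rw [Polynomial.eval_finsetSum, Polynomial.eval_finsetSum, Finset.mul_sum,
    ← Finset.sum_add_distrib]
  exact Finset.sum_congr rfl fun k hk => hQFG k hk w hw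

theorem add (hQ : IsSeparatelyPoly A D Q) (hR : IsSeparatelyPoly A D R) :
    IsSeparatelyPoly A D fun z => Q z + R z := by
  have hsum : IsSeparatelyPoly A D fun z => ∑ k : Fin 2, ![Q, R] k z :=
    sum fun k _ => by fin_cases k <;> assumption
  simpa using hsum

theorem cons {Q : (Fin (N + 1) → S.RegularPoint) → ℂ} (hQ : IsSeparatelyPoly A D Q)
    {u : S.RegularPoint} (hu : u.x ∉ A) :
    IsSeparatelyPoly (insert u.x A) D fun z : Fin N → S.RegularPoint => Q (Fin.cons u z) := by
  intro i z hz
  obtain ⟨F, G, hF, hG, hQFG⟩ := hQ i.succ (Fin.cons u z) (isGenericOff_cons.2 ⟨hu, hz⟩)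
  refine ⟨F, G, hF, hG, fun w hw => ?_⟩
  have hcons := isGenericOff_cons.2 ⟨hu, hw⟩
  simp only [Fin.cons_update] at hcons ⊢
  exact hQFG w hcons

theorem galoisEven_cons {Q : (Fin (N + 1) → S.RegularPoint) → ℂ} (hQ : IsSeparatelyPoly A D Q)
    {u : S.RegularPoint} (hu : u.x ∉ A) :
    IsSeparatelyPoly (insert u.x A) D fun z : Fin N → S.RegularPoint =>
      galoisEven (fun w => Q (Fin.cons w z)) u :=
  (((hQ.cons hu).add (hQ.cons (u := u.conj) hu)).const_mul 2⁻¹).congr fun _ _ =>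
    div_eq_inv_mul ..

theorem galoisOdd_cons {Q : (Fin (N + 1) → S.RegularPoint) → ℂ} (hQ : IsSeparatelyPoly A D Q)
    {u : S.RegularPoint} (hu : u.x ∉ A) :
    IsSeparatelyPoly (insert u.x A) D fun z : Fin N → S.RegularPoint =>
      galoisOdd (fun w => Q (Fin.cons w z)) u := by
  refine (((hQ.cons hu).add ((hQ.cons (u := u.conj) hu).const_mul (-1))).const_mul
    (2 * u.y)⁻¹).congr fun z _ => ?_
  rw [galoisOdd]
  ring

/-- The polynomials obtained for two disjoint sets of excluded values coincide, so that neither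
set is excluded. -/
theorem of_disjoint
    (h : ∀ B : Finset ℂ, ∃ A, Disjoint A B ∧ IsSeparatelyPoly A D Q) :
    IsSeparatelyPoly ∅ D Q := by
  intro i z hz
  set C := Finset.univ.image fun j => (z j).x
  have hgeneric {A : Finset ℂ} (hA : Disjoint A C) : IsGenericOff A z :=
    ⟨hz.1, fun j hj => Finset.disjoint_left.1 hA hj (Finset.mem_image_of_mem _ (Finset.mem_univ j))⟩
  obtain ⟨A, hA, hQA⟩ := h C
  obtain ⟨B, hB, hQB⟩ := h (C ∪ A)
  rw [Finset.disjoint_union_right] at hB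
  obtain ⟨F, G, hF, hG, hFG⟩ := hQA i z (hgeneric hA)
  obtain ⟨F', G', -, -, hFG'⟩ := hQB i z (hgeneric hB.1)
  obtain ⟨rfl, rfl⟩ : F = F' ∧ G = G' := by
    refine eq_of_eval_add_y_mul_eval_eq (S := S) (A ∪ B ∪ C) fun w hw => ?_
    simp only [Finset.mem_union, not_or] at hw
    have hinj := injective_x_update hz.1 i fun j hj =>
      hw.2 (Finset.mem_image.2 ⟨j, Finset.mem_univ j, hj⟩)
    rw [← hFG w ((hgeneric hA).update hw.1.1 hinj), ← hFG' w ((hgeneric hB.1).update hw.1.2 hinj)]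
  refine ⟨F, G, hF, hG, fun w hw => ?_⟩
  by_cases hwA : w.x ∈ A
  · exact hFG' w ((hgeneric hB.1).update (Finset.disjoint_right.1 hB.2 hwA) hw.1)
  · exact hFG w ((hgeneric hA).update hwA hw.1)

theorem exists_polynomials_cons {Q : (Fin (N + 1) → S.RegularPoint) → ℂ}
    (hQ : IsSeparatelyPoly ∅ D Q) :
    ∃ F G : (Fin N → S.RegularPoint) → ℂ[X], ∀ z, (Function.Injective fun i => (z i).x) →
      (F z).natDegree ≤ D ∧ (G z).natDegree ≤ D ∧ ∀ w : S.RegularPoint, (∀ i, (z i).x ≠ w.x) →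
        Q (Fin.cons w z) = (F z).eval w.x + w.y * (G z).eval w.x := by
  suffices h : ∀ z : Fin N → S.RegularPoint, (Function.Injective fun i => (z i).x) →
      ∃ F G : ℂ[X], F.natDegree ≤ D ∧ G.natDegree ≤ D ∧ ∀ w : S.RegularPoint,
        (∀ i, (z i).x ≠ w.x) → Q (Fin.cons w z) = F.eval w.x + w.y * G.eval w.x by
    choose! F G hFG using h
    exact ⟨F, G, hFG⟩
  intro z hz
  obtain ⟨t, ht, hp⟩ := (infinite_x S (Finset.univ.image fun i => (z i).x)).nonempty
  obtain ⟨u, rfl⟩ := exists_x_eq hp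
  have hu : ∀ i, (z i).x ≠ u.x := by simpa using ht
  obtain ⟨F, G, hF, hG, hQFG⟩ :=
    hQ 0 (Fin.cons u z) (isGenericOff_empty.2 (injective_x_cons.2 ⟨hu, hz⟩))
  refine ⟨F, G, hF, hG, fun w hw => ?_⟩
  have hupdate := hQFG w
  rw [Fin.update_cons_zero] at hupdate
  exact hupdate (isGenericOff_empty.2 (injective_x_cons.2 ⟨hw, hz⟩))

end IsSeparatelyPoly

theorem coeff_eq_sum_basis {F : ℂ[X]} {s : Finset ℂ} (hF : F.natDegree < s.card) (m : ℕ) :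
    F.coeff m = ∑ t ∈ s, (Lagrange.basis s id t).coeff m * F.eval t := by
  have hdeg : F.degree < s.card :=
    Polynomial.degree_le_natDegree.trans_lt (by exact_mod_cast hF)
  conv_lhs => rw [Lagrange.eq_interpolate (v := id) Function.injective_id.injOn hdeg]
  rw [Lagrange.interpolate_apply, Polynomial.finsetSum_coeff]
  exact Finset.sum_congr rfl fun t _ => by rw [Polynomial.coeff_C_mul, mul_comm, id]

namespace IsSeparatelyPoly

/-- The coefficients are linear combinations of values, by Lagrange interpolation, and the nodes can
be chosen outside of any finite set. -/
theorem coeff {E : (Fin N → S.RegularPoint) → ℂ[X]}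
    (hdeg : ∀ z, (Function.Injective fun i => (z i).x) → (E z).natDegree ≤ D)
    (heval : ∀ u : S.RegularPoint, IsSeparatelyPoly {u.x} D fun z => (E z).eval u.x) (m : ℕ) :
    IsSeparatelyPoly ∅ D fun z => (E z).coeff m := by
  refine of_disjoint fun B => ?_
  obtain ⟨s, hs, hcard⟩ := (infinite_x S B).exists_subset_card_eq (D + 1)
  refine ⟨s, Finset.disjoint_left.2 fun t ht => (hs ht).1, ?_⟩
  refine (sum (s := s) (Q := fun t z => (Lagrange.basis s id t).coeff m * (E z).eval t)
    fun t ht => ?_).congr fun z hz => coeff_eq_sum_basis ?_ m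
  · obtain ⟨u, rfl⟩ := exists_x_eq (hs ht).2
    exact ((heval u).mono (Finset.singleton_subset_iff.2 ht)).const_mul _
  · exact hcard ▸ Nat.lt_succ_of_le (hdeg z hz.1)

theorem isPolyFun {Q : (Fin N → S.RegularPoint) → ℂ} (hQ : IsSeparatelyPoly ∅ D Q) :
    IsPolyFun Q := by
  induction N with
  | zero => exact .of_isEmpty
  | succ N ih =>
    obtain ⟨F, G, hFG⟩ := hQ.exists_polynomials_cons
    have hval (u : S.RegularPoint) (z : Fin N → S.RegularPoint) (hz : IsGenericOff {u.x} z) :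
        (F z).eval u.x = galoisEven (fun w => Q (Fin.cons w z)) u ∧
          (G z).eval u.x = galoisOdd (fun w => Q (Fin.cons w z)) u := by
      have hu (i : Fin N) : (z i).x ≠ u.x := fun hi => hz.2 i (Finset.mem_singleton.2 hi)
      have hy := u.y_ne_zero
      rw [galoisEven, galoisOdd, (hFG z hz.1).2.2 u hu, (hFG z hz.1).2.2 u.conj hu, conj_x, conj_y]
      constructor
      · ring
      · field_simp
        ring
    have hF := coeff (fun z hz => (hFG z hz).1) fun u =>
      (hQ.galoisEven_cons (Finset.notMem_empty u.x)).congr fun z hz => (hval u z hz).1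
    have hG := coeff (fun z hz => (hFG z hz).2.1) fun u =>
      (hQ.galoisOdd_cons (Finset.notMem_empty u.x)).congr fun z hz => (hval u z hz).2
    refine ((IsPolyFun.sum (Finset.range (D + 1)) fun m _ => (ih (hF m)).x_pow_mul_tail m).add
      (IsPolyFun.sum (Finset.range (D + 1)) fun m _ =>
        (ih (hG m)).y_mul_x_pow_mul_tail m)).congr fun z hz => ?_
    rw [← Fin.cons_self_tail z, injective_x_cons] at hz
    obtain ⟨hF, hG, h⟩ := hFG _ hz.2
    conv_lhs => rw [← Fin.cons_self_tail z]
    rw [h _ hz.1, Polynomial.eval_eq_sum_range' (Nat.lt_succ_of_le hF),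
      Polynomial.eval_eq_sum_range' (Nat.lt_succ_of_le hG), Finset.mul_sum]
    congr 1 <;> exact Finset.sum_congr rfl fun m _ => by ring

theorem of_symmetric {Q : (Fin (N + 1) → S.RegularPoint) → ℂ}
    (hsymm : ∀ (σ : Equiv.Perm (Fin (N + 1))) (z : Fin (N + 1) → S.RegularPoint),
      (Function.Injective fun i => (z i).x) → Q (z ∘ σ) = Q z)
    (h : ∀ z : Fin N → S.RegularPoint, (Function.Injective fun i => (z i).x) →
      ∃ F G : ℂ[X], F.natDegree ≤ D ∧ G.natDegree ≤ D ∧ ∀ w : S.RegularPoint,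
        (∀ i, (z i).x ≠ w.x) → Q (Fin.cons w z) = F.eval w.x + w.y * G.eval w.x) :
    IsSeparatelyPoly ∅ D Q := by
  intro i z hz
  set σ := Equiv.swap 0 i
  obtain ⟨F, G, hF, hG, hQFG⟩ := h (Fin.tail (z ∘ σ))
    ((hz.1.comp σ.injective).comp (Fin.succ_injective N))
  refine ⟨F, G, hF, hG, fun w hw => ?_⟩
  have hcons : Function.update z i w ∘ σ = Fin.cons w (Fin.tail (z ∘ σ)) := by
    rw [Function.update_comp_equiv, ← Fin.cons_self_tail (z ∘ σ), Equiv.symm_swap,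
      Equiv.swap_apply_right, Fin.update_cons_zero, Fin.tail_cons]
  have hinj : Function.Injective fun j => ((Function.update z i w ∘ σ) j).x :=
    hw.1.comp σ.injective
  rw [hcons, injective_x_cons] at hinj
  rw [← hsymm σ _ hw.1, hcons]
  exact hQFG w hinj.1

end IsSeparatelyPoly

end SeparatelyPolynomial

end HyperellipticSurface

/-! ### High order parts and projections -/

namespace HyperellipticSurface

variable {S : HyperellipticSurface}

section HighPart

variable {k : ℝ} {M : ℤ} {E E' : S.RegularPoint → ℂ} {h h' d : ℤ →₀ ℂ}

theorem laurentEval_add (h h' : ℤ →₀ ℂ) (x : ℂ) :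
    laurentEval (h + h') x = laurentEval h x + laurentEval h' x :=
  Finsupp.sum_add_index' (by simp) fun _ _ _ => add_mul ..

theorem laurentEval_smul (a : ℂ) (h : ℤ →₀ ℂ) (x : ℂ) :
    laurentEval (a • h) x = a * laurentEval h x := by
  rw [laurentEval, Finsupp.sum_smul_index' fun _ => zero_mul _, laurentEval, Finsupp.mul_sum]
  simp only [smul_eq_mul, mul_assoc]

@[simp]
theorem laurentEval_zero (x : ℂ) : laurentEval 0 x = 0 :=
  Finsupp.sum_zero_index

theorem laurentEval_single (m : ℤ) (a x : ℂ) : laurentEval (.single m a) x = a * x ^ m :=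
  Finsupp.sum_single_index (zero_mul _)

theorem tendsto_norm_x_atInfinity :
    Tendsto (fun w : S.RegularPoint => ‖w.x‖) atInfinity atTop :=
  tendsto_norm_cobounded_atTop.comp tendsto_x_atInfinity

theorem tendsto_x_zpow_atInfinity {m : ℤ} (hm : m ≤ 0) :
    Tendsto (fun w : S.RegularPoint => w.x ^ m) atInfinity (𝓝 (if m = 0 then 1 else 0)) := by
  obtain ⟨l, rfl⟩ := Int.exists_eq_neg_ofNat hm
  have hpow := (tendsto_inv_x_atInfinity (S := S)).pow l
  simpa [zero_pow_eq] using hpow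

theorem tendsto_laurentEval_mul_zpow (hd : ∀ m ∈ d.support, m ≤ M) :
    Tendsto (fun w : S.RegularPoint => laurentEval d w.x * w.x ^ (-M)) atInfinity (𝓝 (d M)) := by
  have hterms : Tendsto (fun w : S.RegularPoint => ∑ m ∈ d.support, d m * w.x ^ (m - M))
      atInfinity (𝓝 (∑ m ∈ d.support, d m * if m - M = 0 then 1 else 0)) :=
    tendsto_finsetSum _ fun m hm =>
      (tendsto_x_zpow_atInfinity (sub_nonpos.2 (hd m hm))).const_mul _
  have hlimit : ∑ m ∈ d.support, d m * (if m - M = 0 then 1 else 0) = d M := by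
    simp [sub_eq_zero, eq_comm]
  rw [hlimit] at hterms
  refine hterms.congr' ?_
  filter_upwards [eventually_x_ne_zero] with w hw
  simp only [laurentEval, Finsupp.sum, Finset.sum_mul, mul_assoc, ← zpow_add₀ hw, sub_eq_add_neg]

theorem eq_zero_of_laurentEval_isBigO (hd : ∀ m ∈ d.support, k < (m : ℝ))
    (hO : (fun w : S.RegularPoint => laurentEval d w.x) =O[atInfinity] fun w => ‖w.x‖ ^ k) :
    d = 0 := by
  by_contra hne
  obtain ⟨M, hM, hmax⟩ := d.support.exists_max_image id (Finsupp.support_nonempty_iff.2 hne)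
  have hzero : Tendsto (fun w : S.RegularPoint => laurentEval d w.x * w.x ^ (-M)) atInfinity
      (𝓝 0) := by
    have hdecay := (tendsto_rpow_neg_atTop (sub_pos.2 (hd M hM))).comp
      (tendsto_norm_x_atInfinity (S := S))
    refine ((hO.mul (isBigO_refl (fun w : S.RegularPoint => w.x ^ (-M)) _).norm_right).congr'
      EventuallyEq.rfl ?_).trans_tendsto hdecay
    filter_upwards [eventually_x_ne_zero] with w hw
    rw [Function.comp_apply, neg_sub, Real.rpow_sub (norm_pos_iff.2 hw), norm_zpow, zpow_neg,
      Real.rpow_intCast, div_eq_mul_inv]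
  exact Finsupp.mem_support_iff.1 hM
    (tendsto_nhds_unique (tendsto_laurentEval_mul_zpow hmax) hzero)

namespace IsHighPart

theorem add (hE : IsHighPart k E h) (hE' : IsHighPart k E' h') :
    IsHighPart k (fun w => E w + E' w) (h + h') := by
  classical
  refine ⟨fun m hm => ?_, (hE.2.add hE'.2).congr_left fun w => ?_⟩
  · exact (Finset.mem_union.1 (Finsupp.support_add hm)).elim (hE.1 m) (hE'.1 m)
  · rw [laurentEval_add]
    ring

theorem const_mul (a : ℂ) (hE : IsHighPart k E h) :
    IsHighPart k (fun w => a * E w) (a • h) := by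
  refine ⟨fun m hm => hE.1 m (Finsupp.support_smul hm),
    (hE.2.const_mul_left a).congr_left fun w => ?_⟩
  rw [laurentEval_smul]
  ring

theorem congr (hE : IsHighPart k E h) (hEE' : E' =ᶠ[atInfinity] E) : IsHighPart k E' h :=
  ⟨hE.1, hE.2.congr' (hEE'.symm.sub EventuallyEq.rfl) EventuallyEq.rfl⟩

theorem unique (hE : IsHighPart k E h) (hE' : IsHighPart k E h') : h = h' := by
  have hdiff := hE.add (hE'.const_mul (-1))
  have hzero : h + (-1 : ℂ) • h' = 0 :=
    eq_zero_of_laurentEval_isBigO hdiff.1 (hdiff.2.neg_left.congr_left fun w => by ring)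
  rwa [neg_one_smul, ← sub_eq_add_neg, sub_eq_zero] at hzero

theorem highPart_eq (hE : IsHighPart k E h) : highPart k E = h := by
  have hex : ∃ h, IsHighPart k E h := ⟨h, hE⟩
  rw [highPart, dif_pos hex]
  exact hex.choose_spec.unique hE

theorem of_isBigO (hE : E =O[atInfinity] fun w => ‖w.x‖ ^ k) : IsHighPart k E 0 :=
  ⟨by simp, by simpa using hE⟩

theorem zero : IsHighPart k (0 : S.RegularPoint → ℂ) 0 :=
  of_isBigO (isBigO_zero _ _)

theorem monomial (a : ℂ) (m : ℕ) : IsHighPart k (fun w : S.RegularPoint => a * w.x ^ m)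
    (if k < m then Finsupp.single (m : ℤ) a else 0) := by
  split_ifs with hk
  · refine ⟨fun l hl => ?_, ?_⟩
    · rw [Finset.mem_singleton.1 (Finsupp.support_single_subset hl)]
      exact_mod_cast hk
    · simp [laurentEval_single, isBigO_zero]
  · refine of_isBigO (IsBigO.const_mul_left (IsBigO.of_bound 1 ?_) a)
    filter_upwards [tendsto_norm_x_atInfinity.eventually_ge_atTop 1] with w hw
    rw [norm_pow, one_mul, Real.norm_of_nonneg (by positivity), ← Real.rpow_natCast]
    exact Real.rpow_le_rpow_of_exponent_le hw (not_lt.1 hk)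

end IsHighPart

theorem isBigO_inv_y : (fun w : S.RegularPoint => w.y⁻¹) =O[atInfinity]
    fun w => ‖w.x‖ ^ (-(S.n : ℝ) / 2) := by
  have hp : (fun w : S.RegularPoint => w.x ^ S.n) =O[atInfinity] fun w => w.y ^ 2 := by
    refine ((Polynomial.isBigO_cobounded_of_degree_le (P := Polynomial.X ^ S.n) (Q := S.p)
      (by rw [Polynomial.degree_X_pow, Polynomial.degree_eq_natDegree S.p_ne_zero, n])).comp_tendsto
        tendsto_x_atInfinity).congr (fun w => ?_) fun w => w.eqn.symm
    simp
  refine IsBigO.of_pow two_ne_zero (IsBigO.congr' ((hp.inv_rev ?_).norm_right) ?_ ?_)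
  · exact eventually_x_ne_zero.mono fun w hw hzero => absurd hzero (pow_ne_zero _ hw)
  · exact Eventually.of_forall fun w => (inv_pow _ _).symm
  · refine Eventually.of_forall fun w => ?_
    beta_reduce
    rw [Pi.pow_apply, ← Real.rpow_natCast, ← Real.rpow_mul (norm_nonneg _), norm_inv, norm_pow,
      Nat.cast_ofNat, div_mul_cancel₀ _ two_ne_zero, Real.rpow_neg (norm_nonneg _),
      Real.rpow_natCast]

end HighPart

section GaloisParts

variable {E : S.RegularPoint → ℂ}

theorem galoisEven_of_conj (hE : ∀ w, E w.conj = E w) : galoisEven E = E := by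
  funext w
  rw [galoisEven, hE, add_self_div_two]

theorem galoisOdd_of_conj (hE : ∀ w, E w.conj = E w) : galoisOdd E = 0 := by
  funext w
  rw [galoisOdd, hE, sub_self, zero_div, Pi.zero_apply]

theorem galoisEven_y_mul (hE : ∀ w, E w.conj = E w) : galoisEven (fun w => w.y * E w) = 0 := by
  funext w
  rw [galoisEven, hE, conj_y, neg_mul, add_neg_cancel, zero_div, Pi.zero_apply]

theorem galoisOdd_y_mul (hE : ∀ w, E w.conj = E w) : galoisOdd (fun w => w.y * E w) = E := by
  funext w
  have := w.y_ne_zero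
  rw [galoisOdd, hE, conj_y]
  field_simp
  ring

end GaloisParts

section Projections

theorem eventually_generic_update (i : Fin 3) {z : Fin 3 → S.RegularPoint} (hz : Generic z) :
    ∀ᶠ w : S.RegularPoint in atInfinity, Generic (Function.update z i w) := by
  have hne : ∀ᶠ w : S.RegularPoint in atInfinity, ∀ j, (z j).x ≠ w.x :=
    eventually_all.2 fun j =>
      (tendsto_x_atInfinity.eventually (Bornology.eventually_ne_cobounded (z j).x)).mono
        fun _ => Ne.symm
  exact hne.mono fun w => injective_x_update hz i

/-- At generic points, the projection of `Q` with respect to the `i`-th point exists and is `R`. -/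
def HasProjTo (i : Fin 3) (Q R : (Fin 3 → S.RegularPoint) → ℂ) : Prop :=
  ∀ z, Generic z → ∃ h h',
    IsHighPart ((S.n : ℝ) - 3) (evenPart i Q z) h ∧
    IsHighPart ((S.n : ℝ) / 2 - 3) (oddPart i Q z) h' ∧
    R z = laurentEval h (z i).x + (z i).y * laurentEval h' (z i).x

namespace HasProjTo

variable {i : Fin 3} {Q Q' R R' : (Fin 3 → S.RegularPoint) → ℂ}

theorem hasProj (hQ : HasProjTo i Q R) : HasProj i Q := by
  intro z hz
  obtain ⟨h, h', heven, hodd, _⟩ := hQ z hz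
  exact ⟨⟨h, heven⟩, ⟨h', hodd⟩⟩

theorem proj_eq (hQ : HasProjTo i Q R) {z : Fin 3 → S.RegularPoint} (hz : Generic z) :
    proj i Q z = R z := by
  obtain ⟨h, h', heven, hodd, hR⟩ := hQ z hz
  rw [proj, heven.highPart_eq, hodd.highPart_eq, hR]

theorem congr (hQ : HasProjTo i Q R) (hQQ' : ∀ z, Generic z → Q' z = Q z)
    (hRR' : ∀ z, Generic z → R' z = R z) : HasProjTo i Q' R' := by
  intro z hz
  obtain ⟨h, h', heven, hodd, hR⟩ := hQ z hz
  have hgen := eventually_generic_update i hz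
  have hgen_conj := tendsto_conj_atInfinity.eventually hgen
  refine ⟨h, h', heven.congr ?_, hodd.congr ?_, (hRR' z hz).trans hR⟩
  · filter_upwards [hgen, hgen_conj] with w hw hw'
    rw [evenPart, evenPart, hQQ' _ hw, hQQ' _ hw']
  · filter_upwards [hgen, hgen_conj] with w hw hw'
    rw [oddPart, oddPart, hQQ' _ hw, hQQ' _ hw']

theorem add (hQ : HasProjTo i Q R) (hQ' : HasProjTo i Q' R') :
    HasProjTo i (Q + Q') (R + R') := by
  intro z hz
  obtain ⟨h₁, h₁', heven, hodd, hR⟩ := hQ z hz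
  obtain ⟨h₂, h₂', heven', hodd', hR'⟩ := hQ' z hz
  refine ⟨h₁ + h₂, h₁' + h₂', (heven.add heven').congr (.of_forall fun w => ?_),
    (hodd.add hodd').congr (.of_forall fun w => ?_), ?_⟩
  · simp only [evenPart, Pi.add_apply]
    ring
  · simp only [oddPart, Pi.add_apply]
    ring
  · rw [Pi.add_apply, hR, hR', laurentEval_add, laurentEval_add]
    ring

theorem const_smul (a : ℂ) (hQ : HasProjTo i Q R) : HasProjTo i (a • Q) (a • R) := by
  intro z hz
  obtain ⟨h, h', heven, hodd, hR⟩ := hQ z hz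
  refine ⟨a • h, a • h', (heven.const_mul a).congr (.of_forall fun w => ?_),
    (hodd.const_mul a).congr (.of_forall fun w => ?_), ?_⟩
  · simp only [evenPart, Pi.smul_apply, smul_eq_mul]
    ring
  · simp only [oddPart, Pi.smul_apply, smul_eq_mul]
    ring
  · rw [Pi.smul_apply, smul_eq_mul, hR, laurentEval_smul, laurentEval_smul]
    ring

theorem zero : HasProjTo i (0 : (Fin 3 → S.RegularPoint) → ℂ) 0 := fun z _ =>
  ⟨0, 0, IsHighPart.zero.congr (.of_forall fun w => by simp [evenPart]),
    IsHighPart.zero.congr (.of_forall fun w => by simp [oddPart]), by simp⟩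

end HasProjTo

/-- The monomial with exponent `j` is left unchanged by the projection with respect to the `i`-th
point, whose order in `x_i` is to exceed `n - 3`, or `n / 2 - 3` if `y_i` is a factor. Otherwise
the projection kills it. -/
def IsHigh (S : HyperellipticSurface) (i : Fin 3) (j : Exponent 3) : Prop :=
  (if i ∈ j.1 then (S.n : ℝ) / 2 - 3 else S.n - 3) < j.2 i

instance (S : HyperellipticSurface) (i : Fin 3) : DecidablePred (IsHigh S i) := fun _ =>
  inferInstanceAs (Decidable (_ < _))

theorem mono_eq_prod {N : ℕ} (j : Exponent N) (z : Fin N → S.RegularPoint) :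
    mono j z = ∏ i, (if i ∈ j.1 then (z i).y else 1) * (z i).x ^ j.2 i := by
  rw [mono, Finset.prod_mul_distrib, Finset.prod_ite_mem, Finset.univ_inter]

theorem exists_mono_update_eq {N : ℕ} (i : Fin N) (j : Exponent N) (z : Fin N → S.RegularPoint) :
    ∃ C, ∀ w, mono j (Function.update z i w) =
      (if i ∈ j.1 then w.y else 1) * (C * w.x ^ j.2 i) := by
  refine ⟨∏ l ∈ {i}ᶜ, (if l ∈ j.1 then (z l).y else 1) * (z l).x ^ j.2 l, fun w => ?_⟩
  rw [mono_eq_prod, Fintype.prod_eq_mul_prod_compl i, Function.update_self,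
    Finset.prod_congr rfl fun l hl => by
      rw [Function.update_of_ne (by simpa using hl)]]
  ring

theorem hasProjTo_mono (i : Fin 3) (j : Exponent 3) :
    HasProjTo i (mono (S := S) j) (if IsHigh S i j then mono j else 0) := by
  intro z _
  obtain ⟨C, hmono⟩ := exists_mono_update_eq i j z
  have hself := hmono (z i)
  rw [Function.update_eq_self] at hself
  have hconj : ∀ w : S.RegularPoint, C * w.conj.x ^ j.2 i = C * w.x ^ j.2 i := by simp
  by_cases hi : i ∈ j.1
  · simp only [hi, if_true] at hmono hself
    have heven : evenPart i (mono j) z = 0 :=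
      (congrArg galoisEven (funext hmono)).trans (galoisEven_y_mul hconj)
    have hodd : oddPart i (mono j) z = fun w => C * w.x ^ j.2 i :=
      (congrArg galoisOdd (funext hmono)).trans (galoisOdd_y_mul hconj)
    refine ⟨0, _, heven ▸ IsHighPart.zero, hodd ▸ IsHighPart.monomial C (j.2 i), ?_⟩
    have hhigh : IsHigh S i j ↔ (S.n : ℝ) / 2 - 3 < j.2 i := by rw [IsHigh, if_pos hi]
    simp only [hhigh]
    split_ifs <;> simp [hself, laurentEval_single]
  · simp only [hi, if_false, one_mul] at hmono hself
    have heven : evenPart i (mono j) z = fun w => C * w.x ^ j.2 i :=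
      (congrArg galoisEven (funext hmono)).trans (galoisEven_of_conj hconj)
    have hodd : oddPart i (mono j) z = 0 :=
      (congrArg galoisOdd (funext hmono)).trans (galoisOdd_of_conj hconj)
    refine ⟨_, 0, heven ▸ IsHighPart.monomial C (j.2 i), hodd ▸ IsHighPart.zero, ?_⟩
    have hhigh : IsHigh S i j ↔ (S.n : ℝ) - 3 < j.2 i := by rw [IsHigh, if_neg hi]
    simp only [hhigh]
    split_ifs <;> simp [hself, laurentEval_single]

theorem hasProjTo_monoSum (i : Fin 3) (a : Exponent 3 →₀ ℂ) :
    HasProjTo i (monoSum (S := S) a) (monoSum (a.filter (IsHigh S i))) := by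
  induction a using Finsupp.induction_linear with
  | zero =>
    rw [Finsupp.filter_zero, map_zero]
    exact .zero
  | add a b ha hb => simpa only [Finsupp.filter_add, map_add] using ha.add hb
  | single j k =>
    have hsingle := (hasProjTo_mono (S := S) i j).const_smul k
    by_cases hj : IsHigh S i j
    · rw [Finsupp.filter_single_of_pos _ hj]
      simpa [monoSum, hj] using hsingle
    · rw [Finsupp.filter_single_of_neg _ hj, map_zero]
      simpa [monoSum, hj] using hsingle

end Projections

end HyperellipticSurface

/-! ### Permutations and rationality of `R⁽⁰⁾` -/

namespace HyperellipticSurface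

variable {S : HyperellipticSurface}

section Permutations

theorem apply_comp_perm_of_swap {N : ℕ} {Q : (Fin (N + 1) → S.RegularPoint) → ℂ}
    (hswap : ∀ (i : Fin N) (z : Fin (N + 1) → S.RegularPoint),
      (Function.Injective fun j => (z j).x) → Q (z ∘ Equiv.swap i.castSucc i.succ) = Q z)
    (σ : Equiv.Perm (Fin (N + 1))) {z : Fin (N + 1) → S.RegularPoint}
    (hz : Function.Injective fun j => (z j).x) : Q (z ∘ σ) = Q z := by
  have hσ : σ ∈ Submonoid.closure (Set.range fun i : Fin N => Equiv.swap i.castSucc i.succ) := by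
    rw [Equiv.Perm.mclosure_swap_castSucc_succ]
    exact Submonoid.mem_top σ
  induction hσ using Submonoid.closure_induction generalizing z with
  | mem τ hτ =>
    obtain ⟨i, rfl⟩ := hτ
    exact hswap i z hz
  | one => rfl
  | mul σ τ _ _ ihσ ihτ => exact (ihτ (z := z ∘ σ) (hz.comp σ.injective)).trans (ihσ hz)

theorem apply_comp_perm_of_comm {F : S.RegularPoint → S.RegularPoint → S.RegularPoint → ℂ}
    (hleft : ∀ z₁ z₂ z₃, z₁ ≠ z₂ → z₁ ≠ z₃ → z₂ ≠ z₃ → F z₁ z₂ z₃ = F z₂ z₁ z₃)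
    (hright : ∀ z₁ z₂ z₃, z₁ ≠ z₂ → z₁ ≠ z₃ → z₂ ≠ z₃ → F z₁ z₂ z₃ = F z₁ z₃ z₂)
    (σ : Equiv.Perm (Fin 3)) {z : Fin 3 → S.RegularPoint} (hz : Generic z) :
    F ((z ∘ σ) 0) ((z ∘ σ) 1) ((z ∘ σ) 2) = F (z 0) (z 1) (z 2) := by
  refine apply_comp_perm_of_swap (Q := fun z => F (z 0) (z 1) (z 2)) (fun i z hz => ?_) σ hz
  have hne {i j : Fin 3} (hij : i ≠ j) : z i ≠ z j := fun h => hij (hz (congrArg x h))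
  have h01 : z 0 ≠ z 1 := hne (by decide)
  have h02 : z 0 ≠ z 2 := hne (by decide)
  have h12 : z 1 ≠ z 2 := hne (by decide)
  fin_cases i
  · exact (hleft _ _ _ h01 h02 h12).symm
  · exact (hright _ _ _ h01 h02 h12).symm

end Permutations

section RationalFunctions

variable {Q R : (Fin 3 → S.RegularPoint) → ℂ}

theorem evalXY_add (F G : MvPolynomial (Fin 3 ⊕ Fin 3) ℂ) (z : Fin 3 → S.RegularPoint) :
    evalXY (F + G) z = evalXY F z + evalXY G z :=
  map_add _ F G

theorem evalXY_mul (F G : MvPolynomial (Fin 3 ⊕ Fin 3) ℂ) (z : Fin 3 → S.RegularPoint) :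
    evalXY (F * G) z = evalXY F z * evalXY G z :=
  map_mul _ F G

theorem IsPolyFun.exists_evalXY {N : ℕ} {Q : (Fin N → S.RegularPoint) → ℂ} (hQ : IsPolyFun Q)
    {e : Fin N → Fin 3} (he : Function.Injective e) : ∃ F : MvPolynomial (Fin 3 ⊕ Fin 3) ℂ,
      ∀ z : Fin 3 → S.RegularPoint, Generic z → Q (z ∘ e) = evalXY F z := by
  obtain ⟨a, ha⟩ := hQ
  refine ⟨a.sum fun j k => MvPolynomial.C k *
    ((∏ i ∈ j.1, MvPolynomial.X (Sum.inr (e i))) *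
      ∏ i, MvPolynomial.X (Sum.inl (e i)) ^ j.2 i), fun z hz => ?_⟩
  rw [ha (z ∘ e) (Function.Injective.comp (g := fun i => (z i).x) hz he), monoSum_apply]
  simp [Finsupp.sum, evalXY, mono]

/-- A function of three points that is a rational function of their coordinates, whose denominator
does not vanish as long as the `x`-coordinates are distinct. -/
def IsRationalFun (Q : (Fin 3 → S.RegularPoint) → ℂ) : Prop :=
  ∃ num den, ∀ z, Generic z → evalXY den z ≠ 0 ∧ Q z = evalXY num z / evalXY den z

namespace IsRationalFun

theorem add (hQ : IsRationalFun Q) (hR : IsRationalFun R) :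
    IsRationalFun fun z => Q z + R z := by
  obtain ⟨a, b, hab⟩ := hQ
  obtain ⟨d, e, hde⟩ := hR
  refine ⟨a * e + b * d, b * e, fun z hz => ?_⟩
  obtain ⟨hb, hQ⟩ := hab z hz
  obtain ⟨he, hR⟩ := hde z hz
  simp only [evalXY_add, evalXY_mul]
  exact ⟨mul_ne_zero hb he, by rw [hQ, hR, div_add_div _ _ hb he]⟩

theorem mul (hQ : IsRationalFun Q) (hR : IsRationalFun R) :
    IsRationalFun fun z => Q z * R z := by
  obtain ⟨a, b, hab⟩ := hQ
  obtain ⟨d, e, hde⟩ := hR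
  refine ⟨a * d, b * e, fun z hz => ?_⟩
  obtain ⟨hb, hQ⟩ := hab z hz
  obtain ⟨he, hR⟩ := hde z hz
  simp only [evalXY_mul]
  exact ⟨mul_ne_zero hb he, by rw [hQ, hR, div_mul_div_comm]⟩

theorem const (a : ℂ) : IsRationalFun fun _ : Fin 3 → S.RegularPoint => a :=
  ⟨MvPolynomial.C a, 1, fun z _ => by simp [evalXY]⟩

theorem f {i j : Fin 3} (hij : i ≠ j) :
    IsRationalFun fun z : Fin 3 → S.RegularPoint => VirasoroState.f (z i) (z j) := by
  refine ⟨(.X (.inr i) + .X (.inr j)) ^ 2, (.X (.inl i) - .X (.inl j)) ^ 2, fun z hz => ?_⟩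
  have hx : (z i).x - (z j).x ≠ 0 := sub_ne_zero.2 (hz.ne hij)
  simp [evalXY, VirasoroState.f, div_pow, hx]

end IsRationalFun

theorem IsPolyFun.isRationalFun {N : ℕ} {Q : (Fin N → S.RegularPoint) → ℂ} (hQ : IsPolyFun Q)
    {e : Fin N → Fin 3} (he : Function.Injective e) :
    IsRationalFun fun z : Fin 3 → S.RegularPoint => Q (z ∘ e) := by
  obtain ⟨F, hF⟩ := hQ.exists_evalXY he
  exact ⟨F, 1, fun z hz => by simp [evalXY, hF z hz]⟩

end RationalFunctions

end HyperellipticSurface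

namespace VirasoroState

variable {S : HyperellipticSurface} {c : ℂ} (V : VirasoroState S c)

theorem R0_comp_perm (hV : V.one ≠ 0) (σ : Equiv.Perm (Fin 3)) {z : Fin 3 → S.RegularPoint}
    (hz : Generic z) : V.R0 (z ∘ σ) = V.R0 z := by
  rw [R0_eq, R0_eq]
  exact apply_comp_perm_of_comm (F := V.nR) (fun _ _ _ h12 _ _ => V.nR_comm_left hV h12)
    (fun _ _ _ _ _ h23 => V.nR_comm_right hV h23) σ hz

theorem G3_comp_perm (σ : Equiv.Perm (Fin 3)) {z : Fin 3 → S.RegularPoint}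
    (hz : Generic z) : V.G3 (z ∘ σ) = V.G3 z := by
  refine apply_comp_perm_of_comm (F := fun z₁ z₂ z₃ => V.conn3 z₁ z₂ z₃ * (z₁.p * z₂.p * z₃.p))
    (fun z₁ z₂ z₃ h12 h13 h23 => ?_) (fun z₁ z₂ z₃ h12 h13 h23 => ?_) σ hz
  · rw [V.conn3_comm_left h12 h13 h23, mul_comm z₁.p]
  · rw [V.conn3_comm_right h12 h13 h23, mul_right_comm z₁.p]

theorem diffField_eq {z : Fin 3 → S.RegularPoint} (hz : Generic z) :
    V.diffField (z 0) (z 1) (z 2) = V.G3 z - V.R0 z := by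
  have h02 : z 0 ≠ z 2 := fun h => absurd (hz (congrArg RegularPoint.x h)) (by decide)
  rw [diffField, R0_eq, G3, V.conn3_eq_atX h02]

theorem isPolyFun_nP (hV : V.one ≠ 0) :
    IsPolyFun fun z : Fin 1 → S.RegularPoint => V.nP (z 0) := by
  obtain ⟨F, G, hF, hG, h⟩ := V.exists_polynomials_nP hV
  refine (IsSeparatelyPoly.of_symmetric (D := 2 * S.n) (fun σ z _ => ?_)
    fun z _ => ⟨F, G, hF, hG, fun w _ => h w (Finset.notMem_empty _)⟩).isPolyFun
  rw [Function.comp_apply, Fin.fin_one_eq_zero (σ 0)]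

theorem isPolyFun_nreg (hV : V.one ≠ 0) :
    IsPolyFun fun z : Fin 2 → S.RegularPoint => V.nreg (z 0) (z 1) := by
  refine (IsSeparatelyPoly.of_symmetric (D := 4 * S.n) (fun σ z hz => ?_)
    fun z _ => ?_).isPolyFun
  · refine apply_comp_perm_of_swap (Q := fun z => V.nreg (z 0) (z 1)) (fun i z hz => ?_) σ hz
    obtain rfl : i = 0 := Subsingleton.elim _ _
    have h01 : z 0 ≠ z 1 := fun h => absurd (hz (congrArg x h)) (by decide)
    exact (V.nreg_comm hV h01).symm
  · obtain ⟨F, G, hF, hG, h⟩ := V.exists_polynomials_nreg hV (z 0)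
    exact ⟨F, G, hF, hG, fun w hw => h w (by simpa using (hw 0).symm)⟩

theorem isPolyFun_G3_sub_R0 (hV : V.one ≠ 0) :
    IsPolyFun fun z : Fin 3 → S.RegularPoint => V.G3 z - V.R0 z := by
  refine (IsSeparatelyPoly.of_symmetric (D := 6 * S.n) (fun σ z hz => ?_)
    fun z hz => ?_).isPolyFun
  · rw [V.G3_comp_perm σ hz, V.R0_comp_perm hV σ hz]
  · have h01 : (z 0).x ≠ (z 1).x := hz.ne (by decide)
    obtain ⟨F, G, hF, hG, h⟩ := V.exists_polynomials_diffField hV h01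
    refine ⟨F, G, hF, hG, fun w hw => ?_⟩
    rw [← V.diffField_eq (injective_x_cons.2 ⟨hw, hz⟩), ← h w (by simp [(hw _).symm])]
    rfl

theorem isRationalFun_R0 (hV : V.one ≠ 0) : IsRationalFun V.R0 := by
  have hP (i : Fin 3) : IsRationalFun fun z : Fin 3 → S.RegularPoint => V.nP (z i) :=
    (V.isPolyFun_nP hV).isRationalFun (e := fun _ => i) (Function.injective_of_subsingleton _)
  have hreg {i j : Fin 3} (hij : i ≠ j) :
      IsRationalFun fun z : Fin 3 → S.RegularPoint => V.nreg (z i) (z j) :=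
    (V.isPolyFun_nreg hV).isRationalFun (e := ![i, j]) (List.nodup_ofFn.1 (by simpa using hij))
  have h01 : (0 : Fin 3) ≠ 1 := by decide
  have h02 : (0 : Fin 3) ≠ 2 := by decide
  have h12 : (1 : Fin 3) ≠ 2 := by decide
  have hff {i j k l : Fin 3} (hij : i ≠ j) (hkl : k ≠ l) (a : ℂ) :=
    ((IsRationalFun.const (S := S) a).mul (.f hij)).mul (.f hkl)
  have hfr {i j : Fin 3} (hij : i ≠ j) :=
    (IsRationalFun.const (S := S) (1 / 4)).mul (.f hij)
  rw [funext V.R0_eq]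
  exact (((((((hff h01 h02 _).mul (.f h12)).add
    ((hff h01 h02 _).mul ((hP 1).add (hP 2)))).add
    ((hff h01 h12 _).mul ((hP 0).add (hP 2)))).add
    ((hff h02 h12 _).mul ((hP 0).add (hP 1)))).add
    ((hfr h01).mul ((hreg h02).add (hreg h12)))).add
    ((hfr h02).mul ((hreg h01).add (hreg h12)))).add
    ((hfr h12).mul ((hreg h01).add (hreg h02)))

end VirasoroState

/-! ### Symmetric coefficients and inclusion–exclusion -/

namespace HyperellipticSurface

variable {S : HyperellipticSurface} {N : ℕ}

section Permutations

/-- The action of permutations of the `N` points on the exponents of monomials. -/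
def permExponent : Equiv.Perm (Fin N) →* Equiv.Perm (Exponent N) where
  toFun σ := (Equiv.finsetCongr σ).prodCongr (Finsupp.domCongr σ).toEquiv
  map_one' := by
    refine Equiv.ext fun j => Prod.ext ?_ (Finsupp.ext fun _ => rfl)
    exact Finset.map_refl
  map_mul' σ τ := by
    refine Equiv.ext fun j => Prod.ext ?_ (Finsupp.ext fun _ => rfl)
    exact (Finset.map_map τ.toEmbedding σ.toEmbedding j.1).symm

theorem permExponent_fst (σ : Equiv.Perm (Fin N)) (j : Exponent N) :
    (permExponent σ j).1 = j.1.map σ.toEmbedding := rfl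

theorem permExponent_snd_apply (σ : Equiv.Perm (Fin N)) (j : Exponent N) (i : Fin N) :
    (permExponent σ j).2 (σ i) = j.2 i :=
  congrArg j.2 (σ.symm_apply_apply i)

theorem permExponent_mk (σ : Equiv.Perm (Fin N)) (s : Finset (Fin N)) (m : Fin N →₀ ℕ) :
    permExponent σ (s, m) = (s.map σ.toEmbedding, m.mapDomain σ) :=
  Prod.ext rfl (Finsupp.equivMapDomain_eq_mapDomain σ m)

theorem mono_permExponent (σ : Equiv.Perm (Fin N)) (j : Exponent N)
    (z : Fin N → S.RegularPoint) : mono (permExponent σ j) z = mono j (z ∘ σ) := by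
  rw [mono, mono, permExponent_fst, Finset.prod_map,
    ← Equiv.prod_comp σ fun i => (z i).x ^ (permExponent σ j).2 i]
  simp only [permExponent_snd_apply, Equiv.coe_toEmbedding, Function.comp_apply]

theorem monoSum_equivMapDomain (σ : Equiv.Perm (Fin N)) (a : Exponent N →₀ ℂ)
    (z : Fin N → S.RegularPoint) :
    monoSum (a.equivMapDomain (permExponent σ)) z = monoSum a (z ∘ σ) := by
  rw [monoSum_apply, monoSum_apply, Finsupp.equivMapDomain_eq_mapDomain,
    Finsupp.sum_mapDomain_index (by simp) fun _ _ _ => add_mul ..]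
  simp only [mono_permExponent]

/-- The coefficients are made symmetric by averaging over all permutations. -/
theorem IsPolyFun.exists_symmetric {Q : (Fin N → S.RegularPoint) → ℂ} (hQ : IsPolyFun Q)
    (hsymm : ∀ (σ : Equiv.Perm (Fin N)) (z : Fin N → S.RegularPoint),
      (Function.Injective fun i => (z i).x) → Q (z ∘ σ) = Q z) :
    ∃ a : Exponent N →₀ ℂ, (∀ z : Fin N → S.RegularPoint,
      (Function.Injective fun i => (z i).x) → Q z = monoSum a z) ∧
      ∀ σ j, a (permExponent σ j) = a j := by
  obtain ⟨a, ha⟩ := hQ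
  refine ⟨(N.factorial : ℂ)⁻¹ • ∑ σ, a.equivMapDomain (permExponent σ), fun z hz => ?_,
    fun τ j => ?_⟩
  · have hterm (σ : Equiv.Perm (Fin N)) : monoSum (a.equivMapDomain (permExponent σ)) z = Q z := by
      rw [monoSum_equivMapDomain, ← ha (z ∘ σ) (hz.comp σ.injective), hsymm σ z hz]
    have hfact : (N.factorial : ℂ) ≠ 0 := Nat.cast_ne_zero.2 N.factorial_ne_zero
    simp only [map_smul, map_sum, Pi.smul_apply, Finset.sum_apply, hterm, Finset.sum_const,
      Finset.card_univ, Fintype.card_perm, Fintype.card_fin, nsmul_eq_mul, smul_eq_mul]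
    rw [inv_mul_cancel_left₀ hfact]
  · simp only [Finsupp.smul_apply, Finsupp.finsetSum_apply, Finsupp.equivMapDomain_apply]
    congr 1
    refine Fintype.sum_equiv (Equiv.mulLeft τ⁻¹) _ _ fun σ => congrArg a ?_
    rw [Equiv.coe_mulLeft, map_mul, map_inv]
    rfl

end Permutations

section Coefficients

/-- The polynomial in `x₁, …, x_N` by which the product of the `y_i` with `i ∈ s` is multiplied in
`monoSum a`. -/
def yCoeff (a : Exponent N →₀ ℂ) (s : Finset (Fin N)) : MvPolynomial (Fin N) ℂ :=
  a.sum fun j k => if j.1 = s then MvPolynomial.monomial j.2 k else 0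

theorem coeff_yCoeff (a : Exponent N →₀ ℂ) (s : Finset (Fin N)) (m : Fin N →₀ ℕ) :
    (yCoeff a s).coeff m = a (s, m) := by
  have hterm (j : Exponent N) : MvPolynomial.coeff m
      (if j.1 = s then MvPolynomial.monomial j.2 (a j) else 0) = if j = (s, m) then a j else 0 := by
    simp only [Prod.ext_iff, ite_and, apply_ite (MvPolynomial.coeff m),
      MvPolynomial.coeff_monomial, MvPolynomial.coeff_zero]
  rw [yCoeff, Finsupp.sum, MvPolynomial.coeff_sum]
  simp only [hterm, Finset.sum_ite_eq', Finsupp.mem_support_iff, ite_eq_left_iff, not_not]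
  exact Eq.symm

theorem rename_yCoeff {a : Exponent N →₀ ℂ} (ha : ∀ σ j, a (permExponent σ j) = a j)
    (σ : Equiv.Perm (Fin N)) (s : Finset (Fin N)) :
    MvPolynomial.rename σ (yCoeff a s) = yCoeff a (s.map σ.toEmbedding) := by
  ext m
  obtain ⟨m, rfl⟩ : ∃ l : Fin N →₀ ℕ, l.mapDomain σ = m :=
    Finsupp.mapDomain_surjective σ.surjective m
  rw [MvPolynomial.coeff_rename_mapDomain _ σ.injective, coeff_yCoeff, coeff_yCoeff,
    ← permExponent_mk, ha]

theorem galoisSum_comp_perm {F : Finset (Fin 3) → MvPolynomial (Fin 3) ℂ}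
    {σ : Equiv.Perm (Fin 3)} (hF : ∀ s, MvPolynomial.rename σ (F s) = F (s.map σ.toEmbedding))
    (k : ℕ) (z : Fin 3 → S.RegularPoint) : galoisSum F k (z ∘ σ) = galoisSum F k z := by
  refine Finset.sum_equiv (Equiv.finsetCongr σ) (fun s => ?_) fun s _ => ?_
  · simp [Finset.mem_powersetCard]
  · rw [Equiv.finsetCongr_apply, Finset.prod_map, ← hF, evalX, evalX, MvPolynomial.eval_rename]
    rfl

theorem evalX_yCoeff (a : Exponent 3 →₀ ℂ) (s : Finset (Fin 3)) (z : Fin 3 → S.RegularPoint) :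
    evalX (yCoeff a s) z = a.sum fun j k => if j.1 = s then k * ∏ i, (z i).x ^ j.2 i else 0 := by
  rw [evalX, yCoeff, Finsupp.sum, Finsupp.sum, map_sum]
  refine Finset.sum_congr rfl fun j _ => ?_
  rw [apply_ite (MvPolynomial.eval _), MvPolynomial.eval_monomial, map_zero,
    Finsupp.prod_fintype _ _ fun _ => pow_zero _]

theorem sum_galoisSum_yCoeff (a : Exponent 3 →₀ ℂ) (z : Fin 3 → S.RegularPoint) :
    ∑ k ∈ Finset.range 4, galoisSum (yCoeff a) k z = monoSum a z := by
  refine (Finset.sum_powerset Finset.univ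
    fun s => (∏ i ∈ s, (z i).y) * evalX (yCoeff a s) z).symm.trans ?_
  simp only [Finset.powerset_univ, evalX_yCoeff, monoSum_apply, Finsupp.sum, Finset.mul_sum]
  rw [Finset.sum_comm]
  refine Finset.sum_congr rfl fun j _ => ?_
  simp only [mul_ite, mul_zero, Finset.sum_ite_eq, Finset.mem_univ, if_true, mono]
  ring

end Coefficients

section LowOrder

/-- The monomial with exponent `j` is killed by the projections with respect to all points. -/
def IsLow (S : HyperellipticSurface) (j : Exponent 3) : Prop := ∀ i, ¬ IsHigh S i j

instance (S : HyperellipticSurface) : DecidablePred (IsLow S) := fun j =>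
  inferInstanceAs (Decidable (∀ i, ¬ IsHigh S i j))

theorem isHigh_permExponent (σ : Equiv.Perm (Fin 3)) (j : Exponent 3) (i : Fin 3) :
    IsHigh S (σ i) (permExponent σ j) ↔ IsHigh S i j := by
  have hmem : σ i ∈ (permExponent σ j).1 ↔ i ∈ j.1 := Finset.mem_map' σ.toEmbedding
  simp only [IsHigh, permExponent_snd_apply, hmem]

theorem isLow_permExponent (σ : Equiv.Perm (Fin 3)) (j : Exponent 3) :
    IsLow S (permExponent σ j) ↔ IsLow S j := by
  rw [IsLow, ← σ.forall_congr_right]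
  simp only [isHigh_permExponent, IsLow]

theorem filter_isLow_permExponent {a : Exponent 3 →₀ ℂ} (ha : ∀ σ j, a (permExponent σ j) = a j)
    (σ : Equiv.Perm (Fin 3)) (j : Exponent 3) :
    a.filter (IsLow S) (permExponent σ j) = a.filter (IsLow S) j := by
  simp only [Finsupp.filter_apply, isLow_permExponent, ha]

theorem IsLow.snd_apply_le (hn : Odd S.n) {s : Finset (Fin 3)} {m : Fin 3 →₀ ℕ}
    (h : IsLow S (s, m)) (k : Fin 3) :
    (k ∈ s → (m k : ℤ) ≤ ((S.n : ℤ) - 1) / 2 - 3) ∧ (k ∉ s → (m k : ℤ) ≤ (S.n : ℤ) - 3) := by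
  have hk := h k
  obtain ⟨r, hr⟩ := hn
  refine ⟨fun hmem => ?_, fun hmem => ?_⟩
  · rw [IsHigh, if_pos hmem, not_lt, le_sub_iff_add_le, le_div_iff₀ two_pos] at hk
    have hnat : (m k + 3) * 2 ≤ S.n := by exact_mod_cast hk
    lia
  · rw [IsHigh, if_neg hmem, not_lt, le_sub_iff_add_le] at hk
    have hnat : m k + 3 ≤ S.n := by exact_mod_cast hk
    lia

theorem isLow_of_mem_support_yCoeff {a : Exponent 3 →₀ ℂ} {s : Finset (Fin 3)} {m : Fin 3 →₀ ℕ}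
    (hm : m ∈ (yCoeff (a.filter (IsLow S)) s).support) : IsLow S (s, m) := by
  rw [MvPolynomial.mem_support_iff, coeff_yCoeff, ← Finsupp.mem_support_iff,
    Finsupp.support_filter] at hm
  exact (Finset.mem_filter.1 hm).2

theorem filter_isHigh_comm (a : Exponent 3 →₀ ℂ) (i j : Fin 3) :
    (a.filter (IsHigh S i)).filter (IsHigh S j) = (a.filter (IsHigh S j)).filter (IsHigh S i) := by
  ext e
  simp only [Finsupp.filter_apply, ← ite_and, and_comm]

theorem filter_isHigh_eq_filter_forall (a : Exponent 3 →₀ ℂ) {i j k : Fin 3} (hij : i ≠ j)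
    (hik : i ≠ k) (hjk : j ≠ k) :
    ((a.filter (IsHigh S i)).filter (IsHigh S j)).filter (IsHigh S k) =
      a.filter fun e => ∀ l, IsHigh S l e := by
  ext e
  have hforall : (∀ l, IsHigh S l e) ↔ IsHigh S k e ∧ IsHigh S j e ∧ IsHigh S i e := by
    have huniv : ∀ l, l = k ∨ l = j ∨ l = i := by lia
    refine ⟨fun h => ⟨h k, h j, h i⟩, fun ⟨hk, hj, hi⟩ l => ?_⟩
    rcases huniv l with rfl | rfl | rfl <;> assumption
  simp only [Finsupp.filter_apply, ← ite_and, hforall]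

theorem eq_inclusion_exclusion (a : Exponent 3 →₀ ℂ) :
    a = a.filter (IsHigh S 0) - (a.filter (IsHigh S 0)).filter (IsHigh S 1) +
      a.filter (IsHigh S 1) - (a.filter (IsHigh S 1)).filter (IsHigh S 2) +
      a.filter (IsHigh S 2) - (a.filter (IsHigh S 0)).filter (IsHigh S 2) +
      ((a.filter (IsHigh S 0)).filter (IsHigh S 1)).filter (IsHigh S 2) + a.filter (IsLow S) := by
  ext j
  have hlow : IsLow S j ↔ ¬ IsHigh S 0 j ∧ ¬ IsHigh S 1 j ∧ ¬ IsHigh S 2 j := by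
    simp [IsLow, Fin.forall_fin_succ]
  by_cases h0 : IsHigh S 0 j <;> by_cases h1 : IsHigh S 1 j <;> by_cases h2 : IsHigh S 2 j <;>
    simp [hlow, h0, h1, h2]

end LowOrder

theorem HasProjTo.of_isBigO {Q : (Fin 3 → S.RegularPoint) → ℂ} {i : Fin 3}
    (hQ : ∀ z, Generic z →
      (fun w => Q (Function.update z i w)) =O[atInfinity] fun w => ‖w.x‖ ^ ((S.n : ℝ) - 3)) :
    HasProjTo i Q 0 := by
  intro z hz
  have hupdate := hQ z hz
  have hconj : (fun w : S.RegularPoint => Q (Function.update z i w.conj)) =O[atInfinity]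
      fun w => ‖w.x‖ ^ ((S.n : ℝ) - 3) := hupdate.comp_tendsto tendsto_conj_atInfinity
  refine ⟨0, 0, .of_isBigO ?_, .of_isBigO ?_, by simp⟩
  · exact ((hupdate.add hconj).const_mul_left 2⁻¹).congr_left fun w => inv_mul_eq_div _ _
  · refine (((hupdate.sub hconj).mul isBigO_inv_y).const_mul_left 2⁻¹).congr' ?_ ?_
    · refine .of_forall fun w => ?_
      simp only [oddPart]
      ring
    · filter_upwards [eventually_x_ne_zero] with w hw
      rw [← Real.rpow_add (norm_pos_iff.2 hw)]
      ring_nf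

end HyperellipticSurface

namespace VirasoroState

variable {S : HyperellipticSurface} {c : ℂ} (V : VirasoroState S c) {z : Fin 3 → S.RegularPoint}
  {a : Exponent 3 →₀ ℂ}

theorem isBigO_G3_update (hV : V.one ≠ 0) (hn : Odd S.n) (i : Fin 3) (hz : Generic z) :
    (fun w => V.G3 (Function.update z i w)) =O[atInfinity] fun w => w.x ^ (S.n - 3) := by
  set σ := Equiv.swap 0 i
  have hne : z (σ 1) ≠ z (σ 2) := fun h =>
    absurd (σ.injective (hz (congrArg RegularPoint.x h))) (by decide)
  refine (V.isBigO_G3 hV hn hne).congr' ?_ EventuallyEq.rfl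
  filter_upwards [eventually_generic_update i hz] with w hw
  have hupdate : ![w, z (σ 1), z (σ 2)] = Function.update z i w ∘ σ := by
    rw [Function.update_comp_equiv, Equiv.symm_swap, Equiv.swap_apply_right]
    funext l
    fin_cases l <;> rfl
  rw [hupdate, V.G3_comp_perm σ hw]

theorem hasProjTo_G3 (hV : V.one ≠ 0) (hn : Odd S.n) (i : Fin 3) : HasProjTo i V.G3 0 := by
  refine .of_isBigO fun z hz => (V.isBigO_G3_update hV hn i hz).norm_right.congr_right fun w => ?_
  rw [norm_pow, ← Real.rpow_natCast, Nat.cast_sub three_le_n, Nat.cast_ofNat]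

theorem hasProjTo_R0 (hV : V.one ≠ 0) (hn : Odd S.n)
    (ha : ∀ z, Generic z → V.G3 z - V.R0 z = monoSum a z) (i : Fin 3) :
    HasProjTo i V.R0 (monoSum ((-a).filter (IsHigh S i))) := by
  refine ((V.hasProjTo_G3 hV hn i).add (hasProjTo_monoSum i (-a))).congr (fun z hz => ?_)
    fun z _ => ?_
  · rw [map_neg, Pi.add_apply, Pi.neg_apply, ← ha z hz]
    ring
  · rw [zero_add]

theorem hasProjTo_proj_R0 (hV : V.one ≠ 0) (hn : Odd S.n)
    (ha : ∀ z, Generic z → V.G3 z - V.R0 z = monoSum a z) (i j : Fin 3) :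
    HasProjTo j (proj i V.R0) (monoSum (((-a).filter (IsHigh S i)).filter (IsHigh S j))) :=
  (hasProjTo_monoSum j _).congr (fun _ hz => (V.hasProjTo_R0 hV hn ha i).proj_eq hz)
    fun _ _ => rfl

theorem hasProjTo_proj_proj_R0 (hV : V.one ≠ 0) (hn : Odd S.n)
    (ha : ∀ z, Generic z → V.G3 z - V.R0 z = monoSum a z) (i j k : Fin 3) :
    HasProjTo k (proj j (proj i V.R0))
      (monoSum ((((-a).filter (IsHigh S i)).filter (IsHigh S j)).filter (IsHigh S k))) :=
  (hasProjTo_monoSum k _).congr (fun _ hz => (V.hasProjTo_proj_R0 hV hn ha i j).proj_eq hz)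
    fun _ _ => rfl

theorem proj_proj_R0_comm (hV : V.one ≠ 0) (hn : Odd S.n)
    (ha : ∀ z, Generic z → V.G3 z - V.R0 z = monoSum a z) (hz : Generic z) (i j : Fin 3) :
    proj j (proj i V.R0) z = proj i (proj j V.R0) z := by
  rw [(V.hasProjTo_proj_R0 hV hn ha i j).proj_eq hz, (V.hasProjTo_proj_R0 hV hn ha j i).proj_eq hz,
    filter_isHigh_comm]

theorem proj_proj_proj_R0_eq (hV : V.one ≠ 0) (hn : Odd S.n)
    (ha : ∀ z, Generic z → V.G3 z - V.R0 z = monoSum a z) (hz : Generic z) {i j k : Fin 3}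
    (hij : i ≠ j) (hik : i ≠ k) (hjk : j ≠ k) :
    proj k (proj j (proj i V.R0)) z = proj 2 (proj 1 (proj 0 V.R0)) z := by
  rw [(V.hasProjTo_proj_proj_R0 hV hn ha i j k).proj_eq hz,
    (V.hasProjTo_proj_proj_R0 hV hn ha 0 1 2).proj_eq hz,
    filter_isHigh_eq_filter_forall _ hij hik hjk,
    filter_isHigh_eq_filter_forall _ (by decide) (by decide) (by decide)]

theorem G3_eq_R0_sub_proj_add_galoisSum (hV : V.one ≠ 0) (hn : Odd S.n)
    (ha : ∀ z, Generic z → V.G3 z - V.R0 z = monoSum a z) (hz : Generic z) :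
    V.G3 z = V.R0 z - proj 0 V.R0 z + proj 1 (proj 0 V.R0) z - proj 1 V.R0 z +
      proj 2 (proj 1 V.R0) z - proj 2 V.R0 z + proj 2 (proj 0 V.R0) z -
      proj 2 (proj 1 (proj 0 V.R0)) z + galoisSum (yCoeff (a.filter (IsLow S))) 0 z +
      galoisSum (yCoeff (a.filter (IsLow S))) 1 z + galoisSum (yCoeff (a.filter (IsLow S))) 2 z +
      galoisSum (yCoeff (a.filter (IsLow S))) 3 z := by
  have hproj := V.hasProjTo_R0 hV hn ha
  have hproj₂ := V.hasProjTo_proj_R0 hV hn ha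
  have hsum := congrFun (congrArg (monoSum (S := S)) (eq_inclusion_exclusion (S := S) (-a))) z
  have hlow := sum_galoisSum_yCoeff (a.filter (IsLow S)) z
  have hneg : (-a).filter (IsLow S) = -a.filter (IsLow S) := Finsupp.filter_neg _ _
  simp only [hneg, map_add, map_sub, map_neg (monoSum),
    Pi.add_apply, Pi.sub_apply, Pi.neg_apply, ← ha z hz] at hsum
  rw [(hproj 0).proj_eq hz, (hproj 1).proj_eq hz, (hproj 2).proj_eq hz, (hproj₂ 0 1).proj_eq hz,
    (hproj₂ 1 2).proj_eq hz, (hproj₂ 0 2).proj_eq hz,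
    (V.hasProjTo_proj_proj_R0 hV hn ha 0 1 2).proj_eq hz]
  simp only [Finset.sum_range_succ, Finset.sum_range_zero, zero_add] at hlow
  linear_combination -hsum - hlow

end VirasoroState

end

theorem theorem4 (S : HyperellipticSurface) (c : ℂ) (V : VirasoroState S c) (hV : V.one ≠ 0) :
    -- behaviour at infinity
    (Odd S.n → ∀ z₂ z₃ : S.RegularPoint, z₂ ≠ z₃ →
      (fun z₁ : S.RegularPoint => V.G3 ![z₁, z₂, z₃])
        =O[HyperellipticSurface.RegularPoint.atInfinity] fun z₁ => z₁.x ^ (S.n - 3)) ∧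
    -- the finite region
    ((∃ num den : MvPolynomial (Fin 3 ⊕ Fin 3) ℂ,
        ∀ z : Fin 3 → S.RegularPoint, HyperellipticSurface.Generic z →
          HyperellipticSurface.evalXY den z ≠ 0 ∧
          V.R0 z = HyperellipticSurface.evalXY num z / HyperellipticSurface.evalXY den z) ∧
      (∀ (σ : Equiv.Perm (Fin 3)) (z : Fin 3 → S.RegularPoint), HyperellipticSurface.Generic z →
        V.R0 (z ∘ σ) = V.R0 z) ∧
      ∃ F : MvPolynomial (Fin 3 ⊕ Fin 3) ℂ,
        ∀ z : Fin 3 → S.RegularPoint, HyperellipticSurface.Generic z →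
          V.G3 z = V.R0 z + HyperellipticSurface.evalXY F z) ∧
    -- the full formula for odd degree
    (Odd S.n →
      ((∀ i, HyperellipticSurface.HasProj i V.R0) ∧
        (∀ i j, i ≠ j →
          HyperellipticSurface.HasProj j (HyperellipticSurface.proj i V.R0)) ∧
        (∀ i j k, i ≠ j → i ≠ k → j ≠ k →
          HyperellipticSurface.HasProj k
            (HyperellipticSurface.proj j (HyperellipticSurface.proj i V.R0)))) ∧
      (∀ z : Fin 3 → S.RegularPoint, HyperellipticSurface.Generic z →
        (∀ i j, i ≠ j →
          HyperellipticSurface.proj j (HyperellipticSurface.proj i V.R0) z =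
            HyperellipticSurface.proj i (HyperellipticSurface.proj j V.R0) z) ∧
        (∀ i j k, i ≠ j → i ≠ k → j ≠ k →
          HyperellipticSurface.proj k
              (HyperellipticSurface.proj j (HyperellipticSurface.proj i V.R0)) z =
            HyperellipticSurface.proj 2
              (HyperellipticSurface.proj 1 (HyperellipticSurface.proj 0 V.R0)) z)) ∧
      ∃ F : Finset (Fin 3) → MvPolynomial (Fin 3) ℂ,
        (∀ z : Fin 3 → S.RegularPoint, HyperellipticSurface.Generic z →
          V.G3 z =
            V.R0 z
            - HyperellipticSurface.proj 0 V.R0 z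
            + HyperellipticSurface.proj 1 (HyperellipticSurface.proj 0 V.R0) z
            - HyperellipticSurface.proj 1 V.R0 z
            + HyperellipticSurface.proj 2 (HyperellipticSurface.proj 1 V.R0) z
            - HyperellipticSurface.proj 2 V.R0 z
            + HyperellipticSurface.proj 2 (HyperellipticSurface.proj 0 V.R0) z
            - HyperellipticSurface.proj 2
                (HyperellipticSurface.proj 1 (HyperellipticSurface.proj 0 V.R0)) z
            + HyperellipticSurface.galoisSum F 0 z
            + HyperellipticSurface.galoisSum F 1 z
            + HyperellipticSurface.galoisSum F 2 z
            + HyperellipticSurface.galoisSum F 3 z) ∧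
        (∀ s, ∀ m ∈ (F s).support, ∀ k,
          (k ∈ s → (m k : ℤ) ≤ ((S.n : ℤ) - 1) / 2 - 3) ∧
          (k ∉ s → (m k : ℤ) ≤ (S.n : ℤ) - 3)) ∧
        (F ∅).IsSymmetric ∧ (F Finset.univ).IsSymmetric ∧
        (∀ (σ : Equiv.Perm (Fin 3)) (z : Fin 3 → S.RegularPoint),
          HyperellipticSurface.galoisSum F 1 (z ∘ σ) = HyperellipticSurface.galoisSum F 1 z ∧
          HyperellipticSurface.galoisSum F 2 (z ∘ σ) =
            HyperellipticSurface.galoisSum F 2 z)) := by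
  obtain ⟨a, ha, hperm⟩ := (V.isPolyFun_G3_sub_R0 hV).exists_symmetric fun σ z hz => by
    rw [V.G3_comp_perm σ hz, V.R0_comp_perm hV σ hz]
  refine ⟨fun hn _ _ hne => V.isBigO_G3 hV hn hne,
    ⟨V.isRationalFun_R0 hV, fun σ _ hz => V.R0_comp_perm hV σ hz, ?_⟩, fun hn => ?_⟩
  · obtain ⟨F, hF⟩ := (V.isPolyFun_G3_sub_R0 hV).exists_evalXY Function.injective_id
    exact ⟨F, fun z hz => eq_add_of_sub_eq' (hF z hz)⟩
  have hF := HyperellipticSurface.rename_yCoeff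
    (HyperellipticSurface.filter_isLow_permExponent (S := S) hperm)
  refine ⟨⟨fun i => (V.hasProjTo_R0 hV hn ha i).hasProj,
      fun i j _ => (V.hasProjTo_proj_R0 hV hn ha i j).hasProj,
      fun i j k _ _ _ => (V.hasProjTo_proj_proj_R0 hV hn ha i j k).hasProj⟩,
    fun z hz => ⟨fun i j _ => V.proj_proj_R0_comm hV hn ha hz i j,
      fun _ _ _ hij hik hjk => V.proj_proj_proj_R0_eq hV hn ha hz hij hik hjk⟩,
    HyperellipticSurface.yCoeff (a.filter S.IsLow),
    fun z hz => V.G3_eq_R0_sub_proj_add_galoisSum hV hn ha hz,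
    fun _ _ hm k => (HyperellipticSurface.isLow_of_mem_support_yCoeff hm).snd_apply_le hn k,
    fun σ => hF σ ∅, fun σ => (hF σ Finset.univ).trans (by rw [Finset.map_univ_equiv]),
    fun σ z => ⟨HyperellipticSurface.galoisSum_comp_perm (hF σ) 1 z,
      HyperellipticSurface.galoisSum_comp_perm (hF σ) 2 z⟩⟩
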